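/- Let $L=\{l_1,\dots,l_n\}$ be a set of $n$ pairwise disjoint, parallel line segments of equal length in the plane (one-point segments are allowed). A *placement* chooses a point $p_i\in l_i$ for every $i$; let $T_{\max}(p)$ be the largest area of a (possibly degenerate) triangle $p_ip_jp_k$ with $i,j,k$ distinct. The problem **MaxMaxArea** asks for the maximum of $T_{\max}(p)$ over all placements. Let $Z$ be the set of all endpoints of the segments and $C_0$ the convex hull of $Z$. A triangle is *true* if its three vertices lie on three distinct segments of $L$. The upper endpoints are taken with respect to one of the two orientations of the common direction of the segments. 1. If the upper endpoints of the segments are not all collinear, then every triangle of largest area among the triangles with vertices in $Z$ is a true triangle, and there is a true triangle whose vertices are vertices of $C_0$ and whose area is the answer to MaxMaxArea. 2. If $n\ge 3$ (whether or not the upper endpoints are collinear), MaxMaxArea reduces to the largest triangle inscribed in the convex hull: a number is the answer to MaxMaxArea if and only if it is the largest area of a triangle with all its vertices in $C_0$. 3. MaxMaxArea can be solved in $O(n\log n)$ time: there is a single program for the real RAM (exact real arithmetic $+,-,\times,/$ with rational constants and comparisons of reals; addition, truncated subtraction, halving and comparisons of natural numbers; indirectly addressed arrays; unit cost for each operation)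 and a function $T(n)=O(n\log n)$ such that, for every $n\ge 3$ and every such $L$, given by the coordinates of the two endpoints (in any order) of each segment, the program halts after at most $T(n)$ steps and outputs the answer to MaxMaxArea together with the vertices of a true triangle of this area. -/

import Mathlib

open scoped Asymptotics

noncomputable section

namespace ImpreciseTriangle

/-! ### Geometry -/

/-- The Euclidean plane. -/
abbrev Plane : Type := EuclideanSpace ℝ (Fin 2)

/-- The area of the (possibly degenerate) triangle `p q r`, by the shoelace formula. -/
def triangleArea (p q r : Plane) : ℝ :=
  |(q 0 - p 0) * (r 1 - p 1) - (q 1 - p 1) * (r 0 - p 0)| / 2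

/-- An imprecise point modeled as a line segment, given by its two endpoints, in either order. -/
abbrev Seg : Type := Plane × Plane

/-- The set of points of the segment (with its endpoints). -/
def Seg.carrier (s : Seg) : Set Plane := segment ℝ s.1 s.2

/-- Every segment of `L` is parallel to the vector `d` (a one-point segment is parallel to all). -/
def ParallelTo {n : ℕ} (d : Plane) (L : Fin n → Seg) : Prop :=
  ∀ i, ∃ c : ℝ, (L i).2 - (L i).1 = c • d

/-- All the segments have the same length. -/
def EqualLength {n : ℕ} (L : Fin n → Seg) : Prop :=
  ∀ i j, dist (L i).1 (L i).2 = dist (L j).1 (L j).2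

/-- The segments are pairwise disjoint. -/
def PairwiseDisjoint {n : ℕ} (L : Fin n → Seg) : Prop :=
  ∀ i j, i ≠ j → Disjoint (L i).carrier (L j).carrier

/-- The upper endpoint of `s`, where `d` is the direction that is called "up". -/
def Seg.upper (d : Plane) (s : Seg) : Plane :=
  if 0 ≤ inner ℝ d (s.2 - s.1) then s.2 else s.1

/-- The set `Z` of all endpoints. -/
def endpoints {n : ℕ} (L : Fin n → Seg) : Set Plane :=
  {z | ∃ i, z = (L i).1 ∨ z = (L i).2}

/-- The convex hull `C₀` of the set of endpoints. -/
def hull {n : ℕ} (L : Fin n → Seg) : Set Plane := convexHull ℝ (endpoints L)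

/-- `p q r` is a true triangle: its vertices lie on three distinct segments. -/
def IsTrueTriangle {n : ℕ} (L : Fin n → Seg) (p q r : Plane) : Prop :=
  ∃ i j k, i ≠ j ∧ j ≠ k ∧ i ≠ k ∧
    p ∈ (L i).carrier ∧ q ∈ (L j).carrier ∧ r ∈ (L k).carrier

/-- `P` is a possible position of the imprecise points: one point on each segment. -/
def IsPlacement {n : ℕ} (L : Fin n → Seg) (P : Fin n → Plane) : Prop :=
  ∀ i, P i ∈ (L i).carrier

/-- `A` is the area of a largest-area triangle `T_max` on the points of `P`. -/
def IsLargestTriangleArea {n : ℕ} (P : Fin n → Plane) (A : ℝ) : Prop :=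
  IsGreatest {a | ∃ i j k, i ≠ j ∧ j ≠ k ∧ i ≠ k ∧ a = triangleArea (P i) (P j) (P k)} A

/-- `M` is the answer to the problem MaxMaxArea: the largest possible area of `T_max`,
over all possible positions of the imprecise points. -/
def IsMaxMaxArea {n : ℕ} (L : Fin n → Seg) (M : ℝ) : Prop :=
  IsGreatest {A | ∃ P, IsPlacement L P ∧ IsLargestTriangleArea P A} M

/-- The areas of the triangles with all three vertices in the set `S`. -/
def triangleAreasIn (S : Set Plane) : Set ℝ :=
  {a | ∃ p ∈ S, ∃ q ∈ S, ∃ r ∈ S, a = triangleArea p q r}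

/-! ### The real RAM

A program is a finite object; it uses finitely many integer and real registers and finitely many
integer and real arrays, all of them addressed by fixed names, and array cells are addressed by
computed natural numbers. Real numbers can be combined by the four arithmetic operations and
compared, at unit cost; there is no rounding and no conversion of reals to integers. The only
real constants are rational numbers. -/

/-- The content of the memory. -/
structure RAMState where
  /-- natural-number registers -/
  nreg : ℕ → ℕ
  /-- real registers -/
  rreg : ℕ → ℝ
  /-- natural-number arrays: name of the array, then index of the cell -/
  narr : ℕ → ℕ → ℕ
  /-- real arrays: name of the array, then index of the cell -/
  rarr : ℕ → ℕ → ℝ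

/-- Expressions with natural-number values (used for counting and for addresses). -/
inductive NExpr : Type
  | const (k : ℕ)
  | reg (v : ℕ)
  | get (a : ℕ) (i : NExpr)
  | add (e f : NExpr)
  | sub (e f : NExpr)
  | half (e : NExpr)

/-- The value of an expression; subtraction is truncated at `0`, halving rounds down. -/
def NExpr.eval (s : RAMState) : NExpr → ℕ
  | const k => k
  | reg v => s.nreg v
  | get a i => s.narr a (i.eval s)
  | add e f => e.eval s + f.eval s
  | sub e f => e.eval s - f.eval s
  | half e => e.eval s / 2

/-- The number of operations that the evaluation takes. -/
def NExpr.cost : NExpr → ℕ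
  | const _ => 1
  | reg _ => 1
  | get _ i => i.cost + 1
  | add e f => e.cost + f.cost + 1
  | sub e f => e.cost + f.cost + 1
  | half e => e.cost + 1

/-- Expressions with real values. -/
inductive RExpr : Type
  | const (q : ℚ)
  | reg (v : ℕ)
  | get (a : ℕ) (i : NExpr)
  | add (e f : RExpr)
  | sub (e f : RExpr)
  | mul (e f : RExpr)
  | div (e f : RExpr)

/-- The value of an expression; a quotient by `0` has the value `0`. -/
def RExpr.eval (s : RAMState) : RExpr → ℝ
  | const q => (q : ℝ)
  | reg v => s.rreg v
  | get a i => s.rarr a (i.eval s)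
  | add e f => e.eval s + f.eval s
  | sub e f => e.eval s - f.eval s
  | mul e f => e.eval s * f.eval s
  | div e f => e.eval s / f.eval s

/-- The number of operations that the evaluation takes. -/
def RExpr.cost : RExpr → ℕ
  | const _ => 1
  | reg _ => 1
  | get _ i => i.cost + 1
  | add e f => e.cost + f.cost + 1
  | sub e f => e.cost + f.cost + 1
  | mul e f => e.cost + f.cost + 1
  | div e f => e.cost + f.cost + 1

/-- Tests. -/
inductive Test : Type
  | nle (e f : NExpr)
  | rle (e f : RExpr)
  | neg (b : Test)
  | and (b c : Test)

/-- The test `b` succeeds in the state `s`. -/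
def Test.Holds (s : RAMState) : Test → Prop
  | nle e f => e.eval s ≤ f.eval s
  | rle e f => e.eval s ≤ f.eval s
  | neg b => ¬ b.Holds s
  | and b c => b.Holds s ∧ c.Holds s

/-- The number of operations that the test takes. -/
def Test.cost : Test → ℕ
  | nle e f => e.cost + f.cost + 1
  | rle e f => e.cost + f.cost + 1
  | neg b => b.cost + 1
  | and b c => b.cost + c.cost + 1

/-- Programs of the real RAM. -/
inductive Prog : Type
  | skip
  | nset (v : ℕ) (e : NExpr)
  | rset (v : ℕ) (e : RExpr)
  | nput (a : ℕ) (i e : NExpr)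
  | rput (a : ℕ) (i : NExpr) (e : RExpr)
  | seq (c d : Prog)
  | branch (b : Test) (c d : Prog)
  | loop (b : Test) (c : Prog)

/-- `Exec c s t s'`: the program `c`, started in the state `s`, halts after exactly `t` steps
in the state `s'`. -/
inductive Exec : Prog → RAMState → ℕ → RAMState → Prop
  | skip (s : RAMState) : Exec .skip s 1 s
  | nset (s : RAMState) (v : ℕ) (e : NExpr) :
      Exec (.nset v e) s (e.cost + 1)
        { s with nreg := Function.update s.nreg v (e.eval s) }
  | rset (s : RAMState) (v : ℕ) (e : RExpr) :
      Exec (.rset v e) s (e.cost + 1)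
        { s with rreg := Function.update s.rreg v (e.eval s) }
  | nput (s : RAMState) (a : ℕ) (i e : NExpr) :
      Exec (.nput a i e) s (i.cost + e.cost + 1)
        { s with narr := Function.update s.narr a
                  (Function.update (s.narr a) (i.eval s) (e.eval s)) }
  | rput (s : RAMState) (a : ℕ) (i : NExpr) (e : RExpr) :
      Exec (.rput a i e) s (i.cost + e.cost + 1)
        { s with rarr := Function.update s.rarr a
                  (Function.update (s.rarr a) (i.eval s) (e.eval s)) }
  | seq {c d : Prog} {s s' s'' : RAMState} {t t' : ℕ} :
      Exec c s t s' → Exec d s' t' s'' → Exec (.seq c d) s (t + t') s''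
  | branch_true {b : Test} {c d : Prog} {s s' : RAMState} {t : ℕ} :
      b.Holds s → Exec c s t s' → Exec (.branch b c d) s (b.cost + t + 1) s'
  | branch_false {b : Test} {c d : Prog} {s s' : RAMState} {t : ℕ} :
      ¬ b.Holds s → Exec d s t s' → Exec (.branch b c d) s (b.cost + t + 1) s'
  | loop_done {b : Test} {c : Prog} {s : RAMState} :
      ¬ b.Holds s → Exec (.loop b c) s (b.cost + 1) s
  | loop_again {b : Test} {c : Prog} {s s' s'' : RAMState} {t t' : ℕ} :
      b.Holds s → Exec c s t s' → Exec (.loop b c) s' t' s'' →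
        Exec (.loop b c) s (b.cost + t + t' + 1) s''

/-- The initial state for the input `L`: the integer register `0` holds the number `n` of
segments; the cells `i < n` of the real arrays `0`, `1`, `2`, `3` hold the two coordinates of the
first and the two coordinates of the second endpoint of the `i`-th segment; all other memory
cells hold `0`. -/
def initState {n : ℕ} (L : Fin n → Seg) : RAMState where
  nreg v := if v = 0 then n else 0
  rreg _ := 0
  narr _ _ := 0
  rarr a i :=
    if h : i < n then
      if a = 0 then (L ⟨i, h⟩).1 0
      else if a = 1 then (L ⟨i, h⟩).1 1
      else if a = 2 then (L ⟨i, h⟩).2 0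
      else if a = 3 then (L ⟨i, h⟩).2 1
      else 0
    else 0

/-- The memory `s` holds a correct output for MaxMaxArea on `L`: the real register `0` holds the
optimal value, and the real registers `1` to `6` hold the coordinates of the three vertices of a
true triangle that has this area. -/
def IsOutput {n : ℕ} (L : Fin n → Seg) (s : RAMState) : Prop :=
  IsMaxMaxArea L (s.rreg 0) ∧
  IsTrueTriangle L !₂[s.rreg 1, s.rreg 2] !₂[s.rreg 3, s.rreg 4] !₂[s.rreg 5, s.rreg 6] ∧
  triangleArea !₂[s.rreg 1, s.rreg 2] !₂[s.rreg 3, s.rreg 4] !₂[s.rreg 5, s.rreg 6] = s.rreg 0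

end ImpreciseTriangle

end

/-! Geometry. `coord` is a similarity that makes every segment vertical, with lower endpoint `(X i,
Y i)` and common height `h`. For three segments in order from left to right, the signed area is
affine in each height, increasing in the middle one and decreasing in the outer two. Its extremes
are therefore the triangle lower-upper-lower and its mirror image upper-lower-upper
(`abs_cr_le_of_sorted`). Write `w` for the horizontal extent of the segments. A triangle that uses a
segment twice has doubled area at most `w * h` (`abs_cr_le_of_not_distinct`). The two alternating
triangles on a leftmost, a rightmost and a third segment have signed doubled areas `w * h + c` and
`w * h - c`, where `c` is the `cr` of the three lower endpoints (`exists_abs_cr_ge`). So for `3 ≤ n`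
some largest triangle on the endpoints is true. If the upper endpoints are not collinear, some `c`
is nonzero, the bound `w * h` is strictly exceeded, and every largest triangle is true. Since area
is convex in each vertex, a largest triangle on the endpoints, or on the extreme points of the hull,
is also largest in the hull. Being true, it can be completed to a placement, and this identifies the
answer.

Algorithm. It suffices to maximise lower-upper-lower triangles, once for the points and once for
their reflection. The outer vertices can be moved to the lower convex chain (`exists_left`,
`exists_right`). Let `W i k` be the best value over the chord from vertex `i` to vertex `k` of that
chain. The convexity of the chain gives an inverse quadrangle inequality for `W`
(`SearchData.monge`), so the leftmost row maxima move monotonically to the right. Rows are treated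
by halving strides, each row only between the best columns of its two solved neighbours. Within a
level the chords only get steeper, so the best upper vertex only moves left, and a single pointer
along the upper chain serves the whole level. A level costs `O(n)` and there are `O(log n)` levels;
merge sort and the construction of the chains fit into the same bound.

Verification. `WP` is a total-correctness predicate that carries a budget of steps. Loop invariants
speak about the credits that are left, so amortised bounds and termination are proved together with
correctness. `Exec.frame` supplies what a program leaves unchanged. -/

noncomputable section

namespace ImpreciseTriangle

attribute [local simp] NExpr.eval NExpr.cost RExpr.eval RExpr.cost Test.Holds Test.cost

/-! ### Program logic with time credits for the real RAM -/

namespace RAMState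

/-- Assign a natural-number register. -/
def setN (s : RAMState) (v x : ℕ) : RAMState := { s with nreg := Function.update s.nreg v x }

/-- Assign a real register. -/
def setR (s : RAMState) (v : ℕ) (x : ℝ) : RAMState :=
  { s with rreg := Function.update s.rreg v x }

/-- Assign a cell of a natural-number array. -/
def putN (s : RAMState) (a i x : ℕ) : RAMState :=
  { s with narr := Function.update s.narr a (Function.update (s.narr a) i x) }

/-- Assign a cell of a real array. -/
def putR (s : RAMState) (a i : ℕ) (x : ℝ) : RAMState :=
  { s with rarr := Function.update s.rarr a (Function.update (s.rarr a) i x) }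

variable (s : RAMState) (v w a b i x : ℕ) (y : ℝ)

@[simp] theorem setN_nreg : (s.setN v x).nreg w = if w = v then x else s.nreg w := by
  simp [setN, Function.update_apply]
@[simp] theorem setN_rreg : (s.setN v x).rreg = s.rreg := rfl
@[simp] theorem setN_narr : (s.setN v x).narr = s.narr := rfl
@[simp] theorem setN_rarr : (s.setN v x).rarr = s.rarr := rfl
@[simp] theorem setR_nreg : (s.setR v y).nreg = s.nreg := rfl
@[simp] theorem setR_rreg : (s.setR v y).rreg w = if w = v then y else s.rreg w := by
  simp [setR, Function.update_apply]
@[simp] theorem setR_narr : (s.setR v y).narr = s.narr := rfl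
@[simp] theorem setR_rarr : (s.setR v y).rarr = s.rarr := rfl
@[simp] theorem putN_nreg : (s.putN a i x).nreg = s.nreg := rfl
@[simp] theorem putN_rreg : (s.putN a i x).rreg = s.rreg := rfl
@[simp] theorem putN_narr :
    (s.putN a i x).narr b = if b = a then Function.update (s.narr a) i x else s.narr b := by
  simp [putN, Function.update_apply]
@[simp] theorem putN_rarr : (s.putN a i x).rarr = s.rarr := rfl
@[simp] theorem putR_nreg : (s.putR a i y).nreg = s.nreg := rfl
@[simp] theorem putR_rreg : (s.putR a i y).rreg = s.rreg := rfl
@[simp] theorem putR_narr : (s.putR a i y).narr = s.narr := rfl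
@[simp] theorem putR_rarr :
    (s.putR a i y).rarr b = if b = a then Function.update (s.rarr a) i y else s.rarr b := by
  simp [putR, Function.update_apply]

end RAMState

/-- `WP c Q s k`: from the state `s` the program `c` halts within `k` steps, and `Q` holds of the
final state and of the number of steps that are left. -/
def WP (c : Prog) (Q : RAMState → ℕ → Prop) (s : RAMState) (k : ℕ) : Prop :=
  ∃ t s', Exec c s t s' ∧ t ≤ k ∧ Q s' (k - t)

section rules
variable {Q Q' : RAMState → ℕ → Prop} {s : RAMState} {k : ℕ}

theorem WP.skip (h : 1 ≤ k ∧ Q s (k - 1)) : WP .skip Q s k :=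
  ⟨_, _, .skip s, h.1, h.2⟩

theorem WP.nset {v : ℕ} {e : NExpr}
    (h : e.cost + 1 ≤ k ∧ Q (s.setN v (e.eval s)) (k - (e.cost + 1))) : WP (.nset v e) Q s k :=
  ⟨_, _, .nset s v e, h.1, h.2⟩

theorem WP.rset {v : ℕ} {e : RExpr}
    (h : e.cost + 1 ≤ k ∧ Q (s.setR v (e.eval s)) (k - (e.cost + 1))) : WP (.rset v e) Q s k :=
  ⟨_, _, .rset s v e, h.1, h.2⟩

theorem WP.nput {a : ℕ} {i e : NExpr}
    (h : i.cost + e.cost + 1 ≤ k ∧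
      Q (s.putN a (i.eval s) (e.eval s)) (k - (i.cost + e.cost + 1))) : WP (.nput a i e) Q s k :=
  ⟨_, _, .nput s a i e, h.1, h.2⟩

theorem WP.rput {a : ℕ} {i : NExpr} {e : RExpr}
    (h : i.cost + e.cost + 1 ≤ k ∧
      Q (s.putR a (i.eval s) (e.eval s)) (k - (i.cost + e.cost + 1))) : WP (.rput a i e) Q s k :=
  ⟨_, _, .rput s a i e, h.1, h.2⟩

theorem WP.seq {c d : Prog} (h : WP c (WP d Q) s k) : WP (.seq c d) Q s k := by
  obtain ⟨t, s', h1, h2, t', s'', h3, h4, h5⟩ := h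
  exact ⟨_, _, .seq h1 h3, by omega, by rwa [← Nat.sub_sub]⟩

theorem WP.branch {b : Test} {c d : Prog}
    (h : b.cost + 1 ≤ k ∧ (b.Holds s → WP c Q s (k - (b.cost + 1))) ∧
      (¬ b.Holds s → WP d Q s (k - (b.cost + 1)))) : WP (.branch b c d) Q s k := by
  obtain ⟨h0, h1, h2⟩ := h
  by_cases hb : b.Holds s
  · obtain ⟨t, s', e1, e2, e3⟩ := h1 hb
    refine ⟨_, _, .branch_true hb e1, by omega, ?_⟩
    rwa [show k - (b.cost + t + 1) = k - (b.cost + 1) - t by omega]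
  · obtain ⟨t, s', e1, e2, e3⟩ := h2 hb
    refine ⟨_, _, .branch_false hb e1, by omega, ?_⟩
    rwa [show k - (b.cost + t + 1) = k - (b.cost + 1) - t by omega]

theorem WP.mono {c : Prog} (h : WP c Q s k) (hQ : ∀ s' k', Q s' k' → Q' s' k') :
    WP c Q' s k := by
  obtain ⟨t, s', h1, h2, h3⟩ := h
  exact ⟨t, s', h1, h2, hQ _ _ h3⟩

end rules

namespace Prog

/-- The program may write the natural-number register `v`. -/
def writesN (v : ℕ) : Prog → Bool
  | nset w _ => w == v
  | seq c d => c.writesN v || d.writesN v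
  | branch _ c d => c.writesN v || d.writesN v
  | loop _ c => c.writesN v
  | _ => false

/-- The program may write the real register `v`. -/
def writesR (v : ℕ) : Prog → Bool
  | rset w _ => w == v
  | seq c d => c.writesR v || d.writesR v
  | branch _ c d => c.writesR v || d.writesR v
  | loop _ c => c.writesR v
  | _ => false

/-- The program may write the natural-number array `a`. -/
def writesNA (a : ℕ) : Prog → Bool
  | nput b _ _ => b == a
  | seq c d => c.writesNA a || d.writesNA a
  | branch _ c d => c.writesNA a || d.writesNA a
  | loop _ c => c.writesNA a
  | _ => false

/-- The program may write the real array `a`. -/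
def writesRA (a : ℕ) : Prog → Bool
  | rput b _ _ => b == a
  | seq c d => c.writesRA a || d.writesRA a
  | branch _ c d => c.writesRA a || d.writesRA a
  | loop _ c => c.writesRA a
  | _ => false

end Prog

/-- The states `s` and `s'` agree on everything that `c` does not write. -/
structure Frame (c : Prog) (s s' : RAMState) : Prop where
  n : ∀ v, c.writesN v = false → s'.nreg v = s.nreg v
  r : ∀ v, c.writesR v = false → s'.rreg v = s.rreg v
  na : ∀ a, c.writesNA a = false → s'.narr a = s.narr a
  ra : ∀ a, c.writesRA a = false → s'.rarr a = s.rarr a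

theorem Frame.refl (c : Prog) (s : RAMState) : Frame c s s :=
  ⟨fun _ _ => rfl, fun _ _ => rfl, fun _ _ => rfl, fun _ _ => rfl⟩

theorem Frame.trans {c : Prog} {s s' s'' : RAMState} (h : Frame c s s') (h' : Frame c s' s'') :
    Frame c s s'' :=
  ⟨fun v hv => (h'.n v hv).trans (h.n v hv), fun v hv => (h'.r v hv).trans (h.r v hv),
    fun v hv => (h'.na v hv).trans (h.na v hv), fun v hv => (h'.ra v hv).trans (h.ra v hv)⟩

theorem Frame.of_le {c d : Prog} {s s' : RAMState} (h : Frame c s s')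
    (hn : ∀ v, d.writesN v = false → c.writesN v = false)
    (hr : ∀ v, d.writesR v = false → c.writesR v = false)
    (hna : ∀ v, d.writesNA v = false → c.writesNA v = false)
    (hra : ∀ v, d.writesRA v = false → c.writesRA v = false) : Frame d s s' :=
  ⟨fun v hv => h.n v (hn v hv), fun v hv => h.r v (hr v hv),
    fun v hv => h.na v (hna v hv), fun v hv => h.ra v (hra v hv)⟩

/-- Being written is a syntactic, computable property. For a concrete program and a concrete
register the side condition is therefore closed by `rfl`, and loop invariants need not mention
unchanged memory. -/
theorem Exec.frame {c : Prog} {s s' : RAMState} {t : ℕ} (h : Exec c s t s') : Frame c s s' := by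
  induction h with
  | skip s => exact .refl _ s
  | nset s v e =>
    refine ⟨fun w hw => ?_, fun _ _ => rfl, fun _ _ => rfl, fun _ _ => rfl⟩
    exact Function.update_of_ne (by rintro rfl; simp [Prog.writesN] at hw) _ _
  | rset s v e =>
    refine ⟨fun _ _ => rfl, fun w hw => ?_, fun _ _ => rfl, fun _ _ => rfl⟩
    exact Function.update_of_ne (by rintro rfl; simp [Prog.writesR] at hw) _ _
  | nput s v i e =>
    refine ⟨fun _ _ => rfl, fun _ _ => rfl, fun w hw => ?_, fun _ _ => rfl⟩
    exact Function.update_of_ne (by rintro rfl; simp [Prog.writesNA] at hw) _ _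
  | rput s v i e =>
    refine ⟨fun _ _ => rfl, fun _ _ => rfl, fun _ _ => rfl, fun w hw => ?_⟩
    exact Function.update_of_ne (by rintro rfl; simp [Prog.writesRA] at hw) _ _
  | seq _ _ h1 h2 =>
    refine (h1.of_le ?_ ?_ ?_ ?_).trans (h2.of_le ?_ ?_ ?_ ?_) <;> intro v <;>
      simp +contextual [Prog.writesN, Prog.writesR, Prog.writesNA, Prog.writesRA]
  | branch_true _ _ h1 =>
    refine h1.of_le ?_ ?_ ?_ ?_ <;> intro v <;>
      simp +contextual [Prog.writesN, Prog.writesR, Prog.writesNA, Prog.writesRA]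
  | branch_false _ _ h1 =>
    refine h1.of_le ?_ ?_ ?_ ?_ <;> intro v <;>
      simp +contextual [Prog.writesN, Prog.writesR, Prog.writesNA, Prog.writesRA]
  | loop_done _ => exact .refl _ _
  | loop_again _ _ _ h1 h2 =>
    refine (h1.of_le ?_ ?_ ?_ ?_).trans h2 <;> intro v <;>
      simp [Prog.writesN, Prog.writesR, Prog.writesNA, Prog.writesRA]

theorem WP.frame {c : Prog} {Q : RAMState → ℕ → Prop} {s : RAMState} {k : ℕ} (h : WP c Q s k) :
    WP c (fun s' k' => Q s' k' ∧ Frame c s s') s k := by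
  obtain ⟨t, s', h1, h2, h3⟩ := h
  exact ⟨t, s', h1, h2, h3, h1.frame⟩

/-- The rule for loops; the credits ensure termination. -/
theorem WP.loop {b : Test} {c : Prog} {Q : RAMState → ℕ → Prop} (I : RAMState → ℕ → Prop)
    {s : RAMState} {k : ℕ} (h0 : I s k)
    (step : ∀ s' k', Frame c s s' → I s' k' → b.cost + 1 ≤ k' ∧
      (b.Holds s' → WP c I s' (k' - (b.cost + 1))) ∧
      (¬ b.Holds s' → Q s' (k' - (b.cost + 1)))) : WP (.loop b c) Q s k := by
  -- Each round spends at least one credit on the test, so strong induction on the remaining credits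
  -- replaces a separate termination measure.
  have main : ∀ k' s', Frame c s s' → I s' k' → WP (.loop b c) Q s' k' := by
    intro k'
    induction k' using Nat.strong_induction_on with
    | _ k' ih =>
      intro s' hF hI
      obtain ⟨h1, h2, h3⟩ := step s' k' hF hI
      by_cases hb : b.Holds s'
      · obtain ⟨t, s1, e1, e2, e3⟩ := h2 hb
        obtain ⟨t', s2, f1, f2, f3⟩ := ih (k' - (b.cost + 1) - t) (by omega) s1
          (hF.trans e1.frame) e3
        refine ⟨_, _, .loop_again hb e1 f1, by omega, ?_⟩
        rwa [show k' - (b.cost + t + t' + 1) = k' - (b.cost + 1) - t - t' by omega]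
      · exact ⟨_, _, .loop_done hb, h1, h3 hb⟩
  exact main k s (.refl _ _) h0

/-! ### Merge sort -/

/-- The points stored in the cells `lo ≤ u < hi` of two coordinate arrays. -/
def pts (X Y : ℕ → ℝ) (lo hi : ℕ) : Set (ℝ × ℝ) := {q | ∃ u, lo ≤ u ∧ u < hi ∧ q = (X u, Y u)}

theorem pts_self (X Y : ℕ → ℝ) (lo : ℕ) : pts X Y lo lo = ∅ := by
  ext q; simp only [pts, Set.mem_ofPred_eq, Set.mem_empty_iff_false, iff_false]
  rintro ⟨u, h1, h2, -⟩; omega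

theorem pts_succ (X Y : ℕ → ℝ) {lo t : ℕ} (h : lo ≤ t) :
    pts X Y lo (t + 1) = insert (X t, Y t) (pts X Y lo t) := by
  ext q; simp only [pts, Set.mem_ofPred_eq, Set.mem_insert_iff]
  constructor
  · rintro ⟨u, h1, h2, rfl⟩
    rcases Nat.lt_succ_iff_lt_or_eq.mp h2 with h3 | rfl
    · exact Or.inr ⟨u, h1, h3, rfl⟩
    · exact Or.inl rfl
  · rintro (rfl | ⟨u, h1, h2, rfl⟩)
    · exact ⟨t, h, by omega, rfl⟩
    · exact ⟨u, h1, by omega, rfl⟩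

theorem pts_union (X Y : ℕ → ℝ) {lo mid hi : ℕ} (h : lo ≤ mid) (h' : mid ≤ hi) :
    pts X Y lo mid ∪ pts X Y mid hi = pts X Y lo hi := by
  ext q; simp only [pts, Set.mem_ofPred_eq, Set.mem_union]
  constructor
  · rintro (⟨u, h1, h2, rfl⟩ | ⟨u, h1, h2, rfl⟩)
    · exact ⟨u, h1, by omega, rfl⟩
    · exact ⟨u, by omega, h2, rfl⟩
  · rintro ⟨u, h1, h2, rfl⟩
    rcases lt_or_ge u mid with h3 | h3
    · exact Or.inl ⟨u, h1, h3, rfl⟩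
    · exact Or.inr ⟨u, h3, h2, rfl⟩

theorem pts_congr {X Y X' Y' : ℕ → ℝ} {lo hi : ℕ}
    (h : ∀ u, lo ≤ u → u < hi → X u = X' u ∧ Y u = Y' u) : pts X Y lo hi = pts X' Y' lo hi := by
  ext q; simp only [pts, Set.mem_ofPred_eq]
  constructor <;> rintro ⟨u, h1, h2, rfl⟩ <;> exact ⟨u, h1, h2, by simp [h u h1 h2]⟩

namespace Code

/-- One step of merging: move the smaller head of the runs `[i, mid)` and `[j, hi)`. -/
def mergeStep : Prog :=
  .seq (.branch (.and (.nle (.add (.reg 5) (.const 1)) (.reg 3))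
      (.neg (.and (.nle (.add (.reg 6) (.const 1)) (.reg 4))
        (.neg (.rle (.get 4 (.reg 5)) (.get 4 (.reg 6)))))))
    (.seq (.rput 6 (.reg 7) (.get 4 (.reg 5))) (.seq (.rput 7 (.reg 7) (.get 5 (.reg 5)))
      (.nset 5 (.add (.reg 5) (.const 1)))))
    (.seq (.rput 6 (.reg 7) (.get 4 (.reg 6))) (.seq (.rput 7 (.reg 7) (.get 5 (.reg 6)))
      (.nset 6 (.add (.reg 6) (.const 1))))))
    (.nset 7 (.add (.reg 7) (.const 1)))

/-- Merge two adjacent runs into the auxiliary arrays. -/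
def mergeRuns : Prog := .loop (.nle (.add (.reg 7) (.const 1)) (.reg 4)) mergeStep

/-- Merge all pairs of adjacent runs of length `w`. -/
def mergeLevel : Prog :=
  .loop (.nle (.add (.reg 2) (.const 1)) (.reg 0))
    (.seq (.nset 3 (.sub (.add (.reg 2) (.reg 1)) (.sub (.add (.reg 2) (.reg 1)) (.reg 0))))
    (.seq (.nset 4 (.sub (.add (.reg 2) (.add (.reg 1) (.reg 1)))
      (.sub (.add (.reg 2) (.add (.reg 1) (.reg 1))) (.reg 0))))
    (.seq (.nset 5 (.reg 2)) (.seq (.nset 6 (.reg 3)) (.seq (.nset 7 (.reg 2))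
    (.seq mergeRuns (.nset 2 (.add (.reg 2) (.add (.reg 1) (.reg 1))))))))))

/-- Copy the auxiliary arrays back. -/
def copyBack : Prog :=
  .loop (.nle (.add (.reg 7) (.const 1)) (.reg 0))
    (.seq (.rput 4 (.reg 7) (.get 6 (.reg 7))) (.seq (.rput 5 (.reg 7) (.get 7 (.reg 7)))
      (.nset 7 (.add (.reg 7) (.const 1)))))

/-- Sort the points by the first coordinate. -/
def sort : Prog :=
  .seq (.nset 1 (.const 1)) (.loop (.nle (.add (.reg 1) (.const 1)) (.reg 0))
    (.seq (.nset 2 (.const 0)) (.seq mergeLevel (.seq (.nset 7 (.const 0)) (.seq copyBack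
      (.nset 1 (.add (.reg 1) (.reg 1))))))))

end Code

/-- The state of a merge: runs `[lo, mid)` and `[mid, hi)` of `X, Y`, heads `i` and `j`, output
`[lo, t)` in `X', Y'`. -/
structure MergeInv (X Y X' Y' : ℕ → ℝ) (lo mid hi i j t : ℕ) : Prop where
  loi : lo ≤ i
  imid : i ≤ mid
  midj : mid ≤ j
  jhi : j ≤ hi
  t_eq : t + mid = i + j
  pts_eq : pts X' Y' lo t = pts X Y lo i ∪ pts X Y mid j
  sorted : ∀ u v, lo ≤ u → u ≤ v → v < t → X' u ≤ X' v
  le_left : ∀ u v, lo ≤ u → u < t → i ≤ v → v < mid → X' u ≤ X v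
  le_right : ∀ u v, lo ≤ u → u < t → j ≤ v → v < hi → X' u ≤ X v

/-- Everything already output is at most everything still waiting in either run, so appending the
smaller head keeps the output sorted. The comparison `hc` is only demanded while the other run is
nonempty. -/
theorem MergeInv.left {X Y X' Y' : ℕ → ℝ} {lo mid hi i j t : ℕ}
    (hI : MergeInv X Y X' Y' lo mid hi i j t)
    (s1 : ∀ u v, lo ≤ u → u ≤ v → v < mid → X u ≤ X v)
    (s2 : ∀ u v, mid ≤ u → u ≤ v → v < hi → X u ≤ X v)
    (hi1 : i < mid) (hc : j < hi → X i ≤ X j) :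
    MergeInv X Y (Function.update X' t (X i)) (Function.update Y' t (Y i)) lo mid hi (i + 1) j
      (t + 1) := by
  obtain ⟨h1, h2, h3, h4, h5, h6, h7, h8, h9⟩ := hI
  refine ⟨by omega, hi1, h3, h4, by omega, ?_, ?_, ?_, ?_⟩
  · rw [pts_succ _ _ (by omega), pts_succ _ _ h1, Set.insert_union, ← h6]
    simp only [Function.update_self]
    congr 1
    refine pts_congr fun u _ hu => ?_
    rw [Function.update_of_ne hu.ne, Function.update_of_ne hu.ne]
    exact ⟨rfl, rfl⟩
  · intro u v hu huv hv
    rcases Nat.lt_succ_iff_lt_or_eq.mp hv with hv | rfl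
    · rw [Function.update_of_ne hv.ne, Function.update_of_ne (by omega)]
      exact h7 u v hu huv hv
    · rw [Function.update_self]
      rcases huv.lt_or_eq with huv | rfl
      · rw [Function.update_of_ne huv.ne]
        exact h8 u i hu huv le_rfl hi1
      · rw [Function.update_self]
  · intro u v hu hut hv hvm
    rcases Nat.lt_succ_iff_lt_or_eq.mp hut with hu2 | rfl
    · rw [Function.update_of_ne hu2.ne]
      exact h8 u v hu hu2 (by omega) hvm
    · rw [Function.update_self]
      exact s1 i v h1 (by omega) hvm
  · intro u v hu hut hv hvm
    rcases Nat.lt_succ_iff_lt_or_eq.mp hut with hu2 | rfl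
    · rw [Function.update_of_ne hu2.ne]
      exact h9 u v hu hu2 (by omega) hvm
    · rw [Function.update_self]
      exact (hc (by omega)).trans (s2 j v h3 hv hvm)

theorem MergeInv.right {X Y X' Y' : ℕ → ℝ} {lo mid hi i j t : ℕ}
    (hI : MergeInv X Y X' Y' lo mid hi i j t)
    (s1 : ∀ u v, lo ≤ u → u ≤ v → v < mid → X u ≤ X v)
    (s2 : ∀ u v, mid ≤ u → u ≤ v → v < hi → X u ≤ X v)
    (hj1 : j < hi) (hc : i < mid → X j ≤ X i) :
    MergeInv X Y (Function.update X' t (X j)) (Function.update Y' t (Y j)) lo mid hi i (j + 1)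
      (t + 1) := by
  obtain ⟨h1, h2, h3, h4, h5, h6, h7, h8, h9⟩ := hI
  refine ⟨by omega, h2, by omega, hj1, by omega, ?_, ?_, ?_, ?_⟩
  · rw [pts_succ _ _ (by omega), pts_succ _ _ h3, Set.union_insert, ← h6]
    simp only [Function.update_self]
    congr 1
    refine pts_congr fun u _ hu => ?_
    rw [Function.update_of_ne hu.ne, Function.update_of_ne hu.ne]
    exact ⟨rfl, rfl⟩
  · intro u v hu huv hv
    rcases Nat.lt_succ_iff_lt_or_eq.mp hv with hv | rfl
    · rw [Function.update_of_ne hv.ne, Function.update_of_ne (by omega)]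
      exact h7 u v hu huv hv
    · rw [Function.update_self]
      rcases huv.lt_or_eq with huv | rfl
      · rw [Function.update_of_ne huv.ne]
        exact h9 u j hu huv le_rfl hj1
      · rw [Function.update_self]
  · intro u v hu hut hv hvm
    rcases Nat.lt_succ_iff_lt_or_eq.mp hut with hu2 | rfl
    · rw [Function.update_of_ne hu2.ne]
      exact h8 u v hu hu2 hv hvm
    · rw [Function.update_self]
      exact (hc (by omega)).trans (s1 i v h1 hv hvm)
  · intro u v hu hut hv hvm
    rcases Nat.lt_succ_iff_lt_or_eq.mp hut with hu2 | rfl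
    · rw [Function.update_of_ne hu2.ne]
      exact h9 u v hu hu2 (by omega) hvm
    · rw [Function.update_self]
      exact s2 j v h3 (by omega) hvm

theorem mergeRuns_spec {lo mid hi : ℕ} {s : RAMState} {k : ℕ} (h1 : lo ≤ mid) (h2 : mid ≤ hi)
    (hmid : s.nreg 3 = mid) (hhi : s.nreg 4 = hi) (hi0 : s.nreg 5 = lo) (hj0 : s.nreg 6 = mid)
    (ht0 : s.nreg 7 = lo)
    (s1 : ∀ u v, lo ≤ u → u ≤ v → v < mid → s.rarr 4 u ≤ s.rarr 4 v)
    (s2 : ∀ u v, mid ≤ u → u ≤ v → v < hi → s.rarr 4 u ≤ s.rarr 4 v)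
    (hk : 60 * (hi - lo) + 10 ≤ k) :
    WP Code.mergeRuns (fun s' k' => k ≤ k' + 60 * (hi - lo) + 10 ∧
      (∀ u, u < lo ∨ hi ≤ u → s'.rarr 6 u = s.rarr 6 u ∧ s'.rarr 7 u = s.rarr 7 u) ∧
      pts (s'.rarr 6) (s'.rarr 7) lo hi = pts (s.rarr 4) (s.rarr 5) lo hi ∧
      (∀ u v, lo ≤ u → u ≤ v → v < hi → s'.rarr 6 u ≤ s'.rarr 6 v)) s k := by
  refine WP.loop (fun s' k' => k ≤ k' + 60 * (s'.nreg 7 - lo) ∧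
    (∀ u, u < lo ∨ hi ≤ u → s'.rarr 6 u = s.rarr 6 u ∧ s'.rarr 7 u = s.rarr 7 u) ∧
    MergeInv (s.rarr 4) (s.rarr 5) (s'.rarr 6) (s'.rarr 7) lo mid hi (s'.nreg 5) (s'.nreg 6)
      (s'.nreg 7)) ?_ ?_
  · refine ⟨by omega, fun _ _ => ⟨rfl, rfl⟩, ?_⟩
    rw [hi0, hj0, ht0]
    exact ⟨le_rfl, h1, le_rfl, h2, by omega, by simp [pts_self], by omega, by omega, by omega⟩
  · rintro s' k' hF ⟨hk', hout, hI⟩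
    have e4 : s'.rarr 4 = s.rarr 4 := hF.ra 4 rfl
    have e5 : s'.rarr 5 = s.rarr 5 := hF.ra 5 rfl
    have e3 : s'.nreg 3 = mid := (hF.n 3 rfl).trans hmid
    have ehi : s'.nreg 4 = hi := (hF.n 4 rfl).trans hhi
    have := hI.loi
    have := hI.imid
    have := hI.midj
    have := hI.jhi
    have := hI.t_eq
    simp only [Test.cost, NExpr.cost, Test.Holds, NExpr.eval, ehi]
    refine ⟨by omega, fun hb => ?_, fun hb => ?_⟩
    · refine WP.seq (WP.branch ⟨by simp; omega, fun hc => ?_, fun hc => ?_⟩)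
      · simp only [Test.Holds, NExpr.eval, RExpr.eval, e3, ehi, e4] at hc
        refine WP.seq (WP.rput ⟨by simp; omega, WP.seq (WP.rput ⟨by simp; omega,
          WP.nset ⟨by simp; omega, WP.nset ⟨by simp; omega, ?_⟩⟩⟩)⟩)
        simp [e4, e5]
        refine ⟨by omega, fun u hu => ?_, ?_⟩
        · rw [Function.update_of_ne (by omega), Function.update_of_ne (by omega)]
          exact hout u hu
        · refine hI.left s1 s2 (by omega) fun hj => ?_
          by_contra h
          exact hc.2 ⟨hj, h⟩
      · simp only [Test.Holds, NExpr.eval, RExpr.eval, e3, ehi, e4] at hc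
        refine WP.seq (WP.rput ⟨by simp; omega, WP.seq (WP.rput ⟨by simp; omega,
          WP.nset ⟨by simp; omega, WP.nset ⟨by simp; omega, ?_⟩⟩⟩)⟩)
        simp [e4, e5]
        refine ⟨by omega, fun u hu => ?_, ?_⟩
        · rw [Function.update_of_ne (by omega), Function.update_of_ne (by omega)]
          exact hout u hu
        · have key : s'.nreg 5 < mid → s'.nreg 6 < hi ∧
              ¬ s.rarr 4 (s'.nreg 5) ≤ s.rarr 4 (s'.nreg 6) := by
            intro h
            by_contra h'
            exact hc ⟨h, h'⟩
          refine hI.right s1 s2 ?_ fun h => (not_le.mp (key h).2).le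
          -- With the right run exhausted, `key` shows that the left one is exhausted too, against
          -- the loop test `t < hi`.
          by_contra hj
          have := fun h => (key h).1
          omega
    · have ht : s'.nreg 7 = hi := by omega
      have hii : s'.nreg 5 = mid := by omega
      have hjj : s'.nreg 6 = hi := by omega
      rw [ht] at hk'
      refine ⟨by omega, hout, ?_, ?_⟩
      · have := hI.pts_eq
        rw [hii, hjj, ht, pts_union _ _ h1 h2] at this
        exact this
      · intro u v hu huv hv
        exact hI.sorted u v hu huv (by omega)

/-- Each aligned block of length `w` of the first `n` cells is sorted. -/
def SortedBlocks (X : ℕ → ℝ) (w n : ℕ) : Prop :=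
  ∀ q u v, q * w ≤ u → u ≤ v → v < q * w + w → v < n → X u ≤ X v

theorem mergeLevel_spec {n w : ℕ} {s : RAMState} {k : ℕ} (hw : 1 ≤ w)
    (hn : s.nreg 0 = n) (hw' : s.nreg 1 = w) (hlo : s.nreg 2 = 0)
    (hs : SortedBlocks (s.rarr 4) w n) (hk : 120 * n + 10 ≤ k) :
    WP Code.mergeLevel (fun s' k' => k ≤ k' + 120 * n + 10 ∧
      pts (s'.rarr 6) (s'.rarr 7) 0 n = pts (s.rarr 4) (s.rarr 5) 0 n ∧
      SortedBlocks (s'.rarr 6) (w + w) n) s k := by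
  refine WP.loop (fun s' k' => k ≤ k' + 120 * min (s'.nreg 2) n ∧
      (∃ q, s'.nreg 2 = q * (w + w)) ∧
      pts (s'.rarr 6) (s'.rarr 7) 0 (min (s'.nreg 2) n) =
        pts (s.rarr 4) (s.rarr 5) 0 (min (s'.nreg 2) n) ∧
      SortedBlocks (s'.rarr 6) (w + w) (min (s'.nreg 2) n)) ?_ ?_
  · refine ⟨by omega, ⟨0, by omega⟩, by simp [hlo, pts_self], ?_⟩
    intro q u v _ _ _ hv
    omega
  · rintro s' k' hF ⟨hk', ⟨q, hq⟩, hp, hso⟩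
    have e4 : s'.rarr 4 = s.rarr 4 := hF.ra 4 rfl
    have e5 : s'.rarr 5 = s.rarr 5 := hF.ra 5 rfl
    have e0 : s'.nreg 0 = n := (hF.n 0 rfl).trans hn
    have e1 : s'.nreg 1 = w := (hF.n 1 rfl).trans hw'
    simp only [Test.cost, NExpr.cost, Test.Holds, NExpr.eval, e0]
    refine ⟨by omega, fun hb => ?_, fun hb => ?_⟩
    · generalize hlo' : s'.nreg 2 = lo at *
      have hmin : min lo n = lo := by omega
      rw [hmin] at hk' hp hso
      refine WP.seq (WP.nset ⟨by simp; omega, WP.seq (WP.nset ⟨by simp; omega, WP.seq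
        (WP.nset ⟨by simp; omega, WP.seq (WP.nset ⟨by simp; omega, WP.seq
        (WP.nset ⟨by simp; omega, WP.seq ?_⟩)⟩)⟩)⟩)⟩)
      simp only [NExpr.cost, NExpr.eval, RAMState.setN_nreg, e0, e1, hlo']
      norm_num
      -- With truncated subtraction `a - (a - n)` is `min a n`: the last runs are cut off at `n`.
      -- The two runs are the blocks `2 * q` and `2 * q + 1` of width `w`.
      refine (mergeRuns_spec (lo := lo) (mid := lo + w - (lo + w - n))
        (hi := lo + (w + w) - (lo + (w + w) - n)) (by omega) (by omega) (by simp) (by simp)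
        (by simp) (by simp) (by simp) ?_ ?_ (by omega)).frame.mono ?_
      · intro u v h1 h2 h3
        simp only [RAMState.setN_rarr, e4]
        have : 2 * q * w = q * (w + w) := by ring
        exact hs (2 * q) u v (by omega) h2 (by omega) (by omega)
      · intro u v h1 h2 h3
        simp only [RAMState.setN_rarr, e4]
        have : (2 * q + 1) * w = q * (w + w) + w := by ring
        exact hs (2 * q + 1) u v (by omega) h2 (by omega) (by omega)
      · rintro s1 k1 ⟨⟨hk1, hout, hp1, hso1⟩, hF1⟩
        have f1 : s1.nreg 1 = w := (hF1.n 1 rfl).trans (by simp [e1])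
        have f2 : s1.nreg 2 = lo := (hF1.n 2 rfl).trans (by simp [hlo'])
        simp only [RAMState.setN_rarr, e4, e5] at hout hp1
        refine WP.nset ⟨by simp; omega, ?_⟩
        simp only [NExpr.cost, NExpr.eval, RAMState.setN_nreg, f1, f2, if_true,
          RAMState.setN_rarr]
        have hhi : lo + (w + w) - (lo + (w + w) - n) = min (lo + (w + w)) n := by omega
        rw [hhi] at hout hp1 hso1 hk1
        refine ⟨by omega, ⟨q + 1, by rw [hq]; ring⟩, ?_, ?_⟩
        · rw [← pts_union _ _ (Nat.zero_le lo) (by omega), hp1,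
            ← pts_union (s.rarr 4) _ (Nat.zero_le lo) (by omega), ← hp]
          congr 1
          exact pts_congr fun u _ hu => hout u (Or.inl hu)
        · intro q' u v hu huv hv hv2
          rcases lt_or_ge v lo with hvl | hvl
          · rw [(hout u (by omega)).1, (hout v (by omega)).1]
            exact hso q' u v hu huv hv hvl
          -- A block that reaches `lo` starts at `lo` or later, since `lo` is a multiple of the
          -- block length; so it lies in the part just merged.
          · have : q * (w + w) < (q' + 1) * (w + w) := by rw [add_mul]; omega
            have := Nat.lt_of_mul_lt_mul_right this
            have : q * (w + w) ≤ q' * (w + w) := Nat.mul_le_mul_right _ (by omega)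
            exact hso1 u v (by omega) huv hv2
    · have hmin : min (s'.nreg 2) n = n := by omega
      rw [hmin] at hk' hp hso
      exact ⟨by omega, hp, hso⟩

theorem copyBack_spec {n : ℕ} {s : RAMState} {k : ℕ} (hn : s.nreg 0 = n) (h7 : s.nreg 7 = 0)
    (hk : 20 * n + 10 ≤ k) :
    WP Code.copyBack (fun s' k' => k ≤ k' + 20 * n + 10 ∧
      ∀ u, u < n → s'.rarr 4 u = s.rarr 6 u ∧ s'.rarr 5 u = s.rarr 7 u) s k := by
  refine WP.loop (fun s' k' => k ≤ k' + 20 * s'.nreg 7 ∧ s'.nreg 7 ≤ n ∧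
    ∀ u, u < s'.nreg 7 → s'.rarr 4 u = s.rarr 6 u ∧ s'.rarr 5 u = s.rarr 7 u) ?_ ?_
  · exact ⟨by omega, by omega, by omega⟩
  · rintro s' k' hF ⟨hk', hle, hp⟩
    have e6 : s'.rarr 6 = s.rarr 6 := hF.ra 6 rfl
    have e7 : s'.rarr 7 = s.rarr 7 := hF.ra 7 rfl
    have e0 : s'.nreg 0 = n := (hF.n 0 rfl).trans hn
    simp only [Test.cost, NExpr.cost, Test.Holds, NExpr.eval, e0]
    refine ⟨by omega, fun hb => ?_, fun hb => ?_⟩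
    · refine WP.seq (WP.rput ⟨by simp; omega, WP.seq (WP.rput ⟨by simp; omega,
          WP.nset ⟨by simp; omega, ?_⟩⟩)⟩)
      simp [e6, e7]
      refine ⟨by omega, by omega, fun u hu => ?_⟩
      rcases Nat.lt_or_eq_of_le hu with hu | rfl
      · rw [Function.update_of_ne hu.ne, Function.update_of_ne hu.ne]
        exact hp u hu
      · simp
    · exact ⟨by omega, fun u hu => hp u (by omega)⟩

/-- After `e` rounds blocks of width `2 ^ e` are sorted, and `g` counts the rounds still paid for.
Only the set of stored points is tracked; that the result is a permutation follows later, because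
the points are distinct. -/
theorem sort_spec {n : ℕ} {s : RAMState} {k : ℕ} (hn : s.nreg 0 = n)
    (hk : (Nat.log 2 n + 1) * (150 * n + 100) + 100 ≤ k) :
    WP Code.sort (fun s' k' => k ≤ k' + (Nat.log 2 n + 1) * (150 * n + 100) + 100 ∧
      pts (s'.rarr 4) (s'.rarr 5) 0 n = pts (s.rarr 4) (s.rarr 5) 0 n ∧
      ∀ u v, u ≤ v → v < n → s'.rarr 4 u ≤ s'.rarr 4 v) s k := by
  refine WP.seq (WP.nset ⟨by simp; omega, ?_⟩)
  refine WP.loop (fun s' k' => ∃ e g, e + g = Nat.log 2 n + 1 ∧ s'.nreg 1 = 2 ^ e ∧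
      k + g * (150 * n + 100) ≤ k' + (Nat.log 2 n + 1) * (150 * n + 100) + 10 ∧
      pts (s'.rarr 4) (s'.rarr 5) 0 n = pts (s.rarr 4) (s.rarr 5) 0 n ∧
      SortedBlocks (s'.rarr 4) (2 ^ e) n) ?_ ?_
  · refine ⟨0, Nat.log 2 n + 1, by omega, by simp, by simp; omega, by simp, ?_⟩
    intro q u v h1 h2 h3 _
    have : u = v := by simp at h1 h3; omega
    rw [this]
  · rintro s' k' hF ⟨e, g, heg, hw, hk', hp, hso⟩
    have e0 : s'.nreg 0 = n := (hF.n 0 rfl).trans (by simp [hn])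
    have hpos : 1 ≤ 2 ^ e := Nat.one_le_two_pow
    simp only [Test.cost, NExpr.cost, Test.Holds, NExpr.eval, e0, hw]
    refine ⟨by omega, fun hb => ?_, fun hb => ?_⟩
    -- A further round takes place only while `2 ^ e < n`, so at least one paid round is left.
    · have hlt : e < Nat.log 2 n + 1 := by
        by_contra h
        have h1 : n < 2 ^ (Nat.log 2 n + 1) := Nat.lt_pow_succ_log_self (by norm_num) n
        have h2 : 2 ^ (Nat.log 2 n + 1) ≤ 2 ^ e := Nat.pow_le_pow_right (by norm_num) (by omega)
        omega
      obtain ⟨g, rfl⟩ : ∃ g', g = g' + 1 := ⟨g - 1, by omega⟩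
      rw [add_mul, one_mul] at hk'
      refine WP.seq (WP.nset ⟨by simp; omega, WP.seq ?_⟩)
      simp only [NExpr.cost, NExpr.eval]
      refine (mergeLevel_spec (n := n) (w := 2 ^ e) hpos (by simp [e0]) (by simp [hw]) (by simp)
        (by simpa using hso) (by omega)).frame.mono ?_
      rintro s1 k1 ⟨⟨hk1, hp1, hso1⟩, hF1⟩
      have f0 : s1.nreg 0 = n := (hF1.n 0 rfl).trans (by simp [e0])
      have f1 : s1.nreg 1 = 2 ^ e := (hF1.n 1 rfl).trans (by simp [hw])
      refine WP.seq (WP.nset ⟨by simp; omega, WP.seq ?_⟩)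
      simp only [NExpr.cost, NExpr.eval]
      refine (copyBack_spec (n := n) (by simp [f0]) (by simp) (by omega)).frame.mono ?_
      rintro s2 k2 ⟨⟨hk2, hp2⟩, hF2⟩
      have g1 : s2.nreg 1 = 2 ^ e := (hF2.n 1 rfl).trans (by simp [f1])
      refine WP.nset ⟨by simp; omega, ?_⟩
      simp only [RAMState.setN_rarr] at hp2 hp1
      simp only [NExpr.cost, NExpr.eval, g1, RAMState.setN_nreg, if_true, RAMState.setN_rarr]
      refine ⟨e + 1, g, by omega, by ring, by omega, ?_, ?_⟩
      · rw [pts_congr fun u _ hu => hp2 u hu, hp1, hp]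
      · intro q u v h1 h2 h3 h4
        rw [(hp2 u (by omega)).1, (hp2 v h4).1]
        have : 2 ^ (e + 1) = 2 ^ e + 2 ^ e := by ring
        rw [this] at h1 h3
        exact hso1 q u v h1 h2 h3 h4
    · refine ⟨by omega, hp, fun u v h1 h2 => hso 0 u v (by omega) h1 (by omega) h2⟩

/-! ### Lower convex chains -/

/-- The points `(cx i, cy i)`, `i < m`, form a lower convex chain of `S`: they belong to `S`, are
strictly ordered from left to right, span the extent of `S`, and `S` lies above each edge. -/
structure LowerChain (S : Set (ℝ × ℝ)) (cx cy : ℕ → ℝ) (m : ℕ) : Prop where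
  pos : 0 < m
  mem : ∀ i, i < m → (cx i, cy i) ∈ S
  lt : ∀ i, i + 1 < m → cx i < cx (i + 1)
  first : ∀ q ∈ S, cx 0 ≤ q.1
  last : ∀ q ∈ S, q.1 ≤ cx (m - 1)
  bot : ∀ q ∈ S, q.1 = cx (m - 1) → cy (m - 1) ≤ q.2
  left : ∀ i, i + 1 < m → ∀ q ∈ S,
    0 ≤ (cx (i + 1) - cx i) * (q.2 - cy i) - (cy (i + 1) - cy i) * (q.1 - cx i)

/-- The situation while the new rightmost point `p` is being inserted into a lower chain. -/
structure PopInv (S : Set (ℝ × ℝ)) (cx cy : ℕ → ℝ) (m : ℕ) (p : ℝ × ℝ) : Prop where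
  pos : 0 < m
  mem : ∀ i, i < m → (cx i, cy i) ∈ S
  lt : ∀ i, i + 1 < m → cx i < cx (i + 1)
  first : ∀ q ∈ S, cx 0 ≤ q.1
  left : ∀ i, i + 1 < m → ∀ q ∈ S,
    0 ≤ (cx (i + 1) - cx i) * (q.2 - cy i) - (cy (i + 1) - cy i) * (q.1 - cx i)
  top : ∀ q ∈ S, cx (m - 1) ≤ q.1 →
    0 ≤ (p.1 - cx (m - 1)) * (q.2 - cy (m - 1)) - (p.2 - cy (m - 1)) * (q.1 - cx (m - 1))
  tie : cx (m - 1) = p.1 → p.2 < cy (m - 1) ∧ ∀ q ∈ S, q.1 = p.1 → cy (m - 1) ≤ q.2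

variable {S : Set (ℝ × ℝ)} {cx cy : ℕ → ℝ} {m : ℕ} {p : ℝ × ℝ}

theorem lt_of_lt_of_lt_succ (h : ∀ i, i + 1 < m → cx i < cx (i + 1)) {i j : ℕ} (hij : i < j)
    (hj : j < m) : cx i < cx j := by
  induction j with
  | zero => omega
  | succ j ih =>
    have h1 := h j hj
    rcases Nat.lt_succ_iff_lt_or_eq.mp hij with h | rfl
    · exact (ih h (by omega)).trans h1
    · exact h1

/-- The sign of the cross product is transitive on vectors that point to the right. -/
theorem cross_nonneg_trans {a a' b b' c c' : ℝ} (ha : 0 ≤ a) (hb : 0 < b) (hc : 0 ≤ c)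
    (h1 : 0 ≤ a * b' - a' * b) (h2 : 0 ≤ b * c' - b' * c) : 0 ≤ a * c' - a' * c := by
  have key : b * (a * c' - a' * c) = a * (b * c' - b' * c) + c * (a * b' - a' * b) := by ring
  refine nonneg_of_mul_nonneg_right (a := b) ?_ hb
  rw [key]
  exact add_nonneg (mul_nonneg ha h2) (mul_nonneg hc h1)

theorem LowerChain.single (p : ℝ × ℝ) (h0 : cx 0 = p.1) (h0' : cy 0 = p.2)
    (h : ∀ q ∈ S, q.1 = p.1 ∧ p.2 ≤ q.2) : LowerChain (insert p S) cx cy 1 := by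
  refine ⟨one_pos, fun i hi => ?_, by omega, ?_, ?_, ?_, by omega⟩
  · obtain rfl : i = 0 := by omega
    rw [h0, h0']
    exact Set.mem_insert _ _
  · rintro q (rfl | hq)
    · exact h0.le
    · rw [h0, (h q hq).1]
  · rintro q (rfl | hq)
    · exact h0.ge
    · rw [h0, (h q hq).1]
  · rintro q (rfl | hq) -
    · exact h0'.le
    · rw [h0']; exact (h q hq).2

theorem LowerChain.skip (hC : LowerChain S cx cy m) (h1 : p.1 = cx (m - 1))
    (h2 : cy (m - 1) ≤ p.2) : LowerChain (insert p S) cx cy m := by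
  obtain ⟨a, b, c, d, e, f, g⟩ := hC
  refine ⟨a, fun i hi => Set.mem_insert_of_mem _ (b i hi), c, ?_, ?_, ?_, ?_⟩
  · rintro q (rfl | hq)
    · rw [h1]; exact d _ (b (m - 1) (by omega))
    · exact d q hq
  · rintro q (rfl | hq)
    · exact h1.le
    · exact e q hq
  · rintro q (rfl | hq) h
    · exact h2
    · exact f q hq h
  · rintro i hi q (rfl | hq)
    -- The cross product for the new point is that for the last vertex plus edge width times the
    -- height above that vertex.
    · have := g i hi _ (b (m - 1) (by omega))
      have := c i hi
      simp only at *
      rw [h1]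
      nlinarith
    · exact g i hi q hq

/-- The points are sorted by the first coordinate only, so the new point may share its abscissa with
the last vertex. Having failed the skip test, it then lies strictly below that vertex, which is what
`tie` records. -/
theorem LowerChain.popInv (hC : LowerChain S cx cy m) (hp : ∀ q ∈ S, q.1 ≤ p.1)
    (hns : ¬ (p.1 ≤ cx (m - 1) ∧ cy (m - 1) ≤ p.2)) : PopInv S cx cy m p := by
  obtain ⟨a, b, c, d, e, f, g⟩ := hC
  refine ⟨a, b, c, d, g, fun q hq h => ?_, fun h => ⟨?_, fun q hq h' => ?_⟩⟩
  · have h1 : q.1 = cx (m - 1) := le_antisymm (e q hq) h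
    have h2 := f q hq h1
    have h3 := hp _ (b (m - 1) (by omega))
    simp only at h3
    rw [h1]
    nlinarith
  · by_contra h'
    exact hns ⟨h.ge, not_lt.mp h'⟩
  · exact f q hq (h'.trans h.symm)

/-- The removed vertex is not below the segment from its predecessor to `p`. Points to its right are
above that segment by `top` and this turn, points to its left by the last edge and this turn. Each
case is an identity that writes the wanted cross product, times a width, as a nonnegative
combination. -/
theorem PopInv.pop (hI : PopInv S cx cy m p) (hp : ∀ q ∈ S, q.1 ≤ p.1) (hm : 2 ≤ m)
    (hc : (cx (m - 1) - cx (m - 2)) * (p.2 - cy (m - 2)) -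
      (cy (m - 1) - cy (m - 2)) * (p.1 - cx (m - 2)) ≤ 0) : PopInv S cx cy (m - 1) p := by
  obtain ⟨m, rfl⟩ : ∃ m', m = m' + 2 := ⟨m - 2, by omega⟩
  obtain ⟨a, b, c, d, g, t, tie⟩ := hI
  simp only [show m + 2 - 1 = m + 1 by omega, show m + 2 - 2 = m by omega] at *
  have hlt := c m (by omega)
  have hop : cx (m + 1) ≤ p.1 := hp _ (b (m + 1) (by omega))
  refine ⟨by omega, fun i hi => b i (by omega), fun i hi => c i (by omega), d,
    fun i hi => g i (by omega), fun q hq h => ?_, fun h => by simp at h; linarith⟩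
  rw [show m + 1 - 1 = m by omega] at *
  have hqp := hp q hq
  rcases le_or_gt (cx (m + 1)) q.1 with h1 | h1
  · have h2 := t q hq h1
    rcases hop.lt_or_eq with h3 | h3
    · have key : (p.1 - cx (m + 1)) *
          ((p.1 - cx m) * (q.2 - cy m) - (p.2 - cy m) * (q.1 - cx m)) =
          (p.1 - cx m) * ((p.1 - cx (m + 1)) * (q.2 - cy (m + 1)) -
            (p.2 - cy (m + 1)) * (q.1 - cx (m + 1))) +
          (p.1 - q.1) * (-((cx (m + 1) - cx m) * (p.2 - cy m) -
            (cy (m + 1) - cy m) * (p.1 - cx m))) := by ring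
      have h4 : 0 ≤ (p.1 - cx (m + 1)) *
          ((p.1 - cx m) * (q.2 - cy m) - (p.2 - cy m) * (q.1 - cx m)) := by
        rw [key]
        exact add_nonneg (mul_nonneg (by linarith) h2) (mul_nonneg (by linarith) (by linarith))
      exact nonneg_of_mul_nonneg_right h4 (by linarith)
    -- Here `p` is vertically below the removed vertex and the multiplier of the identity vanishes,
    -- so the vertical order is used directly.
    · obtain ⟨h4, h5⟩ := tie h3
      have h6 : q.1 = p.1 := by linarith
      have h7 := h5 q hq h6
      rw [h6]
      nlinarith
  · have h2 := g m (by omega) q hq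
    have key : (cx (m + 1) - cx m) *
        ((p.1 - cx m) * (q.2 - cy m) - (p.2 - cy m) * (q.1 - cx m)) =
        (p.1 - cx m) * ((cx (m + 1) - cx m) * (q.2 - cy m) -
          (cy (m + 1) - cy m) * (q.1 - cx m)) +
        (q.1 - cx m) * (-((cx (m + 1) - cx m) * (p.2 - cy m) -
          (cy (m + 1) - cy m) * (p.1 - cx m))) := by ring
    have h4 : 0 ≤ (cx (m + 1) - cx m) *
        ((p.1 - cx m) * (q.2 - cy m) - (p.2 - cy m) * (q.1 - cx m)) := by
      rw [key]
      exact add_nonneg (mul_nonneg (by linarith) h2) (mul_nonneg (by linarith) (by linarith))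
    exact nonneg_of_mul_nonneg_right h4 (by linarith)

theorem PopInv.reset (hI : PopInv S cx cy 1 p) (hp : ∀ q ∈ S, q.1 ≤ p.1) (hc : p.1 ≤ cx 0) :
    LowerChain (insert p S) (Function.update cx 0 p.1) (Function.update cy 0 p.2) 1 := by
  refine .single p (by simp) (by simp) fun q hq => ?_
  have h1 := hI.first q hq
  have h2 := hp q hq
  have h3 := hp _ (hI.mem 0 one_pos)
  obtain ⟨h4, h5⟩ := hI.tie (le_antisymm h3 hc)
  have h6 : q.1 = p.1 := by linarith
  exact ⟨h6, h4.le.trans (h5 q hq h6)⟩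

/-- Two facts are needed: the old points are above the new edge, and `p` is above the old edges.
Both come from the left turn at the last vertex, combined with the last old edge for the former and
with the monotonicity of slopes along the chain for the latter. -/
theorem PopInv.push (hI : PopInv S cx cy m p) (hp : ∀ q ∈ S, q.1 ≤ p.1)
    (hx : cx (m - 1) < p.1)
    (hc : 2 ≤ m → 0 < (cx (m - 1) - cx (m - 2)) * (p.2 - cy (m - 2)) -
      (cy (m - 1) - cy (m - 2)) * (p.1 - cx (m - 2))) :
    LowerChain (insert p S) (Function.update cx m p.1) (Function.update cy m p.2) (m + 1) := by
  obtain ⟨a, b, c, d, g, t, tie⟩ := hI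
  have new_edge : ∀ q ∈ S, 0 ≤ (p.1 - cx (m - 1)) * (q.2 - cy (m - 1)) -
      (p.2 - cy (m - 1)) * (q.1 - cx (m - 1)) := by
    intro q hq
    rcases le_or_gt (cx (m - 1)) q.1 with h | h
    · exact t q hq h
    · have hm : 2 ≤ m := by
        by_contra h'
        obtain rfl : m = 1 := by omega
        exact absurd h (not_lt.mpr (d q hq))
      obtain ⟨m, rfl⟩ : ∃ m', m = m' + 2 := ⟨m - 2, by omega⟩
      have hc := hc hm
      simp only [show m + 2 - 1 = m + 1 by omega, show m + 2 - 2 = m by omega] at *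
      have h1 := c m (by omega)
      have h2 := g m (by omega) q hq
      have key : (cx (m + 1) - cx m) * ((p.1 - cx (m + 1)) * (q.2 - cy (m + 1)) -
          (p.2 - cy (m + 1)) * (q.1 - cx (m + 1))) =
          (p.1 - cx (m + 1)) * ((cx (m + 1) - cx m) * (q.2 - cy m) -
            (cy (m + 1) - cy m) * (q.1 - cx m)) +
          (cx (m + 1) - q.1) * ((cx (m + 1) - cx m) * (p.2 - cy m) -
            (cy (m + 1) - cy m) * (p.1 - cx m)) := by ring
      refine nonneg_of_mul_nonneg_right (a := cx (m + 1) - cx m) ?_ (by linarith)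
      rw [key]
      exact add_nonneg (mul_nonneg (by linarith) h2) (mul_nonneg (by linarith) hc.le)
  have old_edge : ∀ i, i + 1 < m →
      0 ≤ (cx (i + 1) - cx i) * (p.2 - cy i) - (cy (i + 1) - cy i) * (p.1 - cx i) := by
    intro i hi
    obtain ⟨m, rfl⟩ : ∃ m', m = m' + 2 := ⟨m - 2, by omega⟩
    have hc := hc (by omega)
    simp only [show m + 2 - 1 = m + 1 by omega, show m + 2 - 2 = m by omega] at *
    have h1 := c m (by omega)
    have h2 := g i hi _ (b m (by omega))
    have h3 := g i hi _ (b (m + 1) (by omega))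
    have h4 := c i hi
    simp only at h2 h3
    -- Edge `i` is at most as steep as the last edge; they are compared through the chord from
    -- vertex `i + 1` to vertex `m`.
    have h5 : 0 ≤ (cx (i + 1) - cx i) * (cy (m + 1) - cy m) -
          (cy (i + 1) - cy i) * (cx (m + 1) - cx m) := by
      rcases Nat.lt_or_ge i m with h | h
      · rcases Nat.lt_or_ge (i + 1) m with h' | h'
        · have h6 := lt_of_lt_of_lt_succ c h' (by omega)
          have h7 := g m (by omega) _ (b (i + 1) (by omega))
          simp only at h7
          exact cross_nonneg_trans (b := cx m - cx (i + 1)) (b' := cy m - cy (i + 1))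
            (by linarith) (by linarith) (by linarith) (by linarith) (by linarith)
        · obtain rfl : m = i + 1 := by omega
          linarith
      · obtain rfl : i = m := by omega
        exact le_of_eq (by ring)
    have h6 := cross_nonneg_trans (a := cx (i + 1) - cx i) (a' := cy (i + 1) - cy i)
      (b := cx (m + 1) - cx m) (b' := cy (m + 1) - cy m) (c := p.1 - cx m) (c' := p.2 - cy m)
      (by linarith) (by linarith) (by linarith) h5 hc.le
    linarith
  refine ⟨by omega, fun i hi => ?_, fun i hi => ?_, ?_, ?_, ?_, ?_⟩
  · rcases Nat.lt_succ_iff_lt_or_eq.mp hi with h | rfl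
    · rw [Function.update_of_ne h.ne, Function.update_of_ne h.ne]
      exact Set.mem_insert_of_mem _ (b i h)
    · simp
  · rw [Function.update_of_ne (by omega)]
    rcases Nat.lt_succ_iff_lt_or_eq.mp hi with h | h
    · rw [Function.update_of_ne (by omega)]
      exact c i h
    · rw [h, Function.update_self, show i = m - 1 by omega]
      exact hx
  · rw [Function.update_of_ne (by omega)]
    rintro q (rfl | hq)
    · exact (d _ (b (m - 1) (by omega))).trans hx.le
    · exact d q hq
  · rw [Nat.add_sub_cancel, Function.update_self]
    rintro q (rfl | hq)
    · exact le_rfl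
    · exact hp q hq
  · rw [Nat.add_sub_cancel, Function.update_self, Function.update_self]
    rintro q (rfl | hq) h
    · exact le_rfl
    · have := new_edge q hq
      rw [h] at this
      nlinarith
  · intro i hi q hq
    rw [Function.update_of_ne (show i ≠ m by omega), Function.update_of_ne (show i ≠ m by omega)]
    rcases Nat.lt_succ_iff_lt_or_eq.mp hi with h | h
    · rw [Function.update_of_ne (by omega), Function.update_of_ne (by omega)]
      rcases hq with rfl | hq
      · exact old_edge i h
      · exact g i h q hq
    · rw [h, Function.update_self, Function.update_self, show i = m - 1 by omega]
      rcases hq with rfl | hq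
      · exact le_of_eq (by ring)
      · exact new_edge q hq

namespace Code

/-- The last vertex of the chain does not lie below the segment from the one before to the new
point. -/
def popTest : Test :=
  .and (.nle (.const 2) (.reg 8)) (.rle
    (.sub (.mul (.sub (.get 8 (.sub (.reg 8) (.const 1))) (.get 8 (.sub (.reg 8) (.const 2))))
        (.sub (.reg 18) (.get 9 (.sub (.reg 8) (.const 2)))))
      (.mul (.sub (.get 9 (.sub (.reg 8) (.const 1))) (.get 9 (.sub (.reg 8) (.const 2))))
        (.sub (.reg 17) (.get 8 (.sub (.reg 8) (.const 2)))))) (.const 0))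

/-- Remove vertices from the end of the chain. -/
def popLoop : Prog := .loop popTest (.nset 8 (.sub (.reg 8) (.const 1)))

/-- Append the new point to the chain. -/
def pushPoint : Prog :=
  .seq (.branch (.and (.and (.nle (.const 1) (.reg 8)) (.nle (.reg 8) (.const 1)))
      (.rle (.reg 17) (.get 8 (.const 0)))) (.nset 8 (.const 0)) .skip)
    (.seq (.rput 8 (.reg 8) (.reg 17)) (.seq (.rput 9 (.reg 8) (.reg 18))
      (.nset 8 (.add (.reg 8) (.const 1)))))

/-- Test whether the new point lies above the last vertex of the chain. -/
def skipTest : Test :=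
  .and (.nle (.const 1) (.reg 8)) (.and (.rle (.reg 17) (.get 8 (.sub (.reg 8) (.const 1))))
    (.rle (.get 9 (.sub (.reg 8) (.const 1))) (.reg 18)))

/-- Insert the point in the registers `17`, `18` into the chain. -/
def insertPoint : Prog := .branch skipTest .skip (.seq popLoop pushPoint)

/-- Insert the next point into the chain. -/
def chainStep : Prog :=
  .seq (.rset 17 (.get 4 (.reg 7))) (.seq (.rset 18 (.mul (.reg 16) (.get 5 (.reg 7))))
    (.seq insertPoint (.nset 7 (.add (.reg 7) (.const 1)))))

/-- Compute the lower convex chain of the sorted points, with the second coordinates multiplied by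
the sign in register `16`. -/
def chain : Prog :=
  .seq (.nset 8 (.const 0)) (.seq (.nset 7 (.const 0))
    (.loop (.nle (.add (.reg 7) (.const 1)) (.reg 0)) chainStep))

end Code

/-- The chain length serves as a potential: each vertex carries 60 credits that pay for its removal.
The first alternative of `hI` is the empty chain before the first insertion. -/
theorem popLoop_spec {S : Set (ℝ × ℝ)} {p : ℝ × ℝ} {s : RAMState} {k : ℕ}
    (h17 : s.rreg 17 = p.1) (h18 : s.rreg 18 = p.2)
    (hp : ∀ q ∈ S, q.1 ≤ p.1)
    (hI : (s.nreg 8 = 0 ∧ S = ∅) ∨ PopInv S (s.rarr 8) (s.rarr 9) (s.nreg 8) p)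
    (hk : 60 * s.nreg 8 + 60 ≤ k) :
    WP Code.popLoop (fun s' k' => k + 60 * s'.nreg 8 ≤ k' + 60 * s.nreg 8 + 60 ∧
      s'.nreg 8 ≤ s.nreg 8 ∧ ((s'.nreg 8 = 0 ∧ S = ∅) ∨
      (PopInv S (s.rarr 8) (s.rarr 9) (s'.nreg 8) p ∧
      (2 ≤ s'.nreg 8 → 0 <
        (s.rarr 8 (s'.nreg 8 - 1) - s.rarr 8 (s'.nreg 8 - 2)) *
          (p.2 - s.rarr 9 (s'.nreg 8 - 2)) -
        (s.rarr 9 (s'.nreg 8 - 1) - s.rarr 9 (s'.nreg 8 - 2)) *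
          (p.1 - s.rarr 8 (s'.nreg 8 - 2)))))) s k := by
  refine WP.loop (fun s' k' => k + 60 * s'.nreg 8 ≤ k' + 60 * s.nreg 8 ∧
    s'.nreg 8 ≤ s.nreg 8 ∧
    ((s'.nreg 8 = 0 ∧ S = ∅) ∨ PopInv S (s.rarr 8) (s.rarr 9) (s'.nreg 8) p)) ?_ ?_
  · exact ⟨by omega, le_rfl, hI⟩
  · rintro s' k' hF ⟨hk', hle, hI'⟩
    have e8 : s'.rarr 8 = s.rarr 8 := hF.ra 8 rfl
    have e9 : s'.rarr 9 = s.rarr 9 := hF.ra 9 rfl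
    have e17 : s'.rreg 17 = p.1 := (hF.r 17 rfl).trans h17
    have e18 : s'.rreg 18 = p.2 := (hF.r 18 rfl).trans h18
    have hc : Code.popTest.cost = 39 := by simp [Code.popTest]
    rw [hc]
    simp only [Code.popTest, Test.Holds, NExpr.eval, RExpr.eval, e8, e9, e17, e18, Rat.cast_zero]
    refine ⟨by omega, fun hb => ?_, fun hb => ?_⟩
    · refine WP.nset ⟨by simp; omega, ?_⟩
      simp
      refine ⟨by omega, by omega, Or.inr ?_⟩
      exact (hI'.resolve_left (by omega)).pop hp hb.1 hb.2
    · refine ⟨by omega, hle, hI'.imp_right fun h => ⟨h, fun h2 => ?_⟩⟩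
      by_contra h
      exact hb ⟨h2, not_lt.mp h⟩

theorem pushPoint_spec {S : Set (ℝ × ℝ)} {p : ℝ × ℝ} {s : RAMState} {k : ℕ}
    (h17 : s.rreg 17 = p.1) (h18 : s.rreg 18 = p.2) (hp : ∀ q ∈ S, q.1 ≤ p.1)
    (hI : (s.nreg 8 = 0 ∧ S = ∅) ∨ (PopInv S (s.rarr 8) (s.rarr 9) (s.nreg 8) p ∧
      (2 ≤ s.nreg 8 → 0 <
        (s.rarr 8 (s.nreg 8 - 1) - s.rarr 8 (s.nreg 8 - 2)) * (p.2 - s.rarr 9 (s.nreg 8 - 2)) -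
        (s.rarr 9 (s.nreg 8 - 1) - s.rarr 9 (s.nreg 8 - 2)) * (p.1 - s.rarr 8 (s.nreg 8 - 2)))))
    (hk : 60 ≤ k) :
    WP Code.pushPoint (fun s' k' => k ≤ k' + 60 ∧ s'.nreg 8 ≤ s.nreg 8 + 1 ∧
      LowerChain (insert p S) (s'.rarr 8) (s'.rarr 9) (s'.nreg 8)) s k := by
  refine WP.seq (WP.branch ⟨by simp; omega, fun hc => WP.nset ⟨by simp; omega, ?_⟩,
    fun hc => WP.skip ⟨by simp; omega, ?_⟩⟩)
  · refine WP.seq (WP.rput ⟨by simp; omega, WP.seq (WP.rput ⟨by simp; omega,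
      WP.nset ⟨by simp; omega, ?_⟩⟩)⟩)
    simp [h17] at hc
    simp [h17, h18]
    refine ⟨by omega, ?_⟩
    rcases hI with hI | hI
    · omega
    · obtain ⟨⟨h1, h2⟩, h3⟩ := hc
      have h8 : s.nreg 8 = 1 := by omega
      rw [h8] at hI
      exact hI.1.reset hp h3
  · refine WP.seq (WP.rput ⟨by simp; omega, WP.seq (WP.rput ⟨by simp; omega,
      WP.nset ⟨by simp; omega, ?_⟩⟩)⟩)
    simp [h17] at hc
    simp [h17, h18]
    refine ⟨by omega, ?_⟩
    rcases hI with ⟨h0, rfl⟩ | ⟨hI, h2⟩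
    · rw [h0]
      exact .single p (by simp) (by simp) (by simp)
    · refine hI.push hp ?_ h2
      have hle := hp _ (hI.mem (s.nreg 8 - 1) (by have := hI.pos; omega))
      simp only at hle
      refine lt_of_le_of_ne hle fun h => ?_
      rcases Nat.lt_or_ge (s.nreg 8) 2 with h3 | h3
      · have h8 : s.nreg 8 = 1 := by have := hI.pos; omega
        have := hc (by omega) (by omega)
        rw [h8] at h
        simp at h
        linarith
      -- A last vertex on the vertical line of `p`, with `p` strictly below it, makes a right turn,
      -- so the popping loop would have removed it. A tie can survive only on a chain of one vertex,
      -- which `pushPoint` overwrites.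
      · have h4 := h2 h3
        have h5 := (hI.tie h).1
        have h6 := hI.lt (s.nreg 8 - 2) (by omega)
        rw [show s.nreg 8 - 2 + 1 = s.nreg 8 - 1 by omega] at h6
        rw [← h] at h4
        nlinarith

theorem insertPoint_spec {S : Set (ℝ × ℝ)} {p : ℝ × ℝ} {s : RAMState} {k : ℕ}
    (h17 : s.rreg 17 = p.1) (h18 : s.rreg 18 = p.2) (hp : ∀ q ∈ S, q.1 ≤ p.1)
    (hI : (s.nreg 8 = 0 ∧ S = ∅) ∨ LowerChain S (s.rarr 8) (s.rarr 9) (s.nreg 8))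
    (hk : 60 * s.nreg 8 + 200 ≤ k) :
    WP Code.insertPoint (fun s' k' => k + 60 * s'.nreg 8 ≤ k' + 60 * s.nreg 8 + 200 ∧
      s'.nreg 8 ≤ s.nreg 8 + 1 ∧
      LowerChain (insert p S) (s'.rarr 8) (s'.rarr 9) (s'.nreg 8)) s k := by
  have hsk : Code.skipTest.cost = 17 := by simp [Code.skipTest]
  refine WP.branch ⟨by rw [hsk]; omega, fun hc => WP.skip ⟨by rw [hsk]; omega, ?_⟩, fun hc => ?_⟩
  all_goals
    simp only [Code.skipTest, Test.Holds, NExpr.eval, RExpr.eval, h17, h18] at hc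
    rw [hsk]
  · refine ⟨by omega, by omega, ?_⟩
    have hC := hI.resolve_left (by omega)
    exact hC.skip (le_antisymm hc.2.1 (hp _ (hC.mem _ (by omega)))) hc.2.2
  · refine WP.seq ((popLoop_spec h17 h18 hp (hI.imp_right fun hC => hC.popInv hp fun h =>
      hc ⟨hC.pos, h⟩) (by omega)).frame.mono ?_)
    rintro s1 k1 ⟨⟨hk1, h8, hI1⟩, hF⟩
    have e8 : s1.rarr 8 = s.rarr 8 := hF.ra 8 rfl
    have e9 : s1.rarr 9 = s.rarr 9 := hF.ra 9 rfl
    refine (pushPoint_spec (S := S) (p := p) ((hF.r 17 rfl).trans h17) ((hF.r 18 rfl).trans h18)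
      hp (by rwa [e8, e9]) (by omega)).mono ?_
    rintro s2 k2 ⟨hk2, h82, hC⟩
    exact ⟨by omega, by omega, hC⟩

/-- Every insertion adds at most one vertex, so the potential `60 * s'.nreg 8` makes all removals
together linear in `n`. -/
theorem chain_spec {n : ℕ} {s : RAMState} {k : ℕ} (hn : s.nreg 0 = n) (hn1 : 1 ≤ n)
    (hs : ∀ u v, u ≤ v → v < n → s.rarr 4 u ≤ s.rarr 4 v) (hk : 300 * n + 50 ≤ k) :
    WP Code.chain (fun s' k' => k ≤ k' + 300 * n + 50 ∧ s'.nreg 8 ≤ n ∧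
      LowerChain (pts (s.rarr 4) (fun u => s.rreg 16 * s.rarr 5 u) 0 n) (s'.rarr 8) (s'.rarr 9)
        (s'.nreg 8)) s k := by
  refine WP.seq (WP.nset ⟨by simp; omega, WP.seq (WP.nset ⟨by simp; omega, ?_⟩)⟩)
  refine WP.loop (fun s' k' => k + 60 * s'.nreg 8 ≤ k' + 300 * s'.nreg 7 + 20 ∧
    s'.nreg 8 ≤ s'.nreg 7 ∧ s'.nreg 7 ≤ n ∧ ((s'.nreg 7 = 0 ∧ s'.nreg 8 = 0) ∨
    LowerChain (pts (s.rarr 4) (fun u => s.rreg 16 * s.rarr 5 u) 0 (s'.nreg 7)) (s'.rarr 8)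
      (s'.rarr 9) (s'.nreg 8))) ?_ ?_
  · simp; omega
  · rintro s' k' hF ⟨hk', h87, h7n, hI⟩
    have e4 : s'.rarr 4 = s.rarr 4 := hF.ra 4 rfl
    have e5 : s'.rarr 5 = s.rarr 5 := hF.ra 5 rfl
    have e16 : s'.rreg 16 = s.rreg 16 := hF.r 16 rfl
    have e0 : s'.nreg 0 = n := (hF.n 0 rfl).trans (by simp [hn])
    simp only [Test.cost, NExpr.cost, Test.Holds, NExpr.eval, e0]
    refine ⟨by omega, fun hb => ?_, fun hb => ?_⟩
    · refine WP.seq (WP.rset ⟨by simp; omega, WP.seq (WP.rset ⟨by simp; omega, WP.seq ?_⟩)⟩)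
      simp only [RExpr.cost, NExpr.cost, RExpr.eval, NExpr.eval, RAMState.setR_rreg,
        RAMState.setR_nreg, RAMState.setR_rarr, e4, e5, e16]
      refine (insertPoint_spec
        (S := pts (s.rarr 4) (fun u => s.rreg 16 * s.rarr 5 u) 0 (s'.nreg 7))
        (p := (s.rarr 4 (s'.nreg 7), s.rreg 16 * s.rarr 5 (s'.nreg 7)))
        (by simp) (by simp) ?_ (by simpa using hI.imp_left fun h => ⟨h.2, by rw [h.1, pts_self]⟩)
        (by simp; omega)).frame.mono ?_
      · rintro q ⟨u, -, hu, rfl⟩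
        exact hs _ _ hu.le (by omega)
      · rintro s1 k1 ⟨⟨hk1, h8, hC⟩, hF1⟩
        have e7 : s1.nreg 7 = s'.nreg 7 := (hF1.n 7 rfl).trans (by simp)
        simp only [RAMState.setR_nreg] at hk1 h8
        refine WP.nset ⟨by simp; omega, ?_⟩
        simp [e7]
        refine ⟨by omega, by omega, by omega, ?_⟩
        rwa [pts_succ _ _ (Nat.zero_le _)]
    · have e7 : s'.nreg 7 = n := by omega
      rw [e7] at hI hk' h87
      exact ⟨by omega, h87, hI.resolve_left (by omega)⟩

/-! ### Searching for the largest triangle on a lower chain -/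

/-- Twice the signed area of the triangle on the points `p`, `q + (0, h)` and `r`. -/
def area2 (h : ℝ) (p q r : ℝ × ℝ) : ℝ :=
  (r.1 - p.1) * (q.2 + h - p.2) - (q.1 - p.1) * (r.2 - p.2)

/-- The reflection of a set in the horizontal axis. -/
def reflect (S : Set (ℝ × ℝ)) : Set (ℝ × ℝ) := {q | (q.1, -q.2) ∈ S}

section chords
variable {S : Set (ℝ × ℝ)} {cx cy : ℕ → ℝ} {m : ℕ}

theorem LowerChain.strict (hC : LowerChain S cx cy m) {i j : ℕ} (hij : i < j) (hj : j < m) :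
    cx i < cx j := lt_of_lt_of_lt_succ hC.lt hij hj

/-- The edge that ends at `b` has both `a` and `c` above its line, so its slope separates those of
the two chords. -/
theorem LowerChain.convex (hC : LowerChain S cx cy m) {a b c : ℕ} (hab : a < b) (hbc : b < c)
    (hc : c < m) :
    0 ≤ (cx b - cx a) * (cy c - cy b) - (cy b - cy a) * (cx c - cx b) := by
  obtain ⟨b, rfl⟩ : ∃ b', b = b' + 1 := ⟨b - 1, by omega⟩
  have h1 := hC.left b (by omega) _ (hC.mem c hc)
  have h2 := hC.left b (by omega) _ (hC.mem a (by omega))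
  have h3 := hC.lt b (by omega)
  have h4 := hC.strict hab (by omega)
  have h5 := hC.strict hbc hc
  simp only at h1 h2
  exact cross_nonneg_trans (b := cx (b + 1) - cx b) (b' := cy (b + 1) - cy b) (by linarith)
    (by linarith) (by linarith) (by linarith) (by linarith)

/-- Moving either end of a chord to the right makes it steeper; the two moves are made one after the
other, through the chord from `i` to `k'`. -/
theorem LowerChain.chord (hC : LowerChain S cx cy m) {i k i' k' : ℕ} (hik : i < k)
    (hik' : i' < k') (hi : i ≤ i') (hk : k ≤ k') (hm : k' < m) :
    0 ≤ (cx k - cx i) * (cy k' - cy i') - (cy k - cy i) * (cx k' - cx i') := by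
  have h1 := hC.strict hik (by omega)
  have h2 := hC.strict hik' hm
  have h3 := hC.strict (show i < k' by omega) hm
  refine cross_nonneg_trans (b := cx k' - cx i) (b' := cy k' - cy i) (by linarith)
    (by linarith) (by linarith) ?_ ?_
  · rcases hk.lt_or_eq with h | rfl
    · linarith [hC.convex hik h hm]
    · linarith
  · rcases hi.lt_or_eq with h | rfl
    · linarith [hC.convex h hik' hm]
    · linarith

end chords

/-- The chains on which the search works: `A` is the lower chain of `S`, and `B` that of the
reflected set. The value `W i k` is that of the best triangle on the chord `i k` of `A`. -/
structure SearchData where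
  S : Set (ℝ × ℝ)
  ax : ℕ → ℝ
  ay : ℕ → ℝ
  m : ℕ
  bx : ℕ → ℝ
  by' : ℕ → ℝ
  mb : ℕ
  h : ℝ
  W : ℕ → ℕ → ℝ
  chainA : LowerChain S ax ay m
  chainB : LowerChain (reflect S) bx by' mb
  h_nonneg : 0 ≤ h
  le_W : ∀ i k, ∀ q ∈ S, area2 h (ax i, ay i) q (ax k, ay k) ≤ W i k
  exists_W : ∀ i k, ∃ q ∈ S, area2 h (ax i, ay i) q (ax k, ay k) = W i k

namespace SearchData
variable (D : SearchData)

/-- The value of the triangle on the chord `i k` and a point `q`. -/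
def val (i k : ℕ) (q : ℝ × ℝ) : ℝ := area2 D.h (D.ax i, D.ay i) q (D.ax k, D.ay k)

/-- The points of the upper chain. -/
def up (j : ℕ) : ℝ × ℝ := (D.bx j, -D.by' j)

theorem up_mem {j : ℕ} (hj : j < D.mb) : D.up j ∈ D.S := D.chainB.mem j hj

/-- Raising the left end of the chord itself already gives width times `h`. This makes `-1` a safe
starting value when a row is scanned. -/
theorem W_nonneg {i k : ℕ} (hik : i < k) (hk : k < D.m) : 0 ≤ D.W i k := by
  refine le_trans ?_ (D.le_W i k _ (D.chainA.mem i (by omega)))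
  simp only [area2]
  have := D.chainA.strict hik hk
  have := mul_nonneg (sub_nonneg.mpr this.le) D.h_nonneg
  linarith

theorem W_eq {i k : ℕ} {u : ℝ × ℝ} (hu : u ∈ D.S) (h : ∀ q ∈ D.S, D.val i k q ≤ D.val i k u) :
    D.W i k = D.val i k u := by
  obtain ⟨q, hq, he⟩ := D.exists_W i k
  exact le_antisymm (he ▸ h q hq) (D.le_W i k u hu)

/-- The values satisfy the inverse quadrangle inequality. -/
theorem monge {i i' k k' : ℕ} (h1 : i < i') (h2 : i' < k) (h3 : k < k') (h4 : k' < D.m) :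
    D.W i k' + D.W i' k ≤ D.W i k + D.W i' k' := by
  obtain ⟨q, hq, e1⟩ := D.exists_W i' k
  obtain ⟨q', hq', e2⟩ := D.exists_W i k'
  have x1 := D.chainA.strict h1 (by omega)
  have x2 := D.chainA.strict h2 (by omega)
  have x3 := D.chainA.strict h3 h4
  have c1 := D.chainA.chord h1 h3 (by omega) (by omega) h4
  have c2 := D.chainA.chord h1 h2 (by omega) (by omega) (by omega)
  have c3 := D.chainA.chord h2 h3 (by omega) (by omega) (by omega)
  have w1 := D.le_W i k q hq
  have w2 := D.le_W i' k' q' hq'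
  have w3 := D.le_W i k q' hq'
  have w4 := D.le_W i' k' q hq
  have w5 := D.le_W i' k q' hq'
  rw [← e1] at w5
  rw [← e1, ← e2]
  simp only [area2] at *
  generalize D.W i k = W1 at *
  generalize D.W i' k' = W2 at *
  generalize D.ax i = xi at *
  generalize D.ax i' = xi' at *
  generalize D.ax k = xk at *
  generalize D.ax k' = xk' at *
  generalize D.ay i = yi at *
  generalize D.ay i' = yi' at *
  generalize D.ay k = yk at *
  generalize D.ay k' = yk' at *
  -- Here `q` is best for the chord `i' k` and `q'` for `i k'`. They are reassigned to the chords `i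
  -- k` and `i' k'`. In one order the gain is the convexity term `c1` minus the cross product of the
  -- edge `i i'` with `q' - q`, in the other order the same with the edge `k k'`.
  rcases le_or_gt ((xi' - xi) * (q'.2 - q.2) - (yi' - yi) * (q'.1 - q.1)) 0 with he | he
  · linarith
  rcases le_or_gt ((xk' - xk) * (q'.2 - q.2) - (yk' - yk) * (q'.1 - q.1)) 0 with hf | hf
  · linarith
  exfalso
  -- If both reassignments fail, `q' - q` points above the directions of both outer chords, hence
  -- also above the intermediate chord `i' k`. But `q` is optimal for that chord. The sign of the
  -- abscissa of `q' - q` decides which outer chord is used.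
  have hm : (xk - xi') * (q'.2 - q.2) - (yk - yi') * (q'.1 - q.1) ≤ 0 := by linarith
  rcases le_total (q'.1 - q.1) 0 with hg | hg
  · have key : (xi' - xi) * ((xk - xi') * (q'.2 - q.2) - (yk - yi') * (q'.1 - q.1)) =
        (xk - xi') * ((xi' - xi) * (q'.2 - q.2) - (yi' - yi) * (q'.1 - q.1)) +
        (-(q'.1 - q.1)) * ((xi' - xi) * (yk - yi') - (yi' - yi) * (xk - xi')) := by ring
    have := mul_pos (sub_pos.mpr x2) he
    have := mul_nonneg (neg_nonneg.mpr hg) c2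
    have := mul_nonneg (sub_nonneg.mpr x1.le) (neg_nonneg.mpr hm)
    linarith
  · have key : (xk' - xk) * ((xk - xi') * (q'.2 - q.2) - (yk - yi') * (q'.1 - q.1)) =
        (xk - xi') * ((xk' - xk) * (q'.2 - q.2) - (yk' - yk) * (q'.1 - q.1)) +
        (q'.1 - q.1) * ((xk - xi') * (yk' - yk) - (yk - yi') * (xk' - xk)) := by ring
    have := mul_pos (sub_pos.mpr x2) hf
    have := mul_nonneg hg c3
    have := mul_nonneg (sub_nonneg.mpr x3.le) (neg_nonneg.mpr hm)
    linarith

/-- The leftmost maximum of row `i` is in column `k`. -/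
structure Opt (i k : ℕ) : Prop where
  lt : i < k
  lt_m : k < D.m
  le : ∀ k', i < k' → k' < D.m → D.W i k' ≤ D.W i k
  left : ∀ k', i < k' → k' < k → D.W i k' < D.W i k

variable {D}

/-- By the quadrangle inequality a column that loses strictly against a later one in row `i` keeps
losing in the rows below, as long as it is present there. -/
theorem Opt.left_of_row {i i' k k' : ℕ} (h : D.Opt i k) (hi : i < i') (hk' : i' < k')
    (hlt : k' < k) : D.W i' k' < D.W i' k := by
  have := D.monge hi hk' hlt h.lt_m
  have := h.left k' (by omega) hlt
  linarith

theorem Opt.right_of_row {i i' k k' : ℕ} (h : D.Opt i k) (hi : i' < i) (hlt : k < k')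
    (hm : k' < D.m) : D.W i' k' ≤ D.W i' k := by
  have := D.monge hi h.lt hlt hm
  have := h.le k' (by have := h.lt; omega) hm
  linarith

theorem Opt.mono {i i' k k' : ℕ} (h : D.Opt i k) (h' : D.Opt i' k') (hi : i < i') : k ≤ k' := by
  by_contra hlt
  have := h.left_of_row hi h'.lt (not_le.mp hlt)
  have := h'.le k (by have := h'.lt; omega) h.lt_m
  linarith

variable (D)

/-- To the right of the vertex `j` of the upper chain there is nothing better for the chords that
are at least as steep as `i k`. -/
def PtrOK (i k j : ℕ) : Prop :=
  ∀ i' k', i ≤ i' → k ≤ k' → i' < k' → k' < D.m → ∀ q ∈ D.S, D.bx j ≤ q.1 →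
    D.val i' k' q ≤ D.val i' k' (D.up j)

variable {D}

theorem PtrOK.weaken {i k i' k' j : ℕ} (h : D.PtrOK i k j) (hi : i ≤ i') (hk : k ≤ k') :
    D.PtrOK i' k' j :=
  fun i'' k'' h1 h2 => h i'' k'' (hi.trans h1) (hk.trans h2)

/-- Only points on the vertical line of the rightmost upper vertex are concerned, and none of them
is higher than that vertex. -/
theorem ptrOK_last (i k : ℕ) : D.PtrOK i k (D.mb - 1) := by
  intro i' k' _ _ hik hk q hq hx
  have hr : (q.1, -q.2) ∈ reflect D.S := by simpa [reflect] using hq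
  have h1 := D.chainB.last _ hr
  have h2 : q.1 = D.bx (D.mb - 1) := le_antisymm h1 hx
  have h3 := D.chainB.bot _ hr h2
  have h4 := D.chainA.strict hik hk
  simp only [val, area2, up] at *
  rw [h2]
  have := mul_nonneg (sub_nonneg.mpr h4.le) (sub_nonneg.mpr h3)
  linarith

/-- If the upper edge from `j` to `j + 1` is no steeper than the chord, it is no steeper than any
later chord. Then vertex `j` is at least as good as vertex `j + 1` and as all points under that
edge. -/
theorem PtrOK.move {i k j : ℕ} (h : D.PtrOK i k (j + 1)) (hj : j + 1 < D.mb) (hik : i < k)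
    (hk : k < D.m) (hle : D.val i k (D.up (j + 1)) ≤ D.val i k (D.up j)) : D.PtrOK i k j := by
  intro i' k' hi hk2 hik' hk' q hq hx
  have hr : (q.1, -q.2) ∈ reflect D.S := by simpa [reflect] using hq
  have h1 := D.chainA.strict hik hk
  have h2 := D.chainA.strict hik' hk'
  have h3 := D.chainB.lt j hj
  have h4 := D.chainA.chord hik hik' hi hk2 hk'
  have h5 := D.chainB.left j hj _ hr
  have h7 := h i' k' hi hk2 hik' hk' q hq
  simp only [val, area2, up] at *
  have h6 : 0 ≤ (D.bx (j + 1) - D.bx j) * (D.ay k' - D.ay i') -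
      (D.by' j - D.by' (j + 1)) * (D.ax k' - D.ax i') :=
    cross_nonneg_trans (b := D.ax k - D.ax i) (b' := D.ay k - D.ay i) (by linarith)
      (by linarith) (by linarith) (by linarith) (by linarith)
  rcases le_or_gt (D.bx (j + 1)) q.1 with h8 | h8
  · linarith [h7 h8]
  · have h9 : 0 ≤ (q.1 - D.bx j) * (D.ay k' - D.ay i') -
      (q.2 + D.by' j) * (D.ax k' - D.ax i') :=
      cross_nonneg_trans (b := D.bx (j + 1) - D.bx j) (b' := D.by' j - D.by' (j + 1))
        (by linarith) (by linarith) (by linarith) (by linarith) (by linarith)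
    linarith

/-- A strict loss at `j - 1` means that the upper edge ending at `j` is steeper than the chord. All
points to the left lie below its line, hence are no better than vertex `j`. For `j = 0` there are no
such points. -/
theorem PtrOK.opt {i k j : ℕ} (h : D.PtrOK i k j) (hj : j < D.mb) (hik : i < k)
    (hk : k < D.m) (hlast : 1 ≤ j → D.val i k (D.up (j - 1)) < D.val i k (D.up j)) :
    ∀ q ∈ D.S, D.val i k q ≤ D.val i k (D.up j) := by
  intro q hq
  rcases le_or_gt (D.bx j) q.1 with hx | hx
  · exact h i k le_rfl le_rfl hik hk q hq hx
  have hr : (q.1, -q.2) ∈ reflect D.S := by simpa [reflect] using hq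
  rcases j with _ | j
  · exact absurd hx (not_lt.mpr (D.chainB.first (q.1, -q.2) hr))
  have h1 := D.chainA.strict hik hk
  have h3 := D.chainB.lt j hj
  have h5 := D.chainB.left j hj _ hr
  have h6 := hlast (by omega)
  simp only [val, area2, up, Nat.add_sub_cancel] at *
  have h9 : 0 ≤ (D.ax k - D.ax i) * (-D.by' (j + 1) - q.2) -
      (D.ay k - D.ay i) * (D.bx (j + 1) - q.1) :=
    cross_nonneg_trans (b := D.bx (j + 1) - D.bx j) (b' := D.by' j - D.by' (j + 1))
      (by linarith) (by linarith) (by linarith) (by linarith) (by linarith)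
  linarith

end SearchData

/-! ### The search program and its row scan -/

namespace Code

/-- The value of the triangle on the current chord and the vertex `j` of the upper chain. -/
def score (j : NExpr) : RExpr :=
  .sub (.mul (.reg 23) (.sub (.sub (.reg 13) (.get 11 j)) (.reg 22)))
    (.mul (.sub (.get 10 j) (.reg 21)) (.reg 24))

/-- Move the pointer on the upper chain to the left as long as the value does not decrease. -/
def pointerLoop : Prog :=
  .loop (.and (.nle (.const 1) (.reg 14))
    (.rle (score (.reg 14)) (score (.sub (.reg 14) (.const 1)))))
    (.nset 14 (.sub (.reg 14) (.const 1)))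

/-- Record the current triangle as the best one. -/
def recordBest : Prog :=
  .seq (.rset 0 (.reg 20)) (.seq (.rset 1 (.reg 21))
  (.seq (.rset 2 (.add (.mul (.reg 14) (.reg 22)) (.reg 15)))
  (.seq (.rset 3 (.get 10 (.reg 14)))
  (.seq (.rset 4 (.add (.mul (.reg 14) (.sub (.reg 13) (.get 11 (.reg 14)))) (.reg 15)))
  (.seq (.rset 5 (.get 8 (.reg 12)))
  (.rset 6 (.add (.mul (.reg 14) (.get 9 (.reg 12))) (.reg 15))))))))

/-- The program that updates the best column of a row. -/
def recordRow : Prog :=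
  .branch (.rle (.reg 20) (.reg 19)) .skip (.seq (.rset 19 (.reg 20)) (.nput 0 (.reg 11) (.reg 12)))

/-- The program that updates the best triangle. -/
def recordMax : Prog := .branch (.rle (.reg 20) (.reg 0)) .skip recordBest

/-- Evaluate one column of a row. -/
def scanStep : Prog :=
  .seq (.rset 23 (.sub (.get 8 (.reg 12)) (.reg 21)))
  (.seq (.rset 24 (.sub (.get 9 (.reg 12)) (.reg 22)))
  (.seq pointerLoop (.seq (.rset 20 (score (.reg 14)))
  (.seq recordRow (.seq recordMax
  (.nset 12 (.add (.reg 12) (.const 1))))))))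

/-- Evaluate the columns of a row up to the bound in register `13`. -/
def scan : Prog := .loop (.nle (.reg 12) (.reg 13)) scanStep

/-- Prepare the search of the row `r`, using the best columns of the rows `r - s` and `r + s`. -/
def rowStart : Prog :=
  .seq (.nset 12 (.add (.sub (.get 0 (.sub (.reg 11) (.reg 10))) (.reg 11)) (.reg 11)))
  (.seq (.branch (.nle (.add (.add (.reg 11) (.reg 10)) (.const 1)) (.reg 8))
    (.nset 13 (.get 0 (.add (.reg 11) (.reg 10)))) (.nset 13 (.sub (.reg 8) (.const 1))))
  (.seq (.rset 21 (.get 8 (.sub (.reg 11) (.const 1))))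
  (.seq (.rset 22 (.get 9 (.sub (.reg 11) (.const 1)))) (.rset 19 (.const (-1))))))

/-- Find the best column of the row `r`, and go to the next row of the level. -/
def row : Prog :=
  .seq rowStart (.seq scan (.nset 11 (.add (.reg 11) (.add (.reg 10) (.reg 10)))))

/-- Find the best columns of the rows that are odd multiples of the stride `s`. -/
def level : Prog :=
  .seq (.nset 14 (.sub (.reg 9) (.const 1))) (.seq (.nset 11 (.reg 10))
    (.loop (.nle (.add (.reg 11) (.const 1)) (.reg 8)) row))

/-- Find the best triangle with two vertices on the lower and one on the upper chain. -/
def search : Prog :=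
  .seq (.nput 0 (.const 0) (.const 0)) (.seq (.nset 10 (.const 1))
  (.seq (.loop (.nle (.add (.reg 10) (.const 1)) (.reg 8)) (.nset 10 (.add (.reg 10) (.reg 10))))
  (.loop (.nle (.const 1) (.reg 10)) (.seq level (.nset 10 (.half (.reg 10)))))))

end Code

/-- The memory holds the chains of `D`, the sign and the offset. -/
structure SearchData.Rel (D : SearchData) (sg off : ℝ) (s : RAMState) : Prop where
  ax : s.rarr 8 = D.ax
  ay : s.rarr 9 = D.ay
  bx : s.rarr 10 = D.bx
  by' : s.rarr 11 = D.by'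
  m : s.nreg 8 = D.m
  mb : s.nreg 9 = D.mb
  h : s.rreg 13 = D.h
  sg : s.rreg 14 = sg
  off : s.rreg 15 = off

theorem SearchData.Rel.frame {D : SearchData} {sg off : ℝ} {s s' : RAMState} {c : Prog}
    (hR : D.Rel sg off s) (hF : Frame c s s')
    (h : (c.writesRA 8 || c.writesRA 9 || c.writesRA 10 || c.writesRA 11 || c.writesN 8 ||
      c.writesN 9 || c.writesR 13 || c.writesR 14 || c.writesR 15) = false) :
    D.Rel sg off s' := by
  simp only [Bool.or_eq_false_iff] at h
  obtain ⟨⟨⟨⟨⟨⟨⟨⟨h1, h2⟩, h3⟩, h4⟩, h5⟩, h6⟩, h7⟩, h8⟩, h9⟩ := h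
  exact ⟨(hF.ra _ h1).trans hR.ax, (hF.ra _ h2).trans hR.ay, (hF.ra _ h3).trans hR.bx,
    (hF.ra _ h4).trans hR.by', (hF.n _ h5).trans hR.m, (hF.n _ h6).trans hR.mb,
    (hF.r _ h7).trans hR.h, (hF.r _ h8).trans hR.sg, (hF.r _ h9).trans hR.off⟩

/-- The registers hold the chord `i k`. -/
structure SearchData.ChordRel (D : SearchData) (i k : ℕ) (s : RAMState) : Prop where
  x : s.rreg 21 = D.ax i
  y : s.rreg 22 = D.ay i
  dx : s.rreg 23 = D.ax k - D.ax i
  dy : s.rreg 24 = D.ay k - D.ay i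

theorem score_eval {D : SearchData} {sg off : ℝ} {s : RAMState} {i k : ℕ} (hR : D.Rel sg off s)
    (hC : D.ChordRel i k s) (j : NExpr) :
    (Code.score j).eval s = D.val i k (D.up (j.eval s)) := by
  simp only [Code.score, RExpr.eval, hR.h, hR.by', hR.bx, hC.x, hC.y, hC.dx, hC.dy, SearchData.val, area2,
    SearchData.up]
  ring

/-- The pointer moves on ties as well, so when the loop stops the next vertex to the left is
strictly worse, as `PtrOK.opt` requires. Each move is paid by 60 credits stored on the pointer
position. -/
theorem pointerLoop_spec {D : SearchData} {sg off : ℝ} {s : RAMState} {i k c : ℕ}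
    (hR : D.Rel sg off s) (hC : D.ChordRel i k s) (hik : i < k) (hk : k < D.m)
    (hj : s.nreg 14 < D.mb) (hP : D.PtrOK i k (s.nreg 14)) (hc : 60 * s.nreg 14 + 60 ≤ c) :
    WP Code.pointerLoop (fun s' c' => c + 60 * s'.nreg 14 ≤ c' + 60 * s.nreg 14 + 60 ∧
      s'.nreg 14 ≤ s.nreg 14 ∧ D.PtrOK i k (s'.nreg 14) ∧
      D.W i k = D.val i k (D.up (s'.nreg 14))) s c := by
  refine WP.loop (fun s' c' => c + 60 * s'.nreg 14 ≤ c' + 60 * s.nreg 14 ∧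
      s'.nreg 14 ≤ s.nreg 14 ∧ D.PtrOK i k (s'.nreg 14)) ⟨le_rfl, le_rfl, hP⟩ ?_
  rintro s' c' hF ⟨hc', hle, hP'⟩
  have hR' : D.Rel sg off s' := hR.frame hF rfl
  have hC' : D.ChordRel i k s' := ⟨(hF.r _ rfl).trans hC.x, (hF.r _ rfl).trans hC.y,
    (hF.r _ rfl).trans hC.dx, (hF.r _ rfl).trans hC.dy⟩
  simp only [Test.Holds, score_eval hR' hC', NExpr.eval]
  refine ⟨by simp [Code.score]; omega, fun hb => ?_, fun hb => ?_⟩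
  · refine WP.nset ⟨by simp [Code.score]; omega, ?_⟩
    simp [Code.score]
    refine ⟨by omega, by omega, ?_⟩
    obtain ⟨hb1, hb2⟩ := hb
    generalize s'.nreg 14 = j at *
    obtain ⟨j, rfl⟩ : ∃ j', j = j' + 1 := ⟨j - 1, by omega⟩
    exact hP'.move (by omega) hik hk hb2
  · refine ⟨by simp [Code.score]; omega, hle, hP', ?_⟩
    refine D.W_eq (D.up_mem (by omega)) (hP'.opt (by omega) hik hk fun h1 => ?_)
    by_contra h
    exact hb ⟨h1, not_lt.mp h⟩

/-- The registers hold the best triangle so far, which has the property `I`. -/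
def BestRel (I : ℝ → ℝ × ℝ → ℝ × ℝ → ℝ × ℝ → Prop) (s : RAMState) : Prop :=
  I (s.rreg 0) (s.rreg 1, s.rreg 2) (s.rreg 3, s.rreg 4) (s.rreg 5, s.rreg 6)

/-- The property `I` of the best triangle is kept when a better triangle is recorded. -/
def SearchData.Records (D : SearchData) (sg off : ℝ)
    (I : ℝ → ℝ × ℝ → ℝ × ℝ → ℝ × ℝ → Prop) : Prop :=
  ∀ V p q r i k j, I V p q r → i < k → k < D.m → j < D.mb → V < D.val i k (D.up j) →
    I (D.val i k (D.up j)) (D.ax i, sg * D.ay i + off) (D.bx j, sg * (D.h - D.by' j) + off)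
      (D.ax k, sg * D.ay k + off)

/-- The state while the columns from `lo` on of the row `i` are evaluated. -/
structure SearchData.ScanInv (D : SearchData) (sg off : ℝ)
    (I : ℝ → ℝ × ℝ → ℝ × ℝ → ℝ × ℝ → Prop) (i lo hi : ℕ) (V0 : ℝ) (K0 : ℕ → ℕ)
    (s : RAMState) : Prop where
  rel : D.Rel sg off s
  x : s.rreg 21 = D.ax i
  y : s.rreg 22 = D.ay i
  r : s.nreg 11 = i + 1
  bound : s.nreg 13 = hi
  j_lt : s.nreg 14 < D.mb
  lo_le : lo ≤ s.nreg 12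
  ptr : ∃ k0, k0 ≤ s.nreg 12 ∧ k0 ≤ hi ∧ D.PtrOK i k0 (s.nreg 14)
  best : BestRel I s
  best_ge : V0 ≤ s.rreg 0
  W_le : ∀ k, lo ≤ k → k < s.nreg 12 → D.W i k ≤ s.rreg 0
  row : (s.nreg 12 = lo ∧ s.rreg 19 = -1) ∨ (lo ≤ s.narr 0 (i + 1) ∧
    s.narr 0 (i + 1) < s.nreg 12 ∧ s.rreg 19 = D.W i (s.narr 0 (i + 1)) ∧
    (∀ k, lo ≤ k → k < s.nreg 12 → D.W i k ≤ D.W i (s.narr 0 (i + 1))) ∧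
    ∀ k, lo ≤ k → k < s.narr 0 (i + 1) → D.W i k < D.W i (s.narr 0 (i + 1)))
  others : ∀ r, r ≠ i + 1 → s.narr 0 r = K0 r

section scan
variable {D : SearchData} {sg off : ℝ} {I : ℝ → ℝ × ℝ → ℝ × ℝ → ℝ × ℝ → Prop}

theorem recordRow_spec {s : RAMState} {c : ℕ} (hc : 20 ≤ c) :
    WP Code.recordRow (fun s' c' => c ≤ c' + 20 ∧
      ((s.rreg 20 ≤ s.rreg 19 ∧ s'.rreg 19 = s.rreg 19 ∧ s'.narr 0 = s.narr 0) ∨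
      (s.rreg 19 < s.rreg 20 ∧ s'.rreg 19 = s.rreg 20 ∧
        s'.narr 0 = Function.update (s.narr 0) (s.nreg 11) (s.nreg 12)))) s c := by
  refine WP.branch ⟨by simp; omega, fun hb => WP.skip ⟨by simp; omega, ?_⟩, fun hb =>
    WP.seq (WP.rset ⟨by simp; omega, WP.nput ⟨by simp; omega, ?_⟩⟩)⟩
  all_goals simp only [Test.Holds, RExpr.eval] at hb
  · exact ⟨by simp; omega, Or.inl ⟨hb, rfl, rfl⟩⟩
  · exact ⟨by simp; omega, Or.inr ⟨not_le.mp hb, by simp, by simp⟩⟩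

theorem recordMax_spec {s : RAMState} {i k c : ℕ} (hR : D.Rel sg off s)
    (hI : D.Records sg off I) (hx : s.rreg 21 = D.ax i) (hy : s.rreg 22 = D.ay i)
    (hk : s.nreg 12 = k) (hik : i < k) (hkm : k < D.m) (hj : s.nreg 14 < D.mb)
    (hv : s.rreg 20 = D.val i k (D.up (s.nreg 14))) (hB : BestRel I s) (hc : 80 ≤ c) :
    WP Code.recordMax (fun s' c' => c ≤ c' + 80 ∧ BestRel I s' ∧ s.rreg 0 ≤ s'.rreg 0 ∧
      s.rreg 20 ≤ s'.rreg 0) s c := by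
  refine WP.branch ⟨by simp; omega, fun hb => WP.skip ⟨by simp; omega, ?_⟩, fun hb =>
    WP.seq (WP.rset ⟨by simp; omega, WP.seq (WP.rset ⟨by simp; omega,
    WP.seq (WP.rset ⟨by simp; omega, WP.seq (WP.rset ⟨by simp; omega,
    WP.seq (WP.rset ⟨by simp; omega, WP.seq (WP.rset ⟨by simp; omega,
    WP.rset ⟨by simp; omega, ?_⟩⟩)⟩)⟩)⟩)⟩)⟩)⟩
  all_goals simp only [Test.Holds, RExpr.eval] at hb
  · exact ⟨by simp; omega, hB, le_rfl, hb⟩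
  · simp [BestRel, hx, hy, hR.sg, hR.off, hR.bx, hR.by', hR.ax, hR.ay, hR.h, hk]
    rw [hv] at hb ⊢
    exact ⟨by omega, hI _ _ _ _ i k _ hB hik hkm hj (not_le.mp hb), (not_le.mp hb).le⟩

theorem scanStep_spec {s : RAMState} {i lo hi c : ℕ} {V0 : ℝ} {K0 : ℕ → ℕ}
    (hI : D.Records sg off I) (hS : D.ScanInv sg off I i lo hi V0 K0 s)
    (hilo : i < lo) (hkhi : s.nreg 12 ≤ hi) (him : hi < D.m) (hc : 60 * s.nreg 14 + 300 ≤ c) :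
    WP Code.scanStep (fun s' c' => c + 60 * s'.nreg 14 ≤ c' + 60 * s.nreg 14 + 300 ∧
      s'.nreg 12 = s.nreg 12 + 1 ∧
      D.ScanInv sg off I i lo hi V0 K0 s') s c := by
  refine WP.seq (WP.rset ⟨by simp; omega, WP.seq (WP.rset ⟨by simp; omega, WP.seq ?_⟩)⟩)
  have hik : i < s.nreg 12 := hilo.trans_le hS.lo_le
  have hkm : s.nreg 12 < D.m := hkhi.trans_lt him
  obtain ⟨k0, hk0, -, hP0⟩ := hS.ptr
  have hP := hP0.weaken le_rfl hk0
  set s1 := (s.setR 23 (RExpr.eval s (((RExpr.get 8 (NExpr.reg 12)).sub (RExpr.reg 21))))).setR 24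
    (RExpr.eval (s.setR 23 (RExpr.eval s (((RExpr.get 8 (NExpr.reg 12)).sub (RExpr.reg 21)))))
      ((RExpr.get 9 (NExpr.reg 12)).sub (RExpr.reg 22))) with hs1
  have hR := hS.rel
  have hx := hS.x
  have hy := hS.y
  have hR1 : D.Rel sg off s1 := ⟨hR.ax, hR.ay, hR.bx, hR.by', hR.m, hR.mb, by simp [hs1, hR.h],
    by simp [hs1, hR.sg], by simp [hs1, hR.off]⟩
  have hC1 : D.ChordRel i (s.nreg 12) s1 := by
    constructor <;> simp [hs1, hx, hy, hR.ax, hR.ay]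
  have n1 : s1.nreg = s.nreg := rfl
  have a1 : s1.narr = s.narr := rfl
  have r1 : ∀ v, v < 23 → s1.rreg v = s.rreg v := fun v hv => by
    simp [hs1, show v ≠ 23 by omega, show v ≠ 24 by omega]
  clear_value s1
  refine (pointerLoop_spec hR1 hC1 hik hkm (by rw [n1]; exact hS.j_lt) (by rwa [n1])
    (by simp [n1]; omega)).frame.mono ?_
  rintro s2 c2 ⟨⟨hc2, hj2, hP2, hW2⟩, hF2⟩
  have hR2 : D.Rel sg off s2 := hR1.frame hF2 rfl
  have hC2 : D.ChordRel i (s.nreg 12) s2 := ⟨(hF2.r _ rfl).trans hC1.x, (hF2.r _ rfl).trans hC1.y,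
    (hF2.r _ rfl).trans hC1.dx, (hF2.r _ rfl).trans hC1.dy⟩
  have n2 : ∀ v, v ≠ 14 → s2.nreg v = s.nreg v := fun v hv => by
    rw [hF2.n v (by simpa [Code.pointerLoop, Prog.writesN] using hv.symm), n1]
  have r2 : ∀ v, v < 23 → s2.rreg v = s.rreg v := fun v hv => by
    rw [hF2.r v rfl, r1 v hv]
  have a2 : s2.narr 0 = s.narr 0 := by rw [hF2.na 0 rfl, a1]
  simp only [n1, RExpr.cost, NExpr.cost] at hc2 hj2
  refine WP.seq (WP.rset ⟨by simp [Code.score]; omega, WP.seq ?_⟩)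
  rw [score_eval hR2 hC2]
  simp only [NExpr.eval, ← hW2]
  refine (recordRow_spec (by simp [Code.score]; omega)).frame.mono ?_
  rintro s3 c3 ⟨⟨hc3, hrow⟩, hF3⟩
  simp [Code.score] at hc3
  simp [r2, n2, a2] at hrow
  have hR3 : D.Rel sg off s3 := SearchData.Rel.frame (c := Code.recordRow) (s :=
    s2.setR 20 (D.W i (s.nreg 12))) ⟨hR2.ax, hR2.ay, hR2.bx, hR2.by', hR2.m, hR2.mb,
    by simp [hR2.h], by simp [hR2.sg], by simp [hR2.off]⟩ hF3 rfl
  have n3 : s3.nreg = s2.nreg := funext fun v => hF3.n v rfl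
  have r3 : ∀ v, v < 19 → s3.rreg v = s.rreg v := fun v hv => by
    rw [hF3.r v (by simp [Code.recordRow, Prog.writesR]; omega), ← r2 v (by omega)]
    simp [show v ≠ 20 by omega]
  have v3 : s3.rreg 20 = D.W i (s.nreg 12) := (hF3.r 20 rfl).trans (by simp)
  have x3 : s3.rreg 21 = D.ax i := (hF3.r 21 rfl).trans (by simp [hC2.x])
  have y3 : s3.rreg 22 = D.ay i := (hF3.r 22 rfl).trans (by simp [hC2.y])
  refine WP.seq ((recordMax_spec (I := I) (k := s.nreg 12) hR3 hI x3 y3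
    (by rw [n3, n2 12 (by omega)]) hik hkm (by rw [n3]; exact hj2.trans_lt hS.j_lt)
    (by rw [v3, n3, hW2]) ?_ (by omega)).frame.mono ?_)
  · have := hS.best
    simp only [BestRel] at this ⊢
    rwa [r3 0 (by omega), r3 1 (by omega), r3 2 (by omega), r3 3 (by omega), r3 4 (by omega),
      r3 5 (by omega), r3 6 (by omega)]
  rintro s4 c4 ⟨⟨hc4, hB4, hV4, hv4⟩, hF4⟩
  have n4 : s4.nreg = s2.nreg := by rw [← n3]; exact funext fun v => hF4.n v rfl
  have a4 : s4.narr 0 = s3.narr 0 := hF4.na 0 rfl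
  have r4 : s4.rreg 19 = s3.rreg 19 := hF4.r 19 rfl
  have hR4 : D.Rel sg off s4 := hR3.frame hF4 rfl
  rw [v3] at hv4
  rw [r3 0 (by omega)] at hV4
  refine WP.nset ⟨by simp; omega, ?_⟩
  simp only [NExpr.cost, NExpr.eval]
  have n12 : s4.nreg 12 = s.nreg 12 := by rw [n4, n2 12 (by omega)]
  refine ⟨by simp [n4]; omega, by simp [n12], ?_⟩
  rw [n12]
  refine ⟨⟨hR4.ax, hR4.ay, hR4.bx, hR4.by', by simp [hR4.m], by simp [hR4.mb], hR4.h, hR4.sg,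
    hR4.off⟩, (hF4.r 21 rfl).trans x3, (hF4.r 22 rfl).trans y3, ?_, ?_, ?_, ?_, ?_, hB4,
    hS.best_ge.trans hV4, ?_, ?_, ?_⟩
  · simp [n4, n2, hS.r]
  · simp [n4, n2, hS.bound]
  · simpa [n4] using hj2.trans_lt hS.j_lt
  · simpa using hS.lo_le.trans (Nat.le_succ _)
  -- The witness stays at most `hi`, so the pointer can be handed on to the next row of the level,
  -- whose columns are not before `hi`.
  · exact ⟨s.nreg 12, by simp, hkhi, by simpa [n4] using hP2⟩
  · intro k h1 h2
    simp only [RAMState.setN_nreg, if_true] at h2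
    rcases Nat.lt_succ_iff_lt_or_eq.mp h2 with h2 | rfl
    · exact (hS.W_le k h1 h2).trans hV4
    · exact hv4
  · simp only [RAMState.setN_nreg, RAMState.setN_narr, RAMState.setN_rreg, if_true, a4, r4]
    right
    rcases hrow with ⟨hle, e19, ea⟩ | ⟨hlt, e19, ea⟩
    · rw [ea, e19]
      rcases hS.row with ⟨-, h0⟩ | ⟨h1, h2, h3, h4, h5⟩
      -- The first column of a row always beats the starting value `-1`.
      · have := D.W_nonneg hik hkm
        linarith
      · refine ⟨h1, by omega, h3, fun k hk1 hk2 => ?_, h5⟩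
        rcases Nat.lt_succ_iff_lt_or_eq.mp hk2 with hk2 | rfl
        · exact h4 k hk1 hk2
        · rwa [← h3]
    · rw [ea, e19, hS.r, Function.update_self]
      have key : ∀ k, lo ≤ k → k < s.nreg 12 → D.W i k < D.W i (s.nreg 12) := by
        intro k hk1 hk2
        rcases hS.row with ⟨h0, -⟩ | ⟨h1, h2, h3, h4, h5⟩
        · omega
        · rw [h3] at hlt
          exact (h4 k hk1 hk2).trans_lt hlt
      refine ⟨hS.lo_le, by omega, rfl, fun k hk1 hk2 => ?_, key⟩
      rcases Nat.lt_succ_iff_lt_or_eq.mp hk2 with hk2 | rfl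
      · exact (key k hk1 hk2).le
      · exact le_rfl
  · intro r hr
    simp only [RAMState.setN_narr, a4]
    rw [← hS.others r hr]
    rcases hrow with ⟨-, -, ea⟩ | ⟨-, -, ea⟩
    · rw [ea]
    · rw [ea, hS.r, Function.update_of_ne hr]

theorem scan_spec {s : RAMState} {i lo hi c : ℕ} {V0 : ℝ} {K0 : ℕ → ℕ}
    (hI : D.Records sg off I) (hS : D.ScanInv sg off I i lo hi V0 K0 s)
    (hilo : i < lo) (hlo : s.nreg 12 = lo) (hlohi : lo ≤ hi) (him : hi < D.m)
    (hc : 60 * s.nreg 14 + 310 * (hi + 1 - lo) + 310 ≤ c) :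
    WP Code.scan (fun s' c' => c + 60 * s'.nreg 14 ≤
        c' + 60 * s.nreg 14 + 310 * (hi + 1 - lo) + 10 ∧ s'.nreg 12 = hi + 1 ∧
      D.ScanInv sg off I i lo hi V0 K0 s') s c := by
  refine WP.loop (fun s' c' => c + 60 * s'.nreg 14 ≤
        c' + 60 * s.nreg 14 + 310 * (s'.nreg 12 - lo) ∧ s'.nreg 12 ≤ hi + 1 ∧
      D.ScanInv sg off I i lo hi V0 K0 s') ⟨by omega, by omega, hS⟩ ?_
  rintro s' c' hF ⟨hc', hle, hS'⟩
  have h13 := hS'.bound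
  have hlo' := hS'.lo_le
  simp only [Test.cost, NExpr.cost, Test.Holds, NExpr.eval, h13]
  refine ⟨by omega, fun hb => ?_, fun hb => ⟨?_, by omega, hS'⟩⟩
  · refine (scanStep_spec hI hS' hilo hb him (by omega)).mono ?_
    rintro s1 c1 ⟨h1, h2, h3⟩
    exact ⟨by omega, by omega, h3⟩
  · have : s'.nreg 12 = hi + 1 := by omega
    rw [this] at hc'
    omega

end scan

/-! ### Divide and conquer over the rows -/

variable {D : SearchData} {sg off : ℝ} {I : ℝ → ℝ × ℝ → ℝ × ℝ → ℝ × ℝ → Prop}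

/-- The column `k` is a lower bound for the best column of row `i`. -/
def SearchData.LeftBound (D : SearchData) (i k : ℕ) : Prop := k = 0 ∨ ∃ i1, i1 < i ∧ D.Opt i1 k

/-- The column `k` is an upper bound for the best column of row `i`. -/
def SearchData.RightBound (D : SearchData) (i k : ℕ) : Prop :=
  k + 1 = D.m ∨ ∃ i2, i < i2 ∧ D.Opt i2 k

theorem SearchData.RightBound.lt_m {i k : ℕ} (h : D.RightBound i k) : k < D.m := by
  rcases h with h | ⟨i2, _, h⟩
  · omega
  · exact h.lt_m

/-- The best column of a row lies between those of two other rows. -/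
theorem SearchData.Opt.of_range {i lo hi k1 k : ℕ} (hlo : lo = max k1 (i + 1))
    (h1 : D.LeftBound i k1)
    (h2 : D.RightBound i hi) (hk1 : lo ≤ k) (hk2 : k ≤ hi)
    (hle : ∀ k', lo ≤ k' → k' < hi + 1 → D.W i k' ≤ D.W i k)
    (hlt : ∀ k', lo ≤ k' → k' < k → D.W i k' < D.W i k) : D.Opt i k := by
  have him : hi < D.m := h2.lt_m
  have hleft : ∀ k', i < k' → k' < lo → D.W i k' < D.W i k := by
    intro k' h3 h4
    rcases h1 with rfl | ⟨i1, h5, h6⟩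
    · omega
    · have : lo = k1 := by omega
      subst this
      exact (h6.left_of_row h5 h3 h4).trans_le (hle lo le_rfl (by omega))
  have hright : ∀ k', hi < k' → k' < D.m → D.W i k' ≤ D.W i k := by
    intro k' h3 h4
    rcases h2 with h2 | ⟨i2, h5, h6⟩
    · omega
    · exact (h6.right_of_row h5 h3 h4).trans (hle hi (by omega) (by omega))
  have hik : i < k := by omega
  refine ⟨hik, by omega, fun k' h3 h4 => ?_, fun k' h3 h4 => ?_⟩
  · rcases Nat.lt_or_ge k' lo with h5 | h5
    · exact (hleft k' h3 h5).le
    · rcases Nat.lt_or_ge hi k' with h6 | h6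
      · exact hright k' h6 h4
      · exact hle k' h5 (by omega)
  · rcases Nat.lt_or_ge k' lo with h5 | h5
    · exact hleft k' h3 h5
    · exact hlt k' h5 h4

/-- The array `K` holds the best column of row `r - 1` at `r`, and the recorded value is at least
its value. -/
def SearchData.RowDone (D : SearchData) (s : RAMState) (r : ℕ) : Prop :=
  D.Opt (r - 1) (s.narr 0 r) ∧ D.W (r - 1) (s.narr 0 r) ≤ s.rreg 0

/-- The state during one level with stride `st`; the next row is `(2 * c + 1) * st`. -/
structure SearchData.LevelInv (D : SearchData) (sg off : ℝ)
    (I : ℝ → ℝ × ℝ → ℝ × ℝ → ℝ × ℝ → Prop) (st c κ : ℕ) (s : RAMState) : Prop where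
  rel : D.Rel sg off s
  best : BestRel I s
  stride : s.nreg 10 = st
  r : s.nreg 11 = (2 * c + 1) * st
  j_lt : s.nreg 14 < D.mb
  zero : s.narr 0 0 = 0
  c_le : 2 * c ≤ D.m
  κ_lt : κ < D.m
  κ_eq : (2 * c + 1) * st < D.m → κ = s.narr 0 (2 * c * st)
  ptr : D.PtrOK ((2 * c + 1) * st - 1) κ (s.nreg 14)
  even : ∀ q, 1 ≤ q → 2 * q * st < D.m → D.RowDone s (2 * q * st)
  odd : ∀ q, q < c → (2 * q + 1) * st < D.m → D.RowDone s ((2 * q + 1) * st)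

theorem SearchData.RowDone.mono {s s' : RAMState} {r : ℕ} (h : D.RowDone s r)
    (ha : s'.narr 0 r = s.narr 0 r) (hV : s.rreg 0 ≤ s'.rreg 0) : D.RowDone s' r := by
  simp only [SearchData.RowDone, ha]
  exact ⟨h.1, h.2.trans hV⟩

theorem rowStart_spec {s : RAMState} {t r st lo hi : ℕ} (hR : D.Rel sg off s)
    (h10 : s.nreg 10 = st) (h11 : s.nreg 11 = r) (hr1 : 1 ≤ r) (hB : BestRel I s)
    (hj : s.nreg 14 < D.mb) (hlo : lo = s.narr 0 (r - st) - r + r)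
    (hhi : hi = if r + st < D.m then s.narr 0 (r + st) else D.m - 1)
    (hptr : ∃ k0, k0 ≤ lo ∧ k0 ≤ hi ∧ D.PtrOK (r - 1) k0 (s.nreg 14)) (ht : 100 ≤ t) :
    WP Code.rowStart (fun s' t' => t ≤ t' + 100 ∧ s'.nreg 12 = lo ∧ s'.nreg 14 = s.nreg 14 ∧
      D.ScanInv sg off I (r - 1) lo hi (s.rreg 0) (s.narr 0) s') s t := by
  have main : ∀ t', t ≤ t' + 50 → WP (.seq (.rset 21 (.get 8 (.sub (.reg 11) (.const 1))))
      (.seq (.rset 22 (.get 9 (.sub (.reg 11) (.const 1)))) (.rset 19 (.const (-1)))))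
      (fun s' t' => t ≤ t' + 100 ∧ s'.nreg 12 = lo ∧ s'.nreg 14 = s.nreg 14 ∧
      D.ScanInv sg off I (r - 1) lo hi (s.rreg 0) (s.narr 0) s')
      ((s.setN 12 lo).setN 13 hi) t' := by
    intro t' ht'
    refine WP.seq (WP.rset ⟨by simp; omega, WP.seq (WP.rset ⟨by simp; omega,
      WP.rset ⟨by simp; omega, ?_⟩⟩)⟩)
    refine ⟨by simp; omega, by simp, by simp, ?_⟩
    refine ⟨⟨hR.ax, hR.ay, hR.bx, hR.by', hR.m, hR.mb, by simp [hR.h], by simp [hR.sg],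
      by simp [hR.off]⟩, by simp [hR.ax, h11], by simp [hR.ay, h11], ?_, by simp, by simpa using hj,
      by simp, by simpa using hptr, by simpa [BestRel] using hB, by simp, ?_, Or.inl (by simp), by simp⟩
    · simp [h11]
      omega
    · intro k h1 h2
      simp at h2
      omega
  refine WP.seq (WP.nset ⟨by simp; omega, WP.seq (WP.branch ⟨by simp; omega, fun hb =>
    WP.nset ⟨by simp; omega, ?_⟩, fun hb => WP.nset ⟨by simp; omega, ?_⟩⟩)⟩)
  all_goals
    simp [h10, h11, hR.m] at hb
    simp only [NExpr.eval, RAMState.setN_nreg, RAMState.setN_narr, h10, h11, hR.m]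
    rw [← hlo]
    norm_num
  · rw [if_pos (by omega)] at hhi
    rw [← hhi]
    exact main _ (by omega)
  · rw [if_neg (by omega)] at hhi
    rw [← hhi]
    exact main _ (by omega)

/-- The row `r - 1` lies between two rows at even multiples of the stride, and only the columns
between their optima are scanned. The right bound `κ'` is the left bound of the next row, so the
scan costs `310 * (κ' - κ)` telescope over a level. -/
theorem row_spec {s : RAMState} {st c κ t : ℕ} (hI : D.Records sg off I) (hst : 1 ≤ st)
    (hL : D.LevelInv sg off I st c κ s) (hr : (2 * c + 1) * st < D.m)
    (ht : 60 * s.nreg 14 + 310 * (D.m - κ) + 1000 ≤ t) :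
    WP Code.row (fun s' t' => ∃ κ', κ ≤ κ' ∧
      t + 60 * s'.nreg 14 ≤ t' + 60 * s.nreg 14 + 310 * (κ' - κ) + 1000 ∧
      D.LevelInv sg off I st (c + 1) κ' s') s t := by
  obtain ⟨hR, hB, h10, h11, hj, h0, hc, hκ, hκeq, hptr, heven, hodd⟩ := hL
  replace hκeq := hκeq hr
  set r := (2 * c + 1) * st with hrdef
  have hprev : r - st = 2 * c * st := by rw [hrdef, add_mul, one_mul]; omega
  have hst_r : st ≤ r := by rw [hrdef, add_mul, one_mul]; omega
  have hnext : r + st = 2 * (c + 1) * st := by rw [hrdef]; ring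
  -- Row `i` is stored in cell `i + 1`; cell `0` holds the sentinel column `0`, the left bound of
  -- the first row of each level.
  have hκopt : D.LeftBound (r - 1) κ := by
    rcases Nat.eq_zero_or_pos c with rfl | hcpos
    · left; rw [hκeq]; simpa using h0
    · right
      refine ⟨2 * c * st - 1, ?_, ?_⟩
      · have : 1 * 1 ≤ 2 * c * st := Nat.mul_le_mul (by omega) hst
        omega
      · rw [hκeq]; exact (heven c hcpos (by omega)).1
  set hi := if r + st < D.m then s.narr 0 (r + st) else D.m - 1 with hhi
  have hiopt : D.RightBound (r - 1) hi := by
    by_cases h : r + st < D.m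
    · right
      rw [hhi, if_pos h]
      refine ⟨r + st - 1, by omega, ?_⟩
      rw [hnext] at h ⊢
      exact (heven (c + 1) (by omega) h).1
    · left
      rw [hhi, if_neg h]
      omega
  have him : hi < D.m := hiopt.lt_m
  have hκhi : κ ≤ hi := by
    rcases hiopt with h | ⟨i2, h2, h⟩
    · omega
    · rcases hκopt with h3 | ⟨i1, h4, h5⟩
      · omega
      · exact h5.mono h (by omega)
  have hrhi : r ≤ hi := by
    rcases hiopt with h | ⟨i2, h2, h⟩
    · omega
    · have := h.lt
      omega
  -- Truncated subtraction makes this a maximum: the columns of row `r - 1` start at `r`.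
  have hlo : κ - r + r = max κ (r - 1 + 1) := by omega
  refine WP.seq ((rowStart_spec (I := I) (lo := κ - r + r) (hi := hi) hR h10 h11 (by omega) hB hj
    (by rw [hprev, ← hκeq]) rfl ⟨κ, by omega, hκhi, hptr⟩ (by omega)).frame.mono ?_)
  rintro s1 t1 ⟨⟨ht1, hk1, hj1, hS1⟩, hF1⟩
  refine WP.seq ((scan_spec hI hS1 (by omega) hk1 (by omega) him (by omega)).frame.mono ?_)
  rintro s2 t2 ⟨⟨ht2, hk2, hS2⟩, hF2⟩
  refine WP.nset ⟨by simp; omega, hi, hκhi, by simp; omega, ?_⟩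
  have hst2 : s2.nreg 10 = st := ((hF2.n 10 rfl).trans (hF1.n 10 rfl)).trans h10
  have h12 := hS2.r
  have hR2 := hS2.rel
  have hother : ∀ q, q ≠ r → D.RowDone s q → D.RowDone (s2.setN 11
      ((NExpr.add (.reg 11) (.add (.reg 10) (.reg 10))).eval s2)) q := fun q hq h =>
    h.mono (by simpa using hS2.others q (by omega)) hS2.best_ge
  have hdone : D.RowDone (s2.setN 11 ((NExpr.add (.reg 11) (.add (.reg 10) (.reg 10))).eval s2))
      r := by
    have hrow := hS2.row
    rw [hk2, show r - 1 + 1 = r by omega] at hrow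
    rcases hrow with ⟨h, -⟩ | ⟨h1, h2, -, h3, h4⟩
    · omega
    · refine ⟨.of_range hlo hκopt hiopt h1 (Nat.lt_succ_iff.mp h2) h3 h4, ?_⟩
      exact hS2.W_le _ h1 (by rw [hk2]; exact h2)
  have hcm : 2 * c + 1 < D.m := lt_of_le_of_lt (Nat.le_mul_of_pos_right _ hst) hr
  refine ⟨⟨hR2.ax, hR2.ay, hR2.bx, hR2.by', by simp [hR2.m], by simp [hR2.mb], hR2.h, hR2.sg,
    hR2.off⟩, hS2.best, by simp [hst2], ?_, by simpa using hS2.j_lt, ?_, by omega, him, ?_, ?_,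
    ?_, ?_⟩
  · simp only [RAMState.setN_nreg, NExpr.eval, if_true, h12, hst2]
    rw [show r - 1 + 1 = r by omega, hrdef]
    ring
  · simpa [h0] using hS2.others 0 (by omega)
  · intro hlt
    have e : (2 * (c + 1) + 1) * st = r + st + st := by rw [hrdef]; ring
    rw [hhi, if_pos (by omega), ← hnext]
    exact (hS2.others (r + st) (by omega)).symm
  · obtain ⟨k0, -, hk0, hP⟩ := hS2.ptr
    have e : (2 * (c + 1) + 1) * st = r + st + st := by rw [hrdef]; ring
    rw [e]
    simpa using hP.weaken (show r - 1 ≤ r + st + st - 1 by omega) hk0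
  · intro q hq1 hq2
    refine hother _ ?_ (heven q hq1 hq2)
    intro h
    have := Nat.eq_of_mul_eq_mul_right hst h
    omega
  · intro q hq1 hq2
    rcases Nat.lt_succ_iff_lt_or_eq.mp hq1 with h | rfl
    · refine hother _ ?_ (hodd q h hq2)
      intro h
      have := Nat.eq_of_mul_eq_mul_right hst h
      omega
    · exact hdone

/-- The charge is linear in the number `c` of rows treated, the left bound `κ` and the distance the
pointer has moved from the right end, and each of these is at most `n`. Multiples of `st` are either
even, known from the level before, or odd, found now. -/
theorem level_spec {s : RAMState} {st t n : ℕ} (hI : D.Records sg off I) (hst : 1 ≤ st)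
    (hR : D.Rel sg off s) (hB : BestRel I s) (h10 : s.nreg 10 = st) (h0 : s.narr 0 0 = 0)
    (hn : D.m ≤ n) (hn' : D.mb ≤ n)
    (hrows : ∀ q, 1 ≤ q → q * (2 * st) < D.m → D.RowDone s (q * (2 * st)))
    (ht : 3000 * n + 1000 ≤ t) :
    WP Code.level (fun s' t' => t ≤ t' + 3000 * n + 1000 ∧ D.Rel sg off s' ∧ BestRel I s' ∧
      s'.narr 0 0 = 0 ∧ ∀ q, 1 ≤ q → q * st < D.m → D.RowDone s' (q * st)) s t := by
  have hm := D.chainA.pos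
  have hmb := D.chainB.pos
  refine WP.seq (WP.nset ⟨by simp; omega, WP.seq (WP.nset ⟨by simp; omega, ?_⟩)⟩)
  refine WP.loop (fun s' t' => ∃ c κ, D.LevelInv sg off I st c κ s' ∧
    t + 60 * s'.nreg 14 ≤ t' + 60 * n + 1100 * c + 310 * κ + 20) ?_ ?_
  · refine ⟨0, 0, ⟨⟨hR.ax, hR.ay, hR.bx, hR.by', by simp [hR.m], by simp [hR.mb], hR.h, hR.sg,
      hR.off⟩, hB, by simp [h10], by simp [h10], ?_, h0, by omega, hm, ?_, ?_, ?_, by omega⟩, ?_⟩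
    · simp [hR.mb]; omega
    · simp [h0]
    · simpa [hR.mb] using D.ptrOK_last _ _
    · intro q h1 h2
      have := hrows q h1 (by rwa [show q * (2 * st) = 2 * q * st by ring])
      rw [show q * (2 * st) = 2 * q * st by ring] at this
      exact this
    · simp [hR.mb]
      omega
  · rintro s' t' hF ⟨c, κ, hL, ht'⟩
    have h11 := hL.r
    have hj := hL.j_lt
    have hc := hL.c_le
    have hκ := hL.κ_lt
    simp only [Test.cost, NExpr.cost, Test.Holds, NExpr.eval, hL.rel.m, h11]
    refine ⟨by omega, fun hb => ?_, fun hb => ⟨by omega, hL.rel, hL.best, hL.zero, ?_⟩⟩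
    · refine (row_spec hI hst hL (by omega) (by omega)).mono ?_
      rintro s1 t1 ⟨κ', h1, h2, h3⟩
      exact ⟨c + 1, κ', h3, by omega⟩
    · intro q hq1 hq2
      rcases Nat.even_or_odd' q with ⟨q', rfl | rfl⟩
      · exact hL.even q' (by omega) hq2
      · refine hL.odd q' ?_ hq2
        have h1 : (2 * q' + 1) * st < (2 * c + 1) * st := by omega
        have := Nat.lt_of_mul_lt_mul_right h1
        omega

/-- The first loop finds the first power of two that is at least `D.m`; the second one halves it.
Each level costs at most `C` up to the halving, and there are at most `Nat.log 2 n + 2` of them. -/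
theorem search_spec {s : RAMState} {t n : ℕ} (hI : D.Records sg off I)
    (hR : D.Rel sg off s) (hB : BestRel I s) (hn : D.m ≤ n) (hn' : D.mb ≤ n)
    (ht : (Nat.log 2 n + 2) * (3000 * n + 1100) ≤ t) :
    WP Code.search (fun s' t' => t ≤ t' + (Nat.log 2 n + 2) * (3000 * n + 1100) ∧
      D.Rel sg off s' ∧ BestRel I s' ∧
      ∀ i k, i < k → k < D.m → D.W i k ≤ s'.rreg 0) s t := by
  have hm := D.chainA.pos
  have hlog : (Nat.log 2 n + 2) * (3000 * n + 1100) =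
    (Nat.log 2 n + 1) * (3000 * n + 1010) + 90 * (Nat.log 2 n) + 3000 * n + 1190 := by ring
  obtain ⟨C, hC⟩ : ∃ C, C = 3000 * n + 1010 := ⟨_, rfl⟩
  rw [← hC] at hlog
  refine WP.seq (WP.nput ⟨by simp; omega, WP.seq (WP.nset ⟨by simp; omega, WP.seq ?_⟩)⟩)
  refine WP.loop (fun s' t' => ∃ e, s'.nreg 10 = 2 ^ e ∧ e ≤ Nat.log 2 n + 1 ∧
    t ≤ t' + 20 * e + 20 ∧ D.Rel sg off s' ∧ BestRel I s' ∧ s'.narr 0 0 = 0) ?_ ?_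
  · refine ⟨0, by simp, by omega, by simp; omega, ⟨hR.ax, hR.ay, hR.bx, hR.by', by simp [hR.m],
      by simp [hR.mb], hR.h, hR.sg, hR.off⟩, hB, by simp⟩
  · rintro s1 t1 - ⟨e, h10, he, ht1, hR1, hB1, h01⟩
    simp only [Test.cost, NExpr.cost, Test.Holds, NExpr.eval, hR1.m, h10]
    refine ⟨by omega, fun hb => WP.nset ⟨by simp; omega, ?_⟩, fun hb => ?_⟩
    · refine ⟨e + 1, by simp [h10]; ring, ?_, by simp; omega, ⟨hR1.ax, hR1.ay, hR1.bx, hR1.by',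
        by simp [hR1.m], by simp [hR1.mb], hR1.h, hR1.sg, hR1.off⟩, hB1, h01⟩
      have : e ≤ Nat.log 2 n := Nat.le_log_of_pow_le (by norm_num) (by omega)
      omega
    -- The stride `2 ^ g / 2` is the one to be treated next, when all multiples of `2 ^ g` are done.
    -- At `g = 0` it is `0`: the loop stops with every row done.
    · refine WP.loop (fun s' t' => ∃ g, s'.nreg 10 = 2 ^ g / 2 ∧ g ≤ e + 1 ∧
        t + g * C ≤ t' + (e + 1) * C + 20 * e + 40 ∧
        D.Rel sg off s' ∧ BestRel I s' ∧ s'.narr 0 0 = 0 ∧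
        ∀ q, 1 ≤ q → q * 2 ^ g < D.m → D.RowDone s' (q * 2 ^ g)) ?_ ?_
      · refine ⟨e + 1, ?_, le_rfl, by omega, hR1, hB1, h01, fun q h1 h2 => ?_⟩
        · rw [h10, pow_succ, Nat.mul_div_cancel _ (by norm_num)]
        · have h3 : 1 * 2 ^ (e + 1) ≤ q * 2 ^ (e + 1) := Nat.mul_le_mul_right _ h1
          have h4 : 2 ^ (e + 1) = 2 ^ e + 2 ^ e := by ring
          omega
      · rintro s2 t2 - ⟨g, h10, hg, ht2, hR2, hB2, h02, hrows⟩
        have hle : (e + 1) * C ≤ (Nat.log 2 n + 2) * C := Nat.mul_le_mul_right _ (by omega)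
        have hle2 : (Nat.log 2 n + 2) * C = (Nat.log 2 n + 1) * C + C := by ring
        simp only [Test.cost, NExpr.cost, Test.Holds, NExpr.eval, h10]
        refine ⟨by omega, fun hb => ?_, fun hb => ⟨by omega, hR2, hB2, fun i k hik hk => ?_⟩⟩
        · obtain ⟨g, rfl⟩ : ∃ g', g = g' + 1 := by
            refine ⟨g - 1, ?_⟩
            rcases g with _ | g
            · simp at hb
            · simp
          have hpow : 2 ^ (g + 1) / 2 = 2 ^ g := by
            rw [pow_succ, Nat.mul_div_cancel _ (by norm_num)]
          rw [hpow] at h10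
          have hexp : (g + 1) * C = g * C + C := by ring
          refine WP.seq ((level_spec (st := 2 ^ g) hI Nat.one_le_two_pow hR2 hB2 h10 h02 hn hn'
            (fun q h1 h2 => ?_) (by omega)).frame.mono ?_)
          · have h3 : q * (2 * 2 ^ g) = q * 2 ^ (g + 1) := by ring
            rw [h3] at h2 ⊢
            exact hrows q h1 h2
          · rintro s3 t3 ⟨⟨ht3, hR3, hB3, h03, hrows3⟩, hF3⟩
            have h10' : s3.nreg 10 = 2 ^ g := (hF3.n 10 rfl).trans h10
            refine WP.nset ⟨by simp; omega, g, by simp [h10'], by omega, by simp; omega,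
              ⟨hR3.ax, hR3.ay, hR3.bx, hR3.by', by simp [hR3.m], by simp [hR3.mb], hR3.h, hR3.sg,
              hR3.off⟩, hB3, h03, hrows3⟩
        · have hg0 : g = 0 := by
            rcases g with _ | g
            · rfl
            · rw [pow_succ, Nat.mul_div_cancel _ (by norm_num)] at hb
              exact absurd Nat.one_le_two_pow hb
          subst hg0
          have := hrows (i + 1) (Nat.le_add_left 1 i) (by rw [pow_zero, mul_one]; omega)
          simp only [SearchData.RowDone, pow_zero, mul_one, Nat.add_sub_cancel] at this
          exact (this.1.le k hik hk).trans this.2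

/-! ### Moving the outer vertices to the lower chain -/

namespace SearchData
variable (D : SearchData)

/-- The value does not increase with the height of the left vertex, so it is at most the
interpolation of the values at the chain vertices around `a`. By maximality the right one of them is
not better, hence the left one is not worse. Moving to the left preserves the order of the vertices.
-/
theorem exists_left {a b c : ℝ × ℝ} (ha : a ∈ D.S) (hbc : b.1 ≤ c.1) (hc : c ∈ D.S)
    (hac : a.1 < c.1) (hmax : ∀ p ∈ D.S, area2 D.h p b c ≤ area2 D.h a b c) :
    ∃ t, t < D.m ∧ D.ax t ≤ a.1 ∧
      area2 D.h a b c ≤ area2 D.h (D.ax t, D.ay t) b c := by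
  classical
  have hm := D.chainA.pos
  let P : ℕ → Prop := fun t => t < D.m ∧ D.ax t ≤ a.1
  have hP0 : P 0 := ⟨hm, D.chainA.first a ha⟩
  have hPt : P (Nat.findGreatest P (D.m - 1)) := Nat.findGreatest_spec (P := P) (Nat.zero_le _) hP0
  set t := Nat.findGreatest P (D.m - 1) with ht
  obtain ⟨ht1, ht2⟩ := hPt
  refine ⟨t, ht1, ht2, ?_⟩
  have hlt : t + 1 < D.m := by
    by_contra h
    have h1 : t = D.m - 1 := by omega
    have h2 := D.chainA.last c hc
    rw [← h1] at h2
    linarith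
  have hgt : a.1 < D.ax (t + 1) := by
    by_contra h
    have := Nat.le_findGreatest (P := P) (show t + 1 ≤ D.m - 1 by omega) ⟨hlt, not_lt.mp h⟩
    omega
  have h1 := D.chainA.left t hlt a ha
  have h2 := hmax _ (D.chainA.mem (t + 1) hlt)
  have key : (D.ax (t + 1) - a.1) * area2 D.h (D.ax t, D.ay t) b c +
      (a.1 - D.ax t) * area2 D.h (D.ax (t + 1), D.ay (t + 1)) b c -
      (D.ax (t + 1) - D.ax t) * area2 D.h a b c = (c.1 - b.1) *
      ((D.ax (t + 1) - D.ax t) * (a.2 - D.ay t) - (D.ay (t + 1) - D.ay t) * (a.1 - D.ax t)) := by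
    simp only [area2]; ring
  have h3 := mul_nonneg (sub_nonneg.mpr hbc) h1
  have h4 := mul_nonneg (sub_nonneg.mpr ht2) (sub_nonneg.mpr h2)
  have h5 : 0 ≤ (D.ax (t + 1) - a.1) *
      (area2 D.h (D.ax t, D.ay t) b c - area2 D.h a b c) := by linarith
  exact sub_nonneg.mp (nonneg_of_mul_nonneg_right h5 (by linarith))

/-- The mirror image of `exists_left`, with the first chain vertex that is not to the left of `c`.
-/
theorem exists_right {a b c : ℝ × ℝ} (ha : a ∈ D.S) (hab : a.1 ≤ b.1) (hc : c ∈ D.S)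
    (hac : a.1 < c.1) (hmax : ∀ p ∈ D.S, area2 D.h a b p ≤ area2 D.h a b c) :
    ∃ t, t < D.m ∧ c.1 ≤ D.ax t ∧
      area2 D.h a b c ≤ area2 D.h a b (D.ax t, D.ay t) := by
  classical
  have hm := D.chainA.pos
  have hex : ∃ t, t < D.m ∧ c.1 ≤ D.ax t := ⟨D.m - 1, by omega, D.chainA.last c hc⟩
  have hPt := Nat.find_spec hex
  have hmin := fun t => Nat.find_min (m := t) hex
  generalize Nat.find hex = t at *
  obtain ⟨ht1, ht2⟩ := hPt
  refine ⟨t, ht1, ht2, ?_⟩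
  rcases t with _ | t
  · have := D.chainA.first a ha
    linarith
  have hgt : D.ax t < c.1 := by
    by_contra h
    exact hmin t (by omega) ⟨by omega, not_lt.mp h⟩
  have h1 := D.chainA.left t ht1 c hc
  have h2 := hmax _ (D.chainA.mem t (by omega))
  have key : (c.1 - D.ax t) * area2 D.h a b (D.ax (t + 1), D.ay (t + 1)) +
      (D.ax (t + 1) - c.1) * area2 D.h a b (D.ax t, D.ay t) -
      (D.ax (t + 1) - D.ax t) * area2 D.h a b c = (b.1 - a.1) *
      ((D.ax (t + 1) - D.ax t) * (c.2 - D.ay t) - (D.ay (t + 1) - D.ay t) * (c.1 - D.ax t)) := by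
    simp only [area2]; ring
  have h3 := mul_nonneg (sub_nonneg.mpr hab) h1
  have h4 := mul_nonneg (sub_nonneg.mpr ht2) (sub_nonneg.mpr h2)
  have h5 : 0 ≤ (c.1 - D.ax t) *
      (area2 D.h a b (D.ax (t + 1), D.ay (t + 1)) - area2 D.h a b c) := by linarith
  exact sub_nonneg.mp (nonneg_of_mul_nonneg_right h5 (by linarith))

/-- A largest triangle, if its vertices are in order from left to right, is not larger than the
best one on the chains. -/
theorem le_of_forall_W_le {V : ℝ} (hV : 0 ≤ V)
    (hW : ∀ i k, i < k → k < D.m → D.W i k ≤ V) {a b c : ℝ × ℝ} (ha : a ∈ D.S) (hb : b ∈ D.S)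
    (hc : c ∈ D.S) (hab : a.1 ≤ b.1) (hbc : b.1 ≤ c.1)
    (hmax : ∀ p ∈ D.S, ∀ q ∈ D.S, ∀ r ∈ D.S, area2 D.h p q r ≤ area2 D.h a b c) :
    area2 D.h a b c ≤ V := by
  rcases (hab.trans hbc).lt_or_eq with hac | hac
  · obtain ⟨i, hi, hi1, hi2⟩ := D.exists_left ha hbc hc hac fun p hp => hmax p hp b hb c hc
    have hiS := D.chainA.mem i hi
    obtain ⟨k, hk, hk1, hk2⟩ := D.exists_right (a := (D.ax i, D.ay i)) (b := b) hiS
      (hi1.trans hab) hc (lt_of_le_of_lt hi1 hac)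
      fun p hp => (hmax _ hiS b hb p hp).trans hi2
    -- The left vertex went left and the right one went right. The middle vertex needs no move, as
    -- `W` is a maximum over all of `S`.
    have hik : i < k := by
      by_contra h
      rcases (not_lt.mp h).lt_or_eq with h | rfl
      · have := D.chainA.strict h hi
        linarith
      · linarith
    exact hi2.trans (hk2.trans ((D.le_W i k b hb).trans (hW i k hik hk)))
  · have h1 : b.1 = a.1 := by linarith
    have : area2 D.h a b c = 0 := by simp [area2, h1, ← hac]
    rw [this]
    exact hV

end SearchData

theorem pts_finite (X Y : ℕ → ℝ) (lo hi : ℕ) : (pts X Y lo hi).Finite := by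
  refine ((Set.finite_Iio hi).image fun u => (X u, Y u)).subset ?_
  rintro q ⟨u, -, hu, rfl⟩
  exact ⟨u, hu, rfl⟩

/-- The search data of two chains of a finite set. -/
theorem exists_searchData {S : Set (ℝ × ℝ)} {ax ay bx by' : ℕ → ℝ} {m mb : ℕ} {h : ℝ}
    (hS : S.Finite) (hA : LowerChain S ax ay m) (hB : LowerChain (reflect S) bx by' mb)
    (hh : 0 ≤ h) : ∃ D : SearchData, D.S = S ∧ D.ax = ax ∧ D.ay = ay ∧ D.m = m ∧ D.bx = bx ∧
      D.by' = by' ∧ D.mb = mb ∧ D.h = h := by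
  have : ∀ i k, ∃ w, (∀ q ∈ S, area2 h (ax i, ay i) q (ax k, ay k) ≤ w) ∧
      ∃ q ∈ S, area2 h (ax i, ay i) q (ax k, ay k) = w := by
    intro i k
    obtain ⟨q, hq, hmax⟩ := Set.exists_max_image S (fun q => area2 h (ax i, ay i) q (ax k, ay k))
      hS ⟨_, hA.mem 0 hA.pos⟩
    exact ⟨_, hmax, q, hq, rfl⟩
  choose W hW1 hW2 using this
  exact ⟨⟨S, ax, ay, m, bx, by', mb, h, W, hA, hB, hh, hW1, hW2⟩, rfl, rfl, rfl, rfl, rfl, rfl,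
    rfl, rfl⟩

/-! ### The search in one orientation -/

namespace Code

/-- Copy the chain to the arrays `10` and `11`. -/
def copyChain : Prog :=
  .seq (.nset 7 (.const 0)) (.seq (.loop (.nle (.add (.reg 7) (.const 1)) (.reg 8))
    (.seq (.rput 10 (.reg 7) (.get 8 (.reg 7))) (.seq (.rput 11 (.reg 7) (.get 9 (.reg 7)))
      (.nset 7 (.add (.reg 7) (.const 1))))))
    (.nset 9 (.reg 8)))

/-- Find the best triangle with one upper vertex between two lower ones, in the orientation given
by the sign in register `14`. -/
def half : Prog :=
  .seq (.rset 16 (.sub (.const 0) (.reg 14))) (.seq chain (.seq copyChain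
    (.seq (.rset 16 (.reg 14)) (.seq chain search))))

end Code

theorem copyChain_spec {s : RAMState} {t : ℕ} (ht : 20 * s.nreg 8 + 30 ≤ t) :
    WP Code.copyChain (fun s' t' => t ≤ t' + 20 * s.nreg 8 + 30 ∧ s'.nreg 9 = s.nreg 8 ∧
      ∀ u, u < s.nreg 8 → s'.rarr 10 u = s.rarr 8 u ∧ s'.rarr 11 u = s.rarr 9 u) s t := by
  refine WP.seq (WP.nset ⟨by simp; omega, WP.seq ?_⟩)
  refine WP.loop (fun s' t' => t ≤ t' + 20 * s'.nreg 7 + 5 ∧ s'.nreg 7 ≤ s.nreg 8 ∧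
    ∀ u, u < s'.nreg 7 → s'.rarr 10 u = s.rarr 8 u ∧ s'.rarr 11 u = s.rarr 9 u) ?_ ?_
  · simp; omega
  · rintro s' t' hF ⟨ht', hle, hp⟩
    have e8 : s'.rarr 8 = s.rarr 8 := hF.ra 8 rfl
    have e9 : s'.rarr 9 = s.rarr 9 := hF.ra 9 rfl
    have n8 : s'.nreg 8 = s.nreg 8 := (hF.n 8 rfl).trans (by simp)
    simp only [Test.cost, NExpr.cost, Test.Holds, NExpr.eval, n8]
    refine ⟨by omega, fun hb => ?_, fun hb => ?_⟩
    · refine WP.seq (WP.rput ⟨by simp; omega, WP.seq (WP.rput ⟨by simp; omega,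
          WP.nset ⟨by simp; omega, ?_⟩⟩)⟩)
      simp [e8, e9]
      refine ⟨by omega, by omega, fun u hu => ?_⟩
      rcases Nat.lt_or_eq_of_le hu with hu | rfl
      · rw [Function.update_of_ne hu.ne, Function.update_of_ne hu.ne]
        exact hp u hu
      · simp
    · refine WP.nset ⟨by simp; omega, by simp; omega, by simp [n8], fun u hu => ?_⟩
      exact hp u (by omega)

/-- The chain of the reflected points is copied away before the second chain overwrites it; the copy
agrees only on the first `m` cells. -/
theorem LowerChain.congr {S : Set (ℝ × ℝ)} {cx cy cx' cy' : ℕ → ℝ} {m : ℕ}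
    (hC : LowerChain S cx cy m) (h : ∀ u, u < m → cx' u = cx u ∧ cy' u = cy u) :
    LowerChain S cx' cy' m := by
  obtain ⟨a, b, c, d, e, f, g⟩ := hC
  refine ⟨a, fun i hi => ?_, fun i hi => ?_, fun q hq => ?_, fun q hq => ?_, fun q hq => ?_,
    fun i hi q hq => ?_⟩
  · rw [(h i hi).1, (h i hi).2]; exact b i hi
  · rw [(h i (by omega)).1, (h (i + 1) hi).1]; exact c i hi
  · rw [(h 0 a).1]; exact d q hq
  · rw [(h (m - 1) (by omega)).1]; exact e q hq
  · rw [(h (m - 1) (by omega)).1, (h (m - 1) (by omega)).2]; exact f q hq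
  · rw [(h i (by omega)).1, (h (i + 1) hi).1, (h i (by omega)).2, (h (i + 1) hi).2]
    exact g i hi q hq

theorem reflect_pts (X Y : ℕ → ℝ) (lo hi : ℕ) :
    reflect (pts X Y lo hi) = pts X (fun u => -Y u) lo hi := by
  ext ⟨x, y⟩
  simp only [reflect, pts, Set.mem_ofPred_eq, Prod.mk.injEq]
  constructor
  · rintro ⟨u, h1, h2, h3, h4⟩
    exact ⟨u, h1, h2, h3, by linarith⟩
  · rintro ⟨u, h1, h2, h3, h4⟩
    exact ⟨u, h1, h2, h3, by linarith⟩

set_option maxRecDepth 10000 in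
theorem half_spec {I : ℝ → ℝ × ℝ → ℝ × ℝ → ℝ × ℝ → Prop} {s : RAMState} {n t : ℕ}
    {S : Set (ℝ × ℝ)} {h sg off : ℝ} (hn : s.nreg 0 = n) (hn1 : 1 ≤ n)
    (hs : ∀ u v, u ≤ v → v < n → s.rarr 4 u ≤ s.rarr 4 v)
    (hS : S = pts (s.rarr 4) (fun u => sg * s.rarr 5 u) 0 n)
    (hh : s.rreg 13 = h) (hh0 : 0 ≤ h) (hsg : s.rreg 14 = sg) (hoff : s.rreg 15 = off)
    (hB : BestRel I s)
    (hI : ∀ V p q r, I V p q r → ∀ a ∈ S, ∀ b ∈ S, ∀ c ∈ S, V < area2 h a b c →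
      I (area2 h a b c) (a.1, sg * a.2 + off) (b.1, sg * (h + b.2) + off) (c.1, sg * c.2 + off))
    (ht : (Nat.log 2 n + 2) * (4000 * n + 1400) ≤ t) :
    WP Code.half (fun s' t' => t ≤ t' + (Nat.log 2 n + 2) * (4000 * n + 1400) ∧ BestRel I s' ∧
      (0 ≤ s'.rreg 0 → ∀ a ∈ S, ∀ b ∈ S, ∀ c ∈ S, a.1 ≤ b.1 → b.1 ≤ c.1 →
        (∀ p ∈ S, ∀ q ∈ S, ∀ r ∈ S, area2 h p q r ≤ area2 h a b c) →
        area2 h a b c ≤ s'.rreg 0)) s t := by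
  have hlog : (Nat.log 2 n + 2) * (4000 * n + 1400) = (Nat.log 2 n + 2) * (3000 * n + 1100) +
      (Nat.log 2 n) * (1000 * n + 300) + 2000 * n + 600 := by ring
  refine WP.seq (WP.rset ⟨by simp; omega, WP.seq ?_⟩)
  refine (chain_spec (n := n) (by simp [hn]) hn1 (by simpa using hs)
    (by simp; omega)).frame.mono ?_
  rintro s1 t1 ⟨⟨ht1, hm1, hC1⟩, hF1⟩
  simp at ht1
  refine WP.seq ((copyChain_spec (by omega)).frame.mono ?_)
  rintro s2 t2 ⟨⟨ht2, hm2, hC2⟩, hF2⟩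
  refine WP.seq (WP.rset ⟨by simp; omega, WP.seq ?_⟩)
  have a4 : s2.rarr 4 = s.rarr 4 := (hF2.ra 4 rfl).trans (hF1.ra 4 rfl)
  have a5 : s2.rarr 5 = s.rarr 5 := (hF2.ra 5 rfl).trans (hF1.ra 5 rfl)
  have n0 : s2.nreg 0 = n := ((hF2.n 0 rfl).trans (hF1.n 0 rfl)).trans (by simp [hn])
  have r2 : ∀ v, v < 16 → s2.rreg v = s.rreg v := fun v hv => by
    rw [hF2.r v rfl, hF1.r v ?_]
    · simp [show v ≠ 16 by omega]
    · simp [Code.chain, Code.chainStep, Code.insertPoint, Code.popLoop, Code.pushPoint,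
        Prog.writesR]
      omega
  refine (chain_spec (n := n) (by simp [n0]) hn1 (by simpa [a4] using hs)
    (by simp; omega)).frame.mono ?_
  rintro s3 t3 ⟨⟨ht3, hm3, hC3⟩, hF3⟩
  simp at ht3
  have r3 : ∀ v, v < 16 → s3.rreg v = s.rreg v := fun v hv => by
    rw [hF3.r v ?_, ← r2 v hv]
    · simp [show v ≠ 16 by omega]
    · simp [Code.chain, Code.chainStep, Code.insertPoint, Code.popLoop, Code.pushPoint,
        Prog.writesR]
      omega
  have hA : LowerChain S (s3.rarr 8) (s3.rarr 9) (s3.nreg 8) := by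
    simpa [a4, a5, r2, hsg, ← hS] using hC3
  have hBc : LowerChain (reflect S) (s3.rarr 10) (s3.rarr 11) (s3.nreg 9) := by
    have e10 : s3.rarr 10 = s2.rarr 10 := (hF3.ra 10 rfl).trans rfl
    have e11 : s3.rarr 11 = s2.rarr 11 := (hF3.ra 11 rfl).trans rfl
    have e9 : s3.nreg 9 = s1.nreg 8 := (hF3.n 9 rfl).trans hm2
    rw [e10, e11, e9, hS, reflect_pts]
    refine LowerChain.congr ?_ hC2
    simpa [hsg] using hC1
  have e9 : s3.nreg 9 = s1.nreg 8 := (hF3.n 9 rfl).trans hm2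
  obtain ⟨D, d1, d2, d3, d4, d5, d6, d7, d8⟩ :=
    exists_searchData (by rw [hS]; exact pts_finite _ _ _ _) hA hBc hh0
  have hrec : D.Records sg off I := by
    intro V p q r i k j hV hik hk hj hlt
    have := hI V p q r hV (D.ax i, D.ay i) (by rw [← d1]; exact D.chainA.mem i (by omega))
      (D.up j) (by rw [← d1]; exact D.up_mem hj) (D.ax k, D.ay k)
      (by rw [← d1]; exact D.chainA.mem k hk) (by rw [← d8]; exact hlt)
    rw [← d8] at this
    simpa [SearchData.val, SearchData.up, sub_eq_add_neg] using this
  have hR : D.Rel sg off s3 := ⟨d2.symm, d3.symm, d5.symm, d6.symm, d4.symm, d7.symm,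
    by rw [d8, r3 13 (by omega), hh], by rw [r3 14 (by omega), hsg],
    by rw [r3 15 (by omega), hoff]⟩
  have hB3 : BestRel I s3 := by
    simp only [BestRel] at hB ⊢
    rwa [r3 0 (by omega), r3 1 (by omega), r3 2 (by omega), r3 3 (by omega), r3 4 (by omega),
      r3 5 (by omega), r3 6 (by omega)]
  refine (search_spec (n := n) hrec hR hB3 (by omega) (by omega) (by omega)).mono ?_
  rintro s4 t4 ⟨ht4, -, hB4, hW4⟩
  refine ⟨by omega, hB4, fun h0 a ha b hb c hc hab hbc hmax => ?_⟩
  rw [← d1] at ha hb hc hmax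
  rw [← d8] at hmax ⊢
  exact D.le_of_forall_W_le h0 hW4 ha hb hc hab hbc hmax

/-! ### Triangles on vertical segments of equal height -/

/-- Twice the signed area of a triangle. -/
def cr (p q r : ℝ × ℝ) : ℝ := (r.1 - p.1) * (q.2 - p.2) - (q.1 - p.1) * (r.2 - p.2)

theorem abs_cr_swap_left (p q r : ℝ × ℝ) : |cr p q r| = |cr q p r| := by
  rw [← abs_neg]; congr 1; simp only [cr]; ring

theorem abs_cr_swap_right (p q r : ℝ × ℝ) : |cr p q r| = |cr p r q| := by
  rw [← abs_neg]; congr 1; simp only [cr]; ring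

section index
variable {ι : Type*} {X Y : ι → ℝ} {h V : ℝ}

/-- The signed area is affine in `a`, `b`, `c`, with coefficients of signs minus, plus, minus. Its
maximum over the box is at `(0, h, 0)` and its minimum at `(h, 0, h)`. -/
theorem abs_cr_le_of_sorted {i j k : ι} (h1 : X i ≤ X j) (h2 : X j ≤ X k) {a b c : ℝ}
    (ha : 0 ≤ a ∧ a ≤ h) (hb : 0 ≤ b ∧ b ≤ h) (hc : 0 ≤ c ∧ c ≤ h)
    (hV1 : area2 h (X i, Y i) (X j, Y j) (X k, Y k) ≤ V)
    (hV2 : area2 h (X i, -Y i) (X j, -Y j) (X k, -Y k) ≤ V) :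
    |cr (X i, Y i + a) (X j, Y j + b) (X k, Y k + c)| ≤ V := by
  simp only [area2, cr] at *
  have e1 := mul_nonneg (sub_nonneg.mpr h1) hc.1
  have e2 := mul_nonneg (sub_nonneg.mpr h2) ha.1
  have e3 := mul_nonneg (sub_nonneg.mpr (h1.trans h2)) hb.1
  have e4 := mul_nonneg (sub_nonneg.mpr h1) (sub_nonneg.mpr hc.2)
  have e5 := mul_nonneg (sub_nonneg.mpr h2) (sub_nonneg.mpr ha.2)
  have e6 := mul_nonneg (sub_nonneg.mpr (h1.trans h2)) (sub_nonneg.mpr hb.2)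
  rw [abs_le]
  constructor <;> linarith

/-- A bound for the triangles with one upper vertex between two lower ones, and their reflections,
is a bound for all triangles. -/
theorem abs_cr_le (hV : ∀ i j k, X i ≤ X j → X j ≤ X k →
      area2 h (X i, Y i) (X j, Y j) (X k, Y k) ≤ V ∧
      area2 h (X i, -Y i) (X j, -Y j) (X k, -Y k) ≤ V) (i j k : ι) {a b c : ℝ}
    (ha : 0 ≤ a ∧ a ≤ h) (hb : 0 ≤ b ∧ b ≤ h) (hc : 0 ≤ c ∧ c ≤ h) :
    |cr (X i, Y i + a) (X j, Y j + b) (X k, Y k + c)| ≤ V := by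
  have main : ∀ i j k, ∀ a b c : ℝ, (0 ≤ a ∧ a ≤ h) → (0 ≤ b ∧ b ≤ h) → (0 ≤ c ∧ c ≤ h) →
      X i ≤ X j → X j ≤ X k → |cr (X i, Y i + a) (X j, Y j + b) (X k, Y k + c)| ≤ V :=
    fun i j k a b c ha hb hc h1 h2 =>
      abs_cr_le_of_sorted h1 h2 ha hb hc (hV i j k h1 h2).1 (hV i j k h1 h2).2
  rcases le_total (X i) (X j) with h1 | h1 <;> rcases le_total (X j) (X k) with h2 | h2 <;>
    rcases le_total (X i) (X k) with h3 | h3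
  · exact main _ _ _ _ _ _ ha hb hc h1 h2
  · exact main _ _ _ _ _ _ ha hb hc h1 h2
  · rw [abs_cr_swap_right]; exact main _ _ _ _ _ _ ha hc hb h3 h2
  · rw [abs_cr_swap_right, abs_cr_swap_left]; exact main _ _ _ _ _ _ hc ha hb h3 h1
  · rw [abs_cr_swap_left]; exact main _ _ _ _ _ _ hb ha hc h1 h3
  · rw [abs_cr_swap_left, abs_cr_swap_right]; exact main _ _ _ _ _ _ hb hc ha h2 h3
  · rw [abs_cr_swap_left, abs_cr_swap_right, abs_cr_swap_left]
    exact main _ _ _ _ _ _ hc hb ha h2 h1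
  · rw [abs_cr_swap_left, abs_cr_swap_right, abs_cr_swap_left]
    exact main _ _ _ _ _ _ hc hb ha h2 h1

/-- A triangle that uses one segment twice is not larger than half of the bounding
parallelogram. -/
theorem abs_cr_le_of_not_distinct {w : ℝ} (hw : ∀ i j, X i - X j ≤ w) {i j k : ι}
    (hne : ¬ (i ≠ j ∧ j ≠ k ∧ i ≠ k)) {a b c : ℝ}
    (ha : 0 ≤ a ∧ a ≤ h) (hb : 0 ≤ b ∧ b ≤ h) (hc : 0 ≤ c ∧ c ≤ h) :
    |cr (X i, Y i + a) (X j, Y j + b) (X k, Y k + c)| ≤ w * h := by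
  have main : ∀ i k, ∀ a b c : ℝ, (0 ≤ a ∧ a ≤ h) → (0 ≤ b ∧ b ≤ h) →
      |cr (X i, Y i + a) (X i, Y i + b) (X k, Y k + c)| ≤ w * h := by
    intro i k a b c ha hb
    have : cr (X i, Y i + a) (X i, Y i + b) (X k, Y k + c) = (X k - X i) * (b - a) := by
      simp only [cr]; ring
    rw [this, abs_mul]
    refine mul_le_mul (abs_le.mpr ⟨?_, hw k i⟩) (abs_le.mpr ⟨?_, ?_⟩) (abs_nonneg _) ?_
    · linarith [hw i k]
    · linarith
    · linarith
    · linarith [hw i i]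
  by_cases h1 : i = j
  · subst h1; exact main _ _ _ _ _ ha hb
  by_cases h2 : j = k
  · subst h2; rw [abs_cr_swap_left, abs_cr_swap_right]; exact main _ _ _ _ _ hb hc
  by_cases h3 : i = k
  · subst h3; rw [abs_cr_swap_right]; exact main _ _ _ _ _ ha hc
  · exact absurd ⟨h1, h2, h3⟩ hne

theorem abs_cr_eq_area2 (i j k : ι) :
    |cr (X i, Y i + 0) (X j, Y j + h) (X k, Y k + 0)| =
      |area2 h (X i, Y i) (X j, Y j) (X k, Y k)| := by
  congr 1; simp only [cr, area2]; ring

theorem abs_cr_eq_area2_reflect (i j k : ι) :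
    |cr (X i, Y i + h) (X j, Y j + 0) (X k, Y k + h)| =
      |area2 h (X i, -Y i) (X j, -Y j) (X k, -Y k)| := by
  rw [← abs_neg]; congr 1; simp only [cr, area2]; ring

/-- One of the two triangles on the extreme segments and a third one is not smaller than half of
the bounding parallelogram. -/
theorem exists_abs_cr_ge (i j k : ι) : ∃ a b c : ℝ, (a = 0 ∨ a = h) ∧
    (b = 0 ∨ b = h) ∧ (c = 0 ∨ c = h) ∧
    (X k - X i) * h + |cr (X i, Y i) (X j, Y j) (X k, Y k)| ≤
      |cr (X i, Y i + a) (X j, Y j + b) (X k, Y k + c)| := by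
  -- The two alternating triangles have signed doubled areas `(X k - X i) * h + cr` and `(X k - X i)
  -- * h - cr`; the sign of `cr` selects the larger.
  rcases le_total 0 (cr (X i, Y i) (X j, Y j) (X k, Y k)) with hc | hc
  · refine ⟨0, h, 0, .inl rfl, .inr rfl, .inl rfl, ?_⟩
    rw [abs_of_nonneg hc, abs_cr_eq_area2]
    refine le_trans (le_of_eq ?_) (le_abs_self _)
    simp only [cr, area2]; ring
  · refine ⟨h, 0, h, .inr rfl, .inl rfl, .inr rfl, ?_⟩
    rw [abs_of_nonpos hc, abs_cr_eq_area2_reflect]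
    refine le_trans (le_of_eq ?_) (le_abs_self _)
    simp only [cr, area2]; ring

end index

/-! ### Coordinates along the segments -/

/-- Coordinates across and along the direction `(d0, d1)`. -/
def coord (d0 d1 : ℝ) (p : Plane) : ℝ × ℝ := (d1 * p 0 - d0 * p 1, d0 * p 0 + d1 * p 1)

/-- `coord` is a rotation followed by scaling with the length of `(d0, d1)`, so areas are multiplied
by `d0 * d0 + d1 * d1`. No square root is needed, which matters for the program. -/
theorem triangleArea_eq_cr {d0 d1 : ℝ} (hD : 0 < d0 * d0 + d1 * d1) (p q r : Plane) :
    triangleArea p q r =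
      |cr (coord d0 d1 p) (coord d0 d1 q) (coord d0 d1 r)| / (2 * (d0 * d0 + d1 * d1)) := by
  have : cr (coord d0 d1 p) (coord d0 d1 q) (coord d0 d1 r) = (d0 * d0 + d1 * d1) *
      -((q 0 - p 0) * (r 1 - p 1) - (q 1 - p 1) * (r 0 - p 0)) := by
    simp only [cr, coord]; ring
  rw [this, abs_mul, abs_neg, abs_of_pos hD, triangleArea]
  generalize d0 * d0 + d1 * d1 = D at *
  field_simp

theorem coord_injective {d0 d1 : ℝ} (hD : 0 < d0 * d0 + d1 * d1) :
    Function.Injective (coord d0 d1) := by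
  intro p q hpq
  simp only [coord, Prod.mk.injEq] at hpq
  obtain ⟨h1, h2⟩ := hpq
  ext i
  have e0 : (d0 * d0 + d1 * d1) * (p 0 - q 0) = 0 := by linear_combination d1 * h1 + d0 * h2
  have e1 : (d0 * d0 + d1 * d1) * (p 1 - q 1) = 0 := by linear_combination d1 * h2 - d0 * h1
  fin_cases i
  · exact sub_eq_zero.mp ((mul_eq_zero.mp e0).resolve_left hD.ne')
  · exact sub_eq_zero.mp ((mul_eq_zero.mp e1).resolve_left hD.ne')

/-- The segment `i` is vertical with lower endpoint `(X i, Y i)` and length `h` in the coordinates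
along `(d0, d1)`. -/
structure Coords {n : ℕ} (L : Fin n → Seg) (d0 d1 h : ℝ) (X Y : Fin n → ℝ) : Prop where
  D_pos : 0 < d0 * d0 + d1 * d1
  h_nonneg : 0 ≤ h
  ends : ∀ i, (coord d0 d1 (L i).1 = (X i, Y i) ∧ coord d0 d1 (L i).2 = (X i, Y i + h)) ∨
    (coord d0 d1 (L i).1 = (X i, Y i + h) ∧ coord d0 d1 (L i).2 = (X i, Y i))
  inj : ∀ i j, X i = X j → Y i = Y j → i = j

section coords
variable {n : ℕ} {L : Fin n → Seg} {d0 d1 h : ℝ} {X Y : Fin n → ℝ}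

theorem Coords.exists_of_mem (hC : Coords L d0 d1 h X Y) {p : Plane} (hp : p ∈ endpoints L) :
    ∃ i a, (0 ≤ a ∧ a ≤ h) ∧ p ∈ (L i).carrier ∧ coord d0 d1 p = (X i, Y i + a) := by
  have hh := hC.h_nonneg
  obtain ⟨i, rfl | rfl⟩ := hp <;> rcases hC.ends i with ⟨h1, h2⟩ | ⟨h1, h2⟩
  · exact ⟨i, 0, ⟨le_rfl, hh⟩, left_mem_segment _ _ _, by simp [h1]⟩
  · exact ⟨i, h, ⟨hh, le_rfl⟩, left_mem_segment _ _ _, by simp [h1]⟩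
  · exact ⟨i, h, ⟨hh, le_rfl⟩, right_mem_segment _ _ _, by simp [h2]⟩
  · exact ⟨i, 0, ⟨le_rfl, hh⟩, right_mem_segment _ _ _, by simp [h2]⟩

theorem Coords.exists_endpoint (hC : Coords L d0 d1 h X Y) (i : Fin n) {a : ℝ}
    (ha : a = 0 ∨ a = h) :
    ∃ p ∈ endpoints L, p ∈ (L i).carrier ∧ coord d0 d1 p = (X i, Y i + a) := by
  rcases hC.ends i with ⟨h1, h2⟩ | ⟨h1, h2⟩ <;> rcases ha with rfl | rfl
  · exact ⟨_, ⟨i, .inl rfl⟩, left_mem_segment _ _ _, by simp [h1]⟩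
  · exact ⟨_, ⟨i, .inr rfl⟩, right_mem_segment _ _ _, by simp [h2]⟩
  · exact ⟨_, ⟨i, .inr rfl⟩, right_mem_segment _ _ _, by simp [h2]⟩
  · exact ⟨_, ⟨i, .inl rfl⟩, left_mem_segment _ _ _, by simp [h1]⟩

/-- Each segment is a multiple `c i` of `d` with a common `|c i|`, so its extent along `d` is `|c
i|` times the squared length of `d`. The sign of `c i` tells which endpoint is the upper one.
Disjointness makes the lower endpoints distinct. The length is prescribed through the index of value
`0`, which also covers the empty family. -/
theorem coords_of_parallel (hL : EqualLength L) (hdis : PairwiseDisjoint L) {d : Plane}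
    (hd : d ≠ 0) (hpar : ParallelTo d L) (hh : 0 ≤ h)
    (hlen : ∀ i : Fin n, i.1 = 0 → |d 0 * ((L i).2 0 - (L i).1 0) + d 1 * ((L i).2 1 - (L i).1 1)| = h) :
    Coords L (d 0) (d 1) h (fun i => d 1 * (L i).1 0 - d 0 * (L i).1 1)
      (fun i => min (d 0 * (L i).1 0 + d 1 * (L i).1 1) (d 0 * (L i).2 0 + d 1 * (L i).2 1)) := by
  have hD : 0 < d 0 * d 0 + d 1 * d 1 := by
    rcases eq_or_ne (d 0) 0 with h0 | h0
    · have h1 : d 1 ≠ 0 := by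
        intro h1
        apply hd
        ext i
        fin_cases i
        · exact h0
        · exact h1
      have := mul_self_pos.mpr h1
      have := mul_self_nonneg (d 0)
      linarith
    · have := mul_self_pos.mpr h0
      have := mul_self_nonneg (d 1)
      linarith
  choose c hc using hpar
  have c0 : ∀ i, (L i).2 0 = (L i).1 0 + c i * d 0 := fun i => by
    have := congrArg (fun v : Plane => v 0) (hc i)
    simp at this
    linarith
  have c1 : ∀ i, (L i).2 1 = (L i).1 1 + c i * d 1 := fun i => by
    have := congrArg (fun v : Plane => v 1) (hc i)
    simp at this
    linarith
  have hdist : ∀ i, dist (L i).1 (L i).2 = |c i| * ‖d‖ := fun i => by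
    rw [dist_comm, dist_eq_norm, hc i, norm_smul, Real.norm_eq_abs]
  have hcabs : ∀ i j, |c i| = |c j| := fun i j => by
    have := hL i j
    rw [hdist, hdist] at this
    exact mul_right_cancel₀ (norm_ne_zero_iff.mpr hd) this
  have hch : ∀ i, |c i| * (d 0 * d 0 + d 1 * d 1) = h := fun i => by
    have hn : 0 < n := i.pos
    rw [← hlen ⟨0, hn⟩ rfl, hcabs i ⟨0, hn⟩, c0, c1, ← abs_of_pos hD, ← abs_mul]
    congr 1; ring
  refine ⟨hD, hh, fun i => ?_, fun i j hX hY => ?_⟩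
  · have := hch i
    simp only [coord, c0, c1]
    rcases le_total 0 (c i) with hci | hci
    · rw [abs_of_nonneg hci] at this
      have h2 := mul_nonneg hci hD.le
      left
      rw [min_eq_left (by linarith)]
      exact ⟨rfl, Prod.ext (by ring) (by simp only; linarith)⟩
    · rw [abs_of_nonpos hci] at this
      have h2 := mul_nonneg (neg_nonneg.mpr hci) hD.le
      right
      rw [min_eq_right (by linarith)]
      exact ⟨Prod.ext rfl (by simp only; linarith), Prod.ext (by ring) rfl⟩
  · by_contra hij
    have key : ∀ i, ∃ p ∈ (L i).carrier, coord (d 0) (d 1) p =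
        (d 1 * (L i).1 0 - d 0 * (L i).1 1,
          min (d 0 * (L i).1 0 + d 1 * (L i).1 1) (d 0 * (L i).2 0 + d 1 * (L i).2 1)) := by
      intro i
      rcases le_total (d 0 * (L i).1 0 + d 1 * (L i).1 1) (d 0 * (L i).2 0 + d 1 * (L i).2 1) with
        h1 | h1
      · rw [min_eq_left h1]
        exact ⟨_, left_mem_segment _ _ _, rfl⟩
      · rw [min_eq_right h1]
        refine ⟨_, right_mem_segment _ _ _, ?_⟩
        simp only [coord, c0, c1]
        exact Prod.ext (by ring) rfl
    obtain ⟨p, hp, hp'⟩ := key i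
    obtain ⟨q, hq, hq'⟩ := key j
    simp only at hX hY
    rw [hX, hY, ← hq'] at hp'
    rw [coord_injective hD hp'] at hp
    exact Set.disjoint_left.mp (hdis i j hij) hp hq

end coords

/-! ### Triangles in the convex hull -/

theorem triangleArea_swap_left (p q r : Plane) : triangleArea p q r = triangleArea q p r := by
  simp only [triangleArea]; rw [← abs_neg]; congr 2; ring

theorem triangleArea_swap_right (p q r : Plane) : triangleArea p q r = triangleArea p r q := by
  simp only [triangleArea]; rw [← abs_neg]; congr 2; ring

/-- The products of coordinates of the moving vertex cancel, so the signed area is affine in it and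
its absolute value is convex. -/
theorem convex_triangleArea_le (q r : Plane) (A : ℝ) :
    Convex ℝ {p | triangleArea p q r ≤ A} := by
  intro x hx y hy a b ha hb hab
  simp only [Set.mem_ofPred_eq, triangleArea] at hx hy ⊢
  have : (q 0 - (a • x + b • y) 0) * (r 1 - (a • x + b • y) 1) -
      (q 1 - (a • x + b • y) 1) * (r 0 - (a • x + b • y) 0) =
      a * ((q 0 - x 0) * (r 1 - x 1) - (q 1 - x 1) * (r 0 - x 0)) +
      b * ((q 0 - y 0) * (r 1 - y 1) - (q 1 - y 1) * (r 0 - y 0)) := by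
    obtain rfl : b = 1 - a := by linarith
    simp
    ring
  rw [this]
  have h1 := abs_add_le (a * ((q 0 - x 0) * (r 1 - x 1) - (q 1 - x 1) * (r 0 - x 0)))
    (b * ((q 0 - y 0) * (r 1 - y 1) - (q 1 - y 1) * (r 0 - y 0)))
  rw [abs_mul, abs_mul, abs_of_nonneg ha, abs_of_nonneg hb] at h1
  have h2 := mul_le_mul_of_nonneg_left hx ha
  have h3 := mul_le_mul_of_nonneg_left hy hb
  have h4 : a * A + b * A = A := by rw [← add_mul, hab, one_mul]
  linarith

/-- By convexity in each vertex, the vertices are released from `S` to its hull one at a time. -/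
theorem triangleArea_le_of_mem_convexHull {S : Set Plane} {A : ℝ}
    (hA : ∀ p ∈ S, ∀ q ∈ S, ∀ r ∈ S, triangleArea p q r ≤ A) :
    ∀ p ∈ convexHull ℝ S, ∀ q ∈ convexHull ℝ S, ∀ r ∈ convexHull ℝ S,
      triangleArea p q r ≤ A := by
  have h1 : ∀ p ∈ convexHull ℝ S, ∀ q ∈ S, ∀ r ∈ S, triangleArea p q r ≤ A :=
    fun p hp q hq r hr =>
      convexHull_min (fun p hp => hA p hp q hq r hr) (convex_triangleArea_le q r A) hp
  have h2 : ∀ p ∈ convexHull ℝ S, ∀ q ∈ convexHull ℝ S, ∀ r ∈ S, triangleArea p q r ≤ A := by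
    intro p hp q hq r hr
    rw [triangleArea_swap_left]
    refine convexHull_min (fun q hq => ?_) (convex_triangleArea_le p r A) hq
    rw [Set.mem_ofPred_eq, triangleArea_swap_left]
    exact h1 p hp q hq r hr
  intro p hp q hq r hr
  rw [triangleArea_swap_right, triangleArea_swap_left]
  refine convexHull_min (fun r hr => ?_) (convex_triangleArea_le p q A) hr
  rw [Set.mem_ofPred_eq, triangleArea_swap_left, triangleArea_swap_right]
  exact h2 p hp q hq r hr

/-! ### True triangles and the answer to MaxMaxArea -/

section answer
variable {n : ℕ} {L : Fin n → Seg}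

theorem carrier_subset_hull (i : Fin n) : (L i).carrier ⊆ hull L :=
  segment_subset_convexHull ⟨i, .inl rfl⟩ ⟨i, .inr rfl⟩

/-- A true triangle that is not smaller than any triangle on the endpoints solves MaxMaxArea, and
is a largest triangle in the convex hull. -/
theorem isMaxMaxArea_of_isTrueTriangle {p q r : Plane} (ht : IsTrueTriangle L p q r)
    (hmax : ∀ p' ∈ endpoints L, ∀ q' ∈ endpoints L, ∀ r' ∈ endpoints L,
      triangleArea p' q' r' ≤ triangleArea p q r) :
    IsMaxMaxArea L (triangleArea p q r) ∧
      IsGreatest (triangleAreasIn (hull L)) (triangleArea p q r) := by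
  have hle := triangleArea_le_of_mem_convexHull hmax
  obtain ⟨i, j, k, hij, hjk, hik, hp, hq, hr⟩ := ht
  refine ⟨⟨?_, ?_⟩, ⟨⟨p, carrier_subset_hull i hp, q, carrier_subset_hull j hq, r,
    carrier_subset_hull k hr, rfl⟩, ?_⟩⟩
  -- The other segments get an arbitrary point; every triangle of the placement stays in the hull,
  -- so none is larger.
  · refine ⟨fun l => if l = i then p else if l = j then q else if l = k then r else (L l).1,
      fun l => ?_, ⟨i, j, k, hij, hjk, hik, ?_⟩, ?_⟩
    · simp only
      split_ifs with h1 h2 h3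
      · rw [h1]; exact hp
      · rw [h2]; exact hq
      · rw [h3]; exact hr
      · exact left_mem_segment _ _ _
    · simp [hij.symm, hjk.symm, hik.symm]
    · rintro a ⟨i', j', k', -, -, -, rfl⟩
      have : ∀ l, (fun l => if l = i then p else if l = j then q else if l = k then r
          else (L l).1) l ∈ hull L := fun l => by
        simp only
        split_ifs with h1 h2 h3
        · exact carrier_subset_hull i hp
        · exact carrier_subset_hull j hq
        · exact carrier_subset_hull k hr
        · exact carrier_subset_hull l (left_mem_segment _ _ _)
      exact hle _ (this i') _ (this j') _ (this k')
  · rintro a ⟨P, hP, ⟨i', j', k', -, -, -, rfl⟩, -⟩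
    exact hle _ (carrier_subset_hull _ (hP i')) _ (carrier_subset_hull _ (hP j')) _
      (carrier_subset_hull _ (hP k'))
  · rintro a ⟨p', hp', q', hq', r', hr', rfl⟩
    exact hle p' hp' q' hq' r' hr'

theorem endpoints_finite : (endpoints L).Finite := by
  refine ((Set.finite_range fun i => (L i).1).union (Set.finite_range fun i => (L i).2)).subset ?_
  rintro z ⟨i, rfl | rfl⟩
  · exact .inl ⟨i, rfl⟩
  · exact .inr ⟨i, rfl⟩

/-- A largest triangle with vertices in a finite set. -/
theorem exists_largest {S : Set Plane} (hS : S.Finite) (hne : S.Nonempty) :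
    ∃ p ∈ S, ∃ q ∈ S, ∃ r ∈ S, ∀ p' ∈ S, ∀ q' ∈ S, ∀ r' ∈ S,
      triangleArea p' q' r' ≤ triangleArea p q r := by
  obtain ⟨z, hz⟩ := hne
  obtain ⟨⟨p, q, r⟩, ⟨hp, hq, hr⟩, hmax⟩ := Set.exists_max_image (S ×ˢ S ×ˢ S)
    (fun t : Plane × Plane × Plane => triangleArea t.1 t.2.1 t.2.2) (hS.prod (hS.prod hS))
    ⟨(z, z, z), hz, hz, hz⟩
  exact ⟨p, hp, q, hq, r, hr, fun p' hp' q' hq' r' hr' => hmax (p', q', r') ⟨hp', hq', hr'⟩⟩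

/-- Krein–Milman; the closure can be dropped because the extreme points are among finitely many
endpoints, whose hulls are closed. -/
theorem hull_eq_convexHull_extremePoints :
    hull L = convexHull ℝ ((hull L).extremePoints ℝ) := by
  have hfin : ((hull L).extremePoints ℝ).Finite :=
    (endpoints_finite (L := L)).subset extremePoints_convexHull_subset
  have h1 : IsCompact (hull L) := (endpoints_finite (L := L)).isCompact_convexHull ℝ
  have h2 := closure_convexHull_extremePoints h1 (convex_convexHull ℝ _)
  rw [(hfin.isClosed_convexHull ℝ).closure_eq] at h2
  exact h2.symm

variable {d0 d1 h : ℝ} {X Y : Fin n → ℝ}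

/-- A triangle that is larger than half of the bounding parallelogram is true. -/
theorem Coords.isTrueTriangle (hC : Coords L d0 d1 h X Y) {w : ℝ} (hw : ∀ i j, X i - X j ≤ w)
    {p q r : Plane} (hp : p ∈ endpoints L) (hq : q ∈ endpoints L) (hr : r ∈ endpoints L)
    (hlt : w * h < triangleArea p q r * (2 * (d0 * d0 + d1 * d1))) : IsTrueTriangle L p q r := by
  obtain ⟨i, a, ha, hpi, hpc⟩ := hC.exists_of_mem hp
  obtain ⟨j, b, hb, hqj, hqc⟩ := hC.exists_of_mem hq
  obtain ⟨k, c, hc, hrk, hrc⟩ := hC.exists_of_mem hr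
  by_contra hnt
  have hne : ¬ (i ≠ j ∧ j ≠ k ∧ i ≠ k) := fun ⟨h1, h2, h3⟩ =>
    hnt ⟨i, j, k, h1, h2, h3, hpi, hqj, hrk⟩
  have hD := hC.D_pos
  rw [triangleArea_eq_cr hC.D_pos, hpc, hqc, hrc, div_mul_cancel₀ _ (by positivity)] at hlt
  exact absurd (abs_cr_le_of_not_distinct (Y := Y) hw hne ha hb hc) (not_le.mpr hlt)

theorem Coords.exists_true (hC : Coords L d0 d1 h X Y) {i j k : Fin n} (hij : i ≠ j) (hjk : j ≠ k)
    (hik : i ≠ k) : ∃ p ∈ endpoints L, ∃ q ∈ endpoints L, ∃ r ∈ endpoints L,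
      IsTrueTriangle L p q r ∧ (X k - X i) * h + |cr (X i, Y i) (X j, Y j) (X k, Y k)| ≤
        triangleArea p q r * (2 * (d0 * d0 + d1 * d1)) := by
  obtain ⟨a, b, c, ha, hb, hc, hle⟩ := exists_abs_cr_ge (X := X) (Y := Y) (h := h) i j k
  obtain ⟨p, hp, hp1, hp2⟩ := hC.exists_endpoint i ha
  obtain ⟨q, hq, hq1, hq2⟩ := hC.exists_endpoint j hb
  obtain ⟨r, hr, hr1, hr2⟩ := hC.exists_endpoint k hc
  have hD := hC.D_pos
  refine ⟨p, hp, q, hq, r, hr, ⟨i, j, k, hij, hjk, hik, hp1, hq1, hr1⟩, ?_⟩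
  rw [triangleArea_eq_cr hC.D_pos, hp2, hq2, hr2, div_mul_cancel₀ _ (by positivity)]
  exact hle

/-- There are segments at both ends of the extent. -/
theorem exists_extreme (hn : 0 < n) (X : Fin n → ℝ) :
    ∃ i k, ∀ j, X i ≤ X j ∧ X j ≤ X k := by
  have : Nonempty (Fin n) := ⟨⟨0, hn⟩⟩
  obtain ⟨i, hi⟩ := Finite.exists_min X
  obtain ⟨k, hk⟩ := Finite.exists_max X
  exact ⟨i, k, fun j => ⟨hi j, hk j⟩⟩

/-- Among the triangles on the endpoints of at least three segments, a largest one is true. -/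
theorem Coords.exists_largest_true (hC : Coords L d0 d1 h X Y) (hn : 3 ≤ n) :
    ∃ p q r, IsTrueTriangle L p q r ∧ ∀ p' ∈ endpoints L, ∀ q' ∈ endpoints L,
      ∀ r' ∈ endpoints L, triangleArea p' q' r' ≤ triangleArea p q r := by
  obtain ⟨p, hp, q, hq, r, hr, hmax⟩ := exists_largest (endpoints_finite (L := L))
    ⟨_, ⟨⟨0, by omega⟩, .inl rfl⟩⟩
  by_cases ht : IsTrueTriangle L p q r
  · exact ⟨p, q, r, ht, hmax⟩
  obtain ⟨i, k, hik⟩ := exists_extreme (by omega) X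
  have hw : ∀ a b, X a - X b ≤ X k - X i := fun a b => by linarith [hik a, hik b]
  have hD := hC.D_pos
  -- If all segments lie on one line the extent is zero, the two extreme indices may coincide, and
  -- any other segment can replace one of them.
  have key : ∃ i' k', i' ≠ k' ∧ X k' - X i' = X k - X i := by
    by_cases h1 : i = k
    · obtain ⟨l, hl⟩ : ∃ l : Fin n, l ≠ i := by
        have : Nontrivial (Fin n) := Fin.nontrivial_iff_two_le.mpr (by omega)
        exact exists_ne i
      refine ⟨i, l, hl.symm, ?_⟩
      have := hik l
      subst h1
      linarith
    · exact ⟨i, k, h1, rfl⟩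
  obtain ⟨i', k', hne, he⟩ := key
  obtain ⟨j, hj⟩ : ∃ j, j ∉ ({i', k'} : Finset (Fin n)) := by
    by_contra hall
    push Not at hall
    have h1 := Finset.card_le_card (fun x _ => hall x : Finset.univ ⊆ ({i', k'} : Finset (Fin n)))
    have h2 := Finset.card_le_two (a := i') (b := k')
    simp at h1
    omega
  simp only [Finset.mem_insert, Finset.mem_singleton, not_or] at hj
  obtain ⟨p', hp', q', hq', r', hr', ht', hge⟩ := hC.exists_true (Ne.symm hj.1) hj.2 hne
  refine ⟨p', q', r', ht', fun p1 hp1 q1 hq1 r1 hr1 => (hmax p1 hp1 q1 hq1 r1 hr1).trans ?_⟩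
  by_contra hlt
  refine ht (hC.isTrueTriangle hw hp hq hr ?_)
  have h3 : triangleArea p' q' r' * (2 * (d0 * d0 + d1 * d1)) <
      triangleArea p q r * (2 * (d0 * d0 + d1 * d1)) :=
    mul_lt_mul_of_pos_right (not_le.mp hlt) (by positivity)
  have h4 := abs_nonneg (cr (X i', Y i') (X j, Y j) (X k', Y k'))
  rw [he] at hge
  linarith

theorem Coords.coord_upper {d : Plane} (hC : Coords L (d 0) (d 1) h X Y) (i : Fin n) :
    coord (d 0) (d 1) ((L i).upper d) = (X i, Y i + h) := by
  have hin : inner ℝ d ((L i).2 - (L i).1) =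
      (coord (d 0) (d 1) (L i).2).2 - (coord (d 0) (d 1) (L i).1).2 := by
    simp [PiLp.inner_apply, Fin.sum_univ_two, coord]
    ring
  have hh := hC.h_nonneg
  rw [Seg.upper, hin]
  rcases hC.ends i with ⟨h1, h2⟩ | ⟨h1, h2⟩
  · rw [h1, h2, if_pos (by simpa using hh), h2]
  · rw [h1, h2]
    split_ifs with h3
    -- The tie in `Seg.upper` occurs only for one-point segments, where both endpoints agree.
    · have : h = 0 := by simp at h3; linarith
      rw [h2, this, add_zero]
    · exact h1

/-- If the upper endpoints are not collinear, some true triangle is larger than half of the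
bounding parallelogram. -/
theorem Coords.exists_gt {d : Plane} (hC : Coords L (d 0) (d 1) h X Y)
    (hcol : ¬ Collinear ℝ (Set.range fun i => (L i).upper d)) :
    ∃ w, (∀ i j, X i - X j ≤ w) ∧ ∃ p ∈ endpoints L, ∃ q ∈ endpoints L, ∃ r ∈ endpoints L,
      w * h < triangleArea p q r * (2 * (d 0 * d 0 + d 1 * d 1)) := by
  have hn : 0 < n := by
    by_contra hn
    obtain rfl : n = 0 := by omega
    exact hcol (by simpa using collinear_empty ℝ Plane)
  obtain ⟨i, k, hik⟩ := exists_extreme hn X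
  refine ⟨X k - X i, fun a b => by linarith [hik a, hik b], ?_⟩
  have hD := hC.D_pos
  by_contra hno
  apply hcol
  rw [collinear_iff_of_mem (Set.mem_range_self i : (L i).upper d ∈ Set.range fun i => (L i).upper d)]
  -- With positive extent every lower endpoint must be on the line through the two extreme ones, or
  -- the bound would be exceeded, and the upper endpoints are a translate. With zero extent
  -- everything is on one line of direction `d`.
  rcases (hik i).2.lt_or_eq with hlt | heq
  · refine ⟨(L k).upper d - (L i).upper d, ?_⟩
    rintro _ ⟨j, rfl⟩
    have hcr : cr (X i, Y i) (X j, Y j) (X k, Y k) = 0 := by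
      by_contra hne
      have hik' : i ≠ k := by rintro rfl; exact lt_irrefl _ hlt
      have hij : i ≠ j := by
        rintro rfl
        apply hne
        simp [cr]
      have hjk : j ≠ k := by
        rintro rfl
        apply hne
        simp only [cr]
        ring
      obtain ⟨p, hp, q, hq, r, hr, -, hge⟩ := hC.exists_true hij hjk hik'
      refine hno ⟨p, hp, q, hq, r, hr, lt_of_lt_of_le ?_ hge⟩
      linarith [abs_pos.mpr hne]
    refine ⟨(X j - X i) / (X k - X i), coord_injective hD ?_⟩
    simp only
    have hu := hC.coord_upper
    have hi := hu i
    have hj := hu j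
    have hk := hu k
    have hpos : X k - X i ≠ 0 := by linarith
    generalize (L i).upper d = ui at *
    generalize (L j).upper d = uj at *
    generalize (L k).upper d = uk at *
    rw [hj]
    simp only [coord, cr, Prod.mk.injEq, vadd_eq_add, PiLp.add_apply, PiLp.smul_apply,
      PiLp.sub_apply, smul_eq_mul] at *
    constructor
    · field_simp
      linear_combination (X j - X i) * (hi.1 - hk.1) - (X k - X i) * hi.1
    · field_simp
      linear_combination (X j - X i) * (hi.2 - hk.2) - (X k - X i) * hi.2 + hcr
  · refine ⟨d, ?_⟩
    rintro _ ⟨j, rfl⟩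
    refine ⟨(Y j - Y i) / (d 0 * d 0 + d 1 * d 1), coord_injective hD ?_⟩
    simp only
    have hu := hC.coord_upper
    have hi := hu i
    have hj := hu j
    have hX : X j = X i := le_antisymm ((hik j).2.trans heq.ge) (hik j).1
    generalize (L i).upper d = ui at *
    generalize (L j).upper d = uj at *
    rw [hj]
    simp only [coord, Prod.mk.injEq, vadd_eq_add, PiLp.add_apply, PiLp.smul_apply,
      smul_eq_mul] at *
    have hρ := div_mul_cancel₀ (Y j - Y i) hD.ne'
    constructor
    · linear_combination hX - hi.1
    · linear_combination -hρ - hi.2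

end answer

/-- Coordinates along the given direction. -/
theorem exists_coords {n : ℕ} {L : Fin n → Seg} {d : Plane} (hd : d ≠ 0)
    (hpar : ParallelTo d L) (hL : EqualLength L) (hdis : PairwiseDisjoint L) :
    ∃ h X Y, Coords L (d 0) (d 1) h X Y := by
  by_cases hn : 0 < n
  · exact ⟨_, _, _, coords_of_parallel hL hdis hd hpar (abs_nonneg (d 0 * ((L ⟨0, hn⟩).2 0 -
      (L ⟨0, hn⟩).1 0) + d 1 * ((L ⟨0, hn⟩).2 1 - (L ⟨0, hn⟩).1 1))) fun i hi => by
        obtain rfl : i = ⟨0, hn⟩ := Fin.ext hi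
        rfl⟩
  · exact ⟨_, _, _, coords_of_parallel hL hdis hd hpar le_rfl fun i _ => absurd i.pos hn⟩

/-- Any triangle on the endpoints at least as large as the one from `Coords.exists_gt` is true. A
largest triangle on the extreme points is largest in the whole hull, so it qualifies. -/
theorem isTrueTriangle_and_exists_extreme {n : ℕ} {L : Fin n → Seg} {d : Plane} (hd : d ≠ 0)
    (hpar : ParallelTo d L) (hL : EqualLength L) (hdis : PairwiseDisjoint L)
    (hcol : ¬ Collinear ℝ (Set.range fun i => (L i).upper d)) :
    (∀ p ∈ endpoints L, ∀ q ∈ endpoints L, ∀ r ∈ endpoints L,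
      IsGreatest (triangleAreasIn (endpoints L)) (triangleArea p q r) →
        IsTrueTriangle L p q r) ∧
    (∃ p ∈ (hull L).extremePoints ℝ, ∃ q ∈ (hull L).extremePoints ℝ,
      ∃ r ∈ (hull L).extremePoints ℝ, IsTrueTriangle L p q r ∧
        IsMaxMaxArea L (triangleArea p q r)) := by
  obtain ⟨h, X, Y, hC⟩ := exists_coords hd hpar hL hdis
  obtain ⟨w, hw, p0, hp0, q0, hq0, r0, hr0, hlt⟩ := hC.exists_gt hcol
  have hD := hC.D_pos
  have htrue : ∀ p ∈ endpoints L, ∀ q ∈ endpoints L, ∀ r ∈ endpoints L,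
      triangleArea p0 q0 r0 ≤ triangleArea p q r → IsTrueTriangle L p q r := by
    intro p hp q hq r hr hle
    refine hC.isTrueTriangle hw hp hq hr (hlt.trans_le ?_)
    exact mul_le_mul_of_nonneg_right hle (by positivity)
  refine ⟨fun p hp q hq r hr hg => htrue p hp q hq r hr
    (hg.2 ⟨p0, hp0, q0, hq0, r0, hr0, rfl⟩), ?_⟩
  have hsub : (hull L).extremePoints ℝ ⊆ endpoints L := extremePoints_convexHull_subset
  have hhull := hull_eq_convexHull_extremePoints (L := L)
  have hmem : ∀ z ∈ endpoints L, z ∈ convexHull ℝ ((hull L).extremePoints ℝ) := fun z hz => by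
    rw [← hhull]
    exact subset_convexHull ℝ _ hz
  obtain ⟨p, hp, q, hq, r, hr, hmax⟩ := exists_largest ((endpoints_finite (L := L)).subset hsub)
    (convexHull_nonempty_iff.mp ⟨p0, hmem p0 hp0⟩)
  have hmax' := triangleArea_le_of_mem_convexHull hmax
  have ht := htrue p (hsub hp) q (hsub hq) r (hsub hr)
    (hmax' _ (hmem _ hp0) _ (hmem _ hq0) _ (hmem _ hr0))
  exact ⟨p, hp, q, hq, r, hr, ht, (isMaxMaxArea_of_isTrueTriangle ht fun p' hp' q' hq' r' hr' =>
    hmax' _ (hmem _ hp') _ (hmem _ hq') _ (hmem _ hr')).1⟩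

theorem isMaxMaxArea_iff {n : ℕ} {L : Fin n → Seg} {d : Plane} (hn : 3 ≤ n) (hd : d ≠ 0)
    (hpar : ParallelTo d L) (hL : EqualLength L) (hdis : PairwiseDisjoint L) (M : ℝ) :
    IsMaxMaxArea L M ↔ IsGreatest (triangleAreasIn (hull L)) M := by
  obtain ⟨h, X, Y, hC⟩ := exists_coords hd hpar hL hdis
  obtain ⟨p, q, r, ht, hmax⟩ := hC.exists_largest_true hn
  obtain ⟨h1, h2⟩ := isMaxMaxArea_of_isTrueTriangle ht hmax
  exact ⟨fun h => (IsGreatest.unique h h1) ▸ h2, fun h => (IsGreatest.unique h h2) ▸ h1⟩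

/-! ### The program for MaxMaxArea -/

namespace Code

/-- Compute the direction of the segments, and the length along it. -/
def direction : Prog :=
  .seq (.rset 10 (.sub (.get 2 (.const 0)) (.get 0 (.const 0))))
  (.seq (.rset 11 (.sub (.get 3 (.const 0)) (.get 1 (.const 0))))
  (.seq (.rset 13 (.add (.mul (.reg 10) (.reg 10)) (.mul (.reg 11) (.reg 11))))
  (.seq (.rset 12 (.reg 13))
  (.branch (.rle (.reg 13) (.const 0)) (.seq (.rset 11 (.const 1)) (.rset 12 (.const 1))) .skip))))

/-- Compute the lower endpoints in the coordinates along the direction. -/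
def coordinates : Prog :=
  .seq (.nset 7 (.const 0)) (.loop (.nle (.add (.reg 7) (.const 1)) (.reg 0))
    (.seq (.rput 4 (.reg 7) (.sub (.mul (.reg 11) (.get 0 (.reg 7)))
      (.mul (.reg 10) (.get 1 (.reg 7)))))
    (.seq (.rset 17 (.add (.mul (.reg 10) (.get 0 (.reg 7))) (.mul (.reg 11) (.get 1 (.reg 7)))))
    (.seq (.rset 18 (.add (.mul (.reg 10) (.get 2 (.reg 7))) (.mul (.reg 11) (.get 3 (.reg 7)))))
    (.seq (.branch (.rle (.reg 17) (.reg 18)) (.rput 5 (.reg 7) (.reg 17))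
      (.rput 5 (.reg 7) (.reg 18)))
    (.nset 7 (.add (.reg 7) (.const 1))))))))

/-- The last cell of the sorted points. -/
def lastCell : NExpr := .sub (.reg 0) (.const 1)

/-- Record the better triangle on the first, second and last segment. -/
def initBest : Prog :=
  .seq (.rset 21 (.mul (.sub (.get 4 lastCell) (.get 4 (.const 0))) (.reg 13)))
  (.seq (.rset 20 (.sub (.mul (.sub (.get 4 lastCell) (.get 4 (.const 0)))
      (.sub (.add (.get 5 (.const 1)) (.reg 13)) (.get 5 (.const 0))))
    (.mul (.sub (.get 4 (.const 1)) (.get 4 (.const 0)))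
      (.sub (.get 5 lastCell) (.get 5 (.const 0))))))
  (.seq (.rset 1 (.get 4 (.const 0))) (.seq (.rset 3 (.get 4 (.const 1)))
  (.seq (.rset 5 (.get 4 lastCell))
  (.branch (.rle (.reg 21) (.reg 20))
    (.seq (.rset 0 (.reg 20)) (.seq (.rset 2 (.get 5 (.const 0)))
    (.seq (.rset 4 (.add (.get 5 (.const 1)) (.reg 13))) (.rset 6 (.get 5 lastCell)))))
    (.seq (.rset 0 (.sub (.mul (.const 2) (.reg 21)) (.reg 20)))
    (.seq (.rset 2 (.add (.get 5 (.const 0)) (.reg 13)))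
    (.seq (.rset 4 (.get 5 (.const 1)))
    (.rset 6 (.add (.get 5 lastCell) (.reg 13)))))))))))

/-- Return to the original coordinates. -/
def backPoint (x y : ℕ) : Prog :=
  .seq (.rset 17 (.div (.add (.mul (.reg 11) (.reg x)) (.mul (.reg 10) (.reg y))) (.reg 12)))
  (.seq (.rset y (.div (.sub (.mul (.reg 11) (.reg y)) (.mul (.reg 10) (.reg x))) (.reg 12)))
    (.rset x (.reg 17)))

/-- Write the output. -/
def output : Prog :=
  .seq (.rset 0 (.div (.reg 0) (.mul (.const 2) (.reg 12))))
    (.seq (backPoint 1 2) (.seq (backPoint 3 4) (backPoint 5 6)))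

/-- Search both orientations. -/
def searchBoth : Prog :=
  .seq (.rset 14 (.const 1)) (.seq (.rset 15 (.const 0)) (.seq half
    (.seq (.rset 14 (.const (-1))) (.seq (.rset 15 (.reg 13)) half))))

/-- The program for MaxMaxArea. -/
def maxMaxArea : Prog :=
  .seq direction (.seq coordinates (.seq sort (.seq initBest (.seq searchBoth output))))

end Code

/-- The first segment gives the direction, and its extent along itself is its squared length. If it
is a single point, so are all the others, and the direction `(0, 1)` with height `0` serves. -/
theorem direction_spec {s : RAMState} {t : ℕ} (ht : 100 ≤ t) :
    WP Code.direction (fun s' t' => t ≤ t' + 100 ∧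
      0 < s'.rreg 10 * s'.rreg 10 + s'.rreg 11 * s'.rreg 11 ∧
      s'.rreg 12 = s'.rreg 10 * s'.rreg 10 + s'.rreg 11 * s'.rreg 11 ∧
      ((s'.rreg 10 = s.rarr 2 0 - s.rarr 0 0 ∧ s'.rreg 11 = s.rarr 3 0 - s.rarr 1 0 ∧
        s'.rreg 13 = s'.rreg 12) ∨
      (s.rarr 2 0 = s.rarr 0 0 ∧ s.rarr 3 0 = s.rarr 1 0 ∧ s'.rreg 13 = 0))) s t := by
  refine WP.seq (WP.rset ⟨by simp; omega, WP.seq (WP.rset ⟨by simp; omega, WP.seq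
    (WP.rset ⟨by simp; omega, WP.seq (WP.rset ⟨by simp; omega, WP.branch ⟨by simp; omega,
    fun hb => WP.seq (WP.rset ⟨by simp; omega, WP.rset ⟨by simp; omega, ?_⟩⟩),
    fun hb => WP.skip ⟨by simp; omega, ?_⟩⟩⟩)⟩)⟩)⟩)
  · simp at hb ⊢
    have h1 := mul_self_nonneg (s.rarr 2 0 - s.rarr 0 0)
    have h2 := mul_self_nonneg (s.rarr 3 0 - s.rarr 1 0)
    have h3 : s.rarr 2 0 - s.rarr 0 0 = 0 := mul_self_eq_zero.mp (by linarith)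
    have h4 : s.rarr 3 0 - s.rarr 1 0 = 0 := mul_self_eq_zero.mp (by linarith)
    rw [h3, h4]
    refine ⟨by omega, by norm_num, by norm_num, Or.inr ⟨by linarith, by linarith, by norm_num⟩⟩
  · simp at hb ⊢
    exact ⟨by omega, hb⟩

theorem coordinates_spec {s : RAMState} {t n : ℕ} (hn : s.nreg 0 = n) (ht : 100 * n + 50 ≤ t) :
    WP Code.coordinates (fun s' t' => t ≤ t' + 100 * n + 50 ∧ ∀ u, u < n →
      s'.rarr 4 u = s.rreg 11 * s.rarr 0 u - s.rreg 10 * s.rarr 1 u ∧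
      s'.rarr 5 u = min (s.rreg 10 * s.rarr 0 u + s.rreg 11 * s.rarr 1 u)
        (s.rreg 10 * s.rarr 2 u + s.rreg 11 * s.rarr 3 u)) s t := by
  refine WP.seq (WP.nset ⟨by simp; omega, ?_⟩)
  refine WP.loop (fun s' t' => t ≤ t' + 100 * s'.nreg 7 + 10 ∧ s'.nreg 7 ≤ n ∧
    ∀ u, u < s'.nreg 7 →
      s'.rarr 4 u = s.rreg 11 * s.rarr 0 u - s.rreg 10 * s.rarr 1 u ∧
      s'.rarr 5 u = min (s.rreg 10 * s.rarr 0 u + s.rreg 11 * s.rarr 1 u)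
        (s.rreg 10 * s.rarr 2 u + s.rreg 11 * s.rarr 3 u)) ?_ ?_
  · simp; omega
  · rintro s' t' hF ⟨ht', hle, hp⟩
    have n0 : s'.nreg 0 = n := (hF.n 0 rfl).trans (by simp [hn])
    have r10 : s'.rreg 10 = s.rreg 10 := hF.r 10 rfl
    have r11 : s'.rreg 11 = s.rreg 11 := hF.r 11 rfl
    have a0 : s'.rarr 0 = s.rarr 0 := hF.ra 0 rfl
    have a1 : s'.rarr 1 = s.rarr 1 := hF.ra 1 rfl
    have a2 : s'.rarr 2 = s.rarr 2 := hF.ra 2 rfl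
    have a3 : s'.rarr 3 = s.rarr 3 := hF.ra 3 rfl
    simp only [Test.cost, NExpr.cost, Test.Holds, NExpr.eval, n0]
    refine ⟨by omega, fun hb => ?_, fun hb => ⟨by omega, fun u hu => hp u (by omega)⟩⟩
    refine WP.seq (WP.rput ⟨by simp; omega, WP.seq (WP.rset ⟨by simp; omega, WP.seq
      (WP.rset ⟨by simp; omega, WP.seq (WP.branch ⟨by simp; omega,
      fun hc => WP.rput ⟨by simp; omega, WP.nset ⟨by simp; omega, ?_⟩⟩,
      fun hc => WP.rput ⟨by simp; omega, WP.nset ⟨by simp; omega, ?_⟩⟩⟩)⟩)⟩)⟩)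
    all_goals
      simp [r10, r11, a0, a1, a2, a3] at hc ⊢
      refine ⟨by omega, by omega, fun u hu => ?_⟩
      rcases Nat.lt_or_eq_of_le hu with hu | rfl
      · rw [Function.update_of_ne hu.ne, Function.update_of_ne hu.ne]
        exact hp u hu
    · simp [min_eq_left hc]
    · simp [min_eq_right hc.le]

/-- The points `p`, `q`, `r` are endpoints of three different segments, the area of their triangle
is `V / 2`, at least `V0 / 2` and at least half of the area of the bounding parallelogram. -/
def Candidate (X Y : ℕ → ℝ) (n : ℕ) (h V0 V : ℝ) (p q r : ℝ × ℝ) : Prop :=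
  V0 ≤ V ∧ (X (n - 1) - X 0) * h ≤ V ∧ ∃ i j k a b c, (i < n ∧ j < n ∧ k < n) ∧
    (i ≠ j ∧ j ≠ k ∧ i ≠ k) ∧ ((a = 0 ∨ a = h) ∧ (b = 0 ∨ b = h) ∧ (c = 0 ∨ c = h)) ∧
    (p = (X i, Y i + a) ∧ q = (X j, Y j + b) ∧ r = (X k, Y k + c)) ∧ V = |cr p q r|

theorem Candidate.mono {X Y : ℕ → ℝ} {n : ℕ} {h V0 V0' V : ℝ} {p q r : ℝ × ℝ}
    (hC : Candidate X Y n h V0 V p q r) (hV : V0' ≤ V) : Candidate X Y n h V0' V p q r :=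
  ⟨hV, hC.2⟩

/-- The recorded value is never below `w * h`, which bounds the triangles with a repeated segment. A
strict improvement therefore comes from three distinct segments, without any test by the program. -/
theorem Candidate.step {X Y : ℕ → ℝ} {n : ℕ} {h V0 sg off : ℝ} (hh : 0 ≤ h)
    (hs : ∀ u v, u ≤ v → v < n → X u ≤ X v) (hsg : (sg = 1 ∧ off = 0) ∨ (sg = -1 ∧ off = h))
    (V : ℝ) (p q r : ℝ × ℝ) (hC : Candidate X Y n h V0 V p q r) :
    ∀ a ∈ pts X (fun u => sg * Y u) 0 n, ∀ b ∈ pts X (fun u => sg * Y u) 0 n,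
    ∀ c ∈ pts X (fun u => sg * Y u) 0 n, V < area2 h a b c →
      Candidate X Y n h V0 (area2 h a b c) (a.1, sg * a.2 + off) (b.1, sg * (h + b.2) + off)
        (c.1, sg * c.2 + off) := by
  rintro _ ⟨i, -, hi, rfl⟩ _ ⟨j, -, hj, rfl⟩ _ ⟨k, -, hk, rfl⟩ hlt
  obtain ⟨h1, h2, -⟩ := hC
  have hw : ∀ u v, u < n → v < n → X v - X u ≤ X (n - 1) - X 0 := fun u v hu hv => by
    have := hs 0 u (by omega) hu
    have := hs v (n - 1) (by omega) (by omega)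
    linarith
  have hwh := mul_le_mul_of_nonneg_right (hw i k hi hk) hh
  have hw0 := mul_nonneg (show 0 ≤ X (n - 1) - X 0 by linarith [hw i i hi hi]) hh
  have hpos : 0 ≤ area2 h (X i, sg * Y i) (X j, sg * Y j) (X k, sg * Y k) := by linarith
  refine ⟨h1.trans hlt.le, h2.trans hlt.le, i, j, k, ?_⟩
  have hne : i ≠ j ∧ j ≠ k ∧ i ≠ k := by
    refine ⟨?_, ?_, ?_⟩ <;> rintro rfl <;> simp only [area2] at hlt <;> linarith
  rcases hsg with ⟨rfl, rfl⟩ | ⟨rfl, rfl⟩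
  · refine ⟨0, h, 0, ⟨hi, hj, hk⟩, hne, ⟨.inl rfl, .inr rfl, .inl rfl⟩, ⟨?_, ?_, ?_⟩, ?_⟩
    · simp
    · simp [add_comm]
    · simp
    · rw [← abs_of_nonneg hpos]
      congr 1
      simp only [area2, cr]; ring
  · refine ⟨off, 0, off, ⟨hi, hj, hk⟩, hne, ⟨.inr rfl, .inl rfl, .inr rfl⟩, ⟨?_, ?_, ?_⟩, ?_⟩
    · simp
    · simp
    · simp
    · rw [← abs_of_nonneg hpos, ← abs_neg]
      congr 1
      simp only [area2, cr]; ring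

/-- In sorted order the cells `0` and `n - 1` are extreme, so with cell `1` the better alternating
triangle reaches `w * h`. If register `20` holds `w * h + c`, then `2 * w * h` minus it is the value
of the mirrored triangle. -/
theorem initBest_spec {s : RAMState} {t n : ℕ} {h : ℝ} (hn : s.nreg 0 = n) (hn3 : 3 ≤ n)
    (hh : s.rreg 13 = h) (hh0 : 0 ≤ h) (hs : ∀ u v, u ≤ v → v < n → s.rarr 4 u ≤ s.rarr 4 v)
    (ht : 200 ≤ t) :
    WP Code.initBest (fun s' t' => t ≤ t' + 200 ∧
      BestRel (Candidate (s.rarr 4) (s.rarr 5) n h 0) s') s t := by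
  have hw0 : 0 ≤ (s.rarr 4 (n - 1) - s.rarr 4 0) * h :=
    mul_nonneg (by linarith [hs 0 (n - 1) (by omega) (by omega)]) hh0
  refine WP.seq (WP.rset ⟨by simp [Code.lastCell]; omega, WP.seq (WP.rset
    ⟨by simp [Code.lastCell]; omega, WP.seq (WP.rset ⟨by simp [Code.lastCell]; omega, WP.seq
    (WP.rset ⟨by simp [Code.lastCell]; omega, WP.seq (WP.rset ⟨by simp [Code.lastCell]; omega,
    WP.branch ⟨by simp [Code.lastCell]; omega,
    fun hb => WP.seq (WP.rset ⟨by simp [Code.lastCell]; omega, WP.seq (WP.rset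
    ⟨by simp [Code.lastCell]; omega, WP.seq (WP.rset ⟨by simp [Code.lastCell]; omega, WP.rset
    ⟨by simp [Code.lastCell]; omega, ?_⟩⟩)⟩)⟩),
    fun hb => WP.seq (WP.rset ⟨by simp [Code.lastCell]; omega, WP.seq (WP.rset
    ⟨by simp [Code.lastCell]; omega, WP.seq (WP.rset ⟨by simp [Code.lastCell]; omega, WP.rset
    ⟨by simp [Code.lastCell]; omega, ?_⟩⟩)⟩)⟩)⟩⟩)⟩)⟩)⟩)⟩)
  · simp [Code.lastCell, hn, hh] at hb
    refine ⟨by simp [Code.lastCell]; omega, ?_⟩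
    simp [BestRel, Code.lastCell, hn, hh]
    refine ⟨by linarith, hb, 0, 1, n - 1, 0, h, 0, ⟨by omega, by omega, by omega⟩,
      ⟨by omega, by omega, by omega⟩, ⟨.inl rfl, .inr rfl, .inl rfl⟩, by simp, ?_⟩
    rw [← abs_of_nonneg (hw0.trans hb)]
    congr 1
  · simp [Code.lastCell, hn, hh] at hb
    refine ⟨by simp [Code.lastCell]; omega, ?_⟩
    simp [BestRel, Code.lastCell, hn, hh]
    have hb' : (s.rarr 4 (n - 1) - s.rarr 4 0) * h ≤ 2 * ((s.rarr 4 (n - 1) - s.rarr 4 0) * h) -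
        ((s.rarr 4 (n - 1) - s.rarr 4 0) * (s.rarr 5 1 + h - s.rarr 5 0) -
          (s.rarr 4 1 - s.rarr 4 0) * (s.rarr 5 (n - 1) - s.rarr 5 0)) := by linarith
    refine ⟨by linarith, hb', 0, 1, n - 1, h, 0, h, ⟨by omega, by omega, by omega⟩,
      ⟨by omega, by omega, by omega⟩, ⟨.inr rfl, .inl rfl, .inr rfl⟩, by simp, ?_⟩
    rw [← abs_of_nonneg (hw0.trans hb'), ← abs_neg]
    congr 1
    simp only [cr]
    ring

/-- If no largest triangle in order beats `V`, then no triangle does. -/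
theorem abs_cr_le_of_largest {X Y : ℕ → ℝ} {n : ℕ} {h V : ℝ} (hh : 0 ≤ h)
    (hV : ∀ sg : ℝ, sg = 1 ∨ sg = -1 → ∀ a ∈ pts X (fun u => sg * Y u) 0 n,
      ∀ b ∈ pts X (fun u => sg * Y u) 0 n, ∀ c ∈ pts X (fun u => sg * Y u) 0 n,
      a.1 ≤ b.1 → b.1 ≤ c.1 → (∀ p ∈ pts X (fun u => sg * Y u) 0 n,
        ∀ q ∈ pts X (fun u => sg * Y u) 0 n, ∀ r ∈ pts X (fun u => sg * Y u) 0 n,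
        area2 h p q r ≤ area2 h a b c) → area2 h a b c ≤ V)
    (i j k : Fin n) {a b c : ℝ} (ha : 0 ≤ a ∧ a ≤ h) (hb : 0 ≤ b ∧ b ≤ h) (hc : 0 ≤ c ∧ c ≤ h) :
    |cr (X i, Y i + a) (X j, Y j + b) (X k, Y k + c)| ≤ V := by
  -- The maximum is taken over both orientations and all ordered triples. It bounds every `|cr|`,
  -- hence also the unordered triples in its own orientation, and this is the maximality that `hV`
  -- asks for.
  let f : Bool × Fin n × Fin n × Fin n → ℝ := fun t =>
    if t.1 then area2 h (X t.2.1, 1 * Y t.2.1) (X t.2.2.1, 1 * Y t.2.2.1) (X t.2.2.2, 1 * Y t.2.2.2)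
    else area2 h (X t.2.1, -1 * Y t.2.1) (X t.2.2.1, -1 * Y t.2.2.1) (X t.2.2.2, -1 * Y t.2.2.2)
  obtain ⟨⟨b0, i0, j0, k0⟩, ⟨hs1, hs2⟩, hmax⟩ := Set.exists_max_image
    {t : Bool × Fin n × Fin n × Fin n | X t.2.1 ≤ X t.2.2.1 ∧ X t.2.2.1 ≤ X t.2.2.2} f
    (Set.toFinite _) ⟨(true, i, i, i), le_rfl, le_rfl⟩
  simp only at hs1 hs2
  have hall : ∀ (i j k : Fin n) {a b c : ℝ}, 0 ≤ a ∧ a ≤ h → 0 ≤ b ∧ b ≤ h → 0 ≤ c ∧ c ≤ h →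
      |cr (X i, Y i + a) (X j, Y j + b) (X k, Y k + c)| ≤ f (b0, i0, j0, k0) := by
    intro i j k a b c ha hb hc
    refine abs_cr_le (X := fun i : Fin n => X i) (Y := fun i : Fin n => Y i)
      (fun i j k h1 h2 => ⟨?_, ?_⟩) i j k ha hb hc
    · simpa [f] using hmax (true, i, j, k) ⟨h1, h2⟩
    · simpa [f] using hmax (false, i, j, k) ⟨h1, h2⟩
  refine (hall i j k ha hb hc).trans ?_
  have mem : ∀ sg (i : Fin n), (X i, sg * Y i) ∈ pts X (fun u => sg * Y u) 0 n := fun sg i =>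
    ⟨i, Nat.zero_le _, i.2, rfl⟩
  cases b0
  · refine hV (-1) (.inr rfl) _ (mem _ i0) _ (mem _ j0) _ (mem _ k0) hs1 hs2 ?_
    rintro _ ⟨i, -, hi, rfl⟩ _ ⟨j, -, hj, rfl⟩ _ ⟨k, -, hk, rfl⟩
    refine le_trans ?_ (hall ⟨i, hi⟩ ⟨j, hj⟩ ⟨k, hk⟩ (a := h) (b := 0) (c := h) ⟨hh, le_rfl⟩
      ⟨le_rfl, hh⟩ ⟨hh, le_rfl⟩)
    refine le_trans (le_of_eq ?_) (neg_le_abs _)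
    simp only [area2, cr]; ring
  · refine hV 1 (.inl rfl) _ (mem _ i0) _ (mem _ j0) _ (mem _ k0) hs1 hs2 ?_
    rintro _ ⟨i, -, hi, rfl⟩ _ ⟨j, -, hj, rfl⟩ _ ⟨k, -, hk, rfl⟩
    refine le_trans ?_ (hall ⟨i, hi⟩ ⟨j, hj⟩ ⟨k, hk⟩ (a := 0) (b := h) (c := 0) ⟨le_rfl, hh⟩
      ⟨hh, le_rfl⟩ ⟨le_rfl, hh⟩)
    refine le_trans (le_of_eq ?_) (le_abs_self _)
    simp only [area2, cr]; ring

-- The second run uses the invariant with `V0` equal to the result of the first, so the recorded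
-- value cannot drop and both bounds hold at the end.
set_option maxRecDepth 10000 in
theorem searchBoth_spec {s : RAMState} {t n : ℕ} {h : ℝ} (hn : s.nreg 0 = n) (hn3 : 3 ≤ n)
    (hh : s.rreg 13 = h) (hh0 : 0 ≤ h) (hs : ∀ u v, u ≤ v → v < n → s.rarr 4 u ≤ s.rarr 4 v)
    (hB : BestRel (Candidate (s.rarr 4) (s.rarr 5) n h 0) s)
    (ht : (Nat.log 2 n + 2) * (8000 * n + 2900) ≤ t) :
    WP Code.searchBoth (fun s' t' => t ≤ t' + (Nat.log 2 n + 2) * (8000 * n + 2900) ∧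
      BestRel (Candidate (s.rarr 4) (s.rarr 5) n h 0) s' ∧
      ∀ (i j k : Fin n) {a b c : ℝ}, 0 ≤ a ∧ a ≤ h → 0 ≤ b ∧ b ≤ h → 0 ≤ c ∧ c ≤ h →
        |cr (s.rarr 4 i, s.rarr 5 i + a) (s.rarr 4 j, s.rarr 5 j + b)
          (s.rarr 4 k, s.rarr 5 k + c)| ≤ s'.rreg 0) s t := by
  have hlog : (Nat.log 2 n + 2) * (8000 * n + 2900) =
      2 * ((Nat.log 2 n + 2) * (4000 * n + 1400)) + 100 * Nat.log 2 n + 200 := by ring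
  refine WP.seq (WP.rset ⟨by simp; omega, WP.seq (WP.rset ⟨by simp; omega, WP.seq ?_⟩)⟩)
  refine (half_spec (n := n) (h := h) (sg := 1) (off := 0)
    (I := Candidate (s.rarr 4) (s.rarr 5) n h 0) (by simp [hn]) (by omega) (by simpa using hs) rfl
    (by simp [hh]) hh0 (by simp) (by simp) (by simpa [BestRel] using hB) ?_
    (by simp; omega)).frame.mono ?_
  · exact Candidate.step hh0 hs (.inl ⟨rfl, rfl⟩)
  rintro s1 t1 ⟨⟨ht1, hB1, hV1⟩, hF1⟩
  simp only [RAMState.setR_rarr] at hV1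
  simp at ht1
  have a4 : s1.rarr 4 = s.rarr 4 := hF1.ra 4 rfl
  have a5 : s1.rarr 5 = s.rarr 5 := hF1.ra 5 rfl
  have n0 : s1.nreg 0 = n := (hF1.n 0 rfl).trans hn
  have r13 : s1.rreg 13 = h := (hF1.r 13 rfl).trans (by simp [hh])
  refine WP.seq (WP.rset ⟨by simp; omega, WP.seq (WP.rset ⟨by simp; omega, ?_⟩)⟩)
  refine (half_spec (n := n) (h := h) (sg := -1) (off := h)
    (I := Candidate (s.rarr 4) (s.rarr 5) n h (s1.rreg 0)) (by simp [n0]) (by omega)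
    (by simpa [a4] using hs) rfl
    (by simp [r13]) hh0 (by simp) (by simp [r13]) ?_ ?_ (by simp; omega)).mono ?_
  · have : BestRel (Candidate (s.rarr 4) (s.rarr 5) n h (s1.rreg 0)) s1 := hB1.mono le_rfl
    simpa [BestRel] using this
  · simp only [RAMState.setR_rarr, a4, a5]
    exact Candidate.step hh0 hs (.inr ⟨rfl, rfl⟩)
  rintro s2 t2 ⟨ht2, hB2, hV2⟩
  simp only [RAMState.setR_rarr, a4, a5] at hV2
  have h01 : 0 ≤ s1.rreg 0 := hB1.1
  have h12 : s1.rreg 0 ≤ s2.rreg 0 := hB2.1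
  refine ⟨by simp at ht2; omega, hB2.mono (h01.trans h12), fun i j k a b c ha hb hc => ?_⟩
  refine abs_cr_le_of_largest hh0 ?_ i j k ha hb hc
  rintro sg (rfl | rfl) a ha b hb c hc h1 h2 hm
  · exact (hV1 h01 a ha b hb c hc h1 h2 hm).trans h12
  · exact hV2 (h01.trans h12) a ha b hb c hc h1 h2 hm

theorem output_spec {s : RAMState} {t : ℕ} (ht : 200 ≤ t) :
    WP Code.output (fun s' _ =>
      s'.rreg 0 = s.rreg 0 / (2 * s.rreg 12) ∧
      s'.rreg 1 = (s.rreg 11 * s.rreg 1 + s.rreg 10 * s.rreg 2) / s.rreg 12 ∧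
      s'.rreg 2 = (s.rreg 11 * s.rreg 2 - s.rreg 10 * s.rreg 1) / s.rreg 12 ∧
      s'.rreg 3 = (s.rreg 11 * s.rreg 3 + s.rreg 10 * s.rreg 4) / s.rreg 12 ∧
      s'.rreg 4 = (s.rreg 11 * s.rreg 4 - s.rreg 10 * s.rreg 3) / s.rreg 12 ∧
      s'.rreg 5 = (s.rreg 11 * s.rreg 5 + s.rreg 10 * s.rreg 6) / s.rreg 12 ∧
      s'.rreg 6 = (s.rreg 11 * s.rreg 6 - s.rreg 10 * s.rreg 5) / s.rreg 12) s t := by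
  refine WP.seq (WP.rset ⟨by simp; omega, WP.seq (WP.seq (WP.rset ⟨by simp; omega, WP.seq (WP.rset
    ⟨by simp; omega, WP.rset ⟨by simp; omega, WP.seq (WP.seq (WP.rset ⟨by simp; omega, WP.seq
    (WP.rset ⟨by simp; omega, WP.rset ⟨by simp; omega, WP.seq (WP.rset ⟨by simp; omega, WP.seq
    (WP.rset ⟨by simp; omega, WP.rset ⟨by simp; omega, ?_⟩⟩)⟩)⟩⟩)⟩))⟩⟩)⟩))⟩)
  simp

theorem coord_back {d0 d1 : ℝ} (hD : 0 < d0 * d0 + d1 * d1) (z : ℝ × ℝ) :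
    coord d0 d1 !₂[(d1 * z.1 + d0 * z.2) / (d0 * d0 + d1 * d1),
      (d1 * z.2 - d0 * z.1) / (d0 * d0 + d1 * d1)] = z := by
  have := hD.ne'
  refine Prod.ext ?_ ?_
  · simp only [coord, Matrix.cons_val_zero, Matrix.cons_val_one]
    rw [← mul_div_assoc, ← mul_div_assoc, ← sub_div, div_eq_iff this]
    ring
  · simp only [coord, Matrix.cons_val_zero, Matrix.cons_val_one]
    rw [← mul_div_assoc, ← mul_div_assoc, ← add_div, div_eq_iff this]
    ring

/-! ### Correctness of the program -/

section correct
variable {n : ℕ} {L : Fin n → Seg} {d0 d1 h : ℝ}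

/-- The program does not know `d`. A first segment of positive length is a nonzero multiple of it;
otherwise all segments are points, parallel to everything. -/
theorem coords_of_direction {d : Plane} (hpar : ParallelTo d L) (hL : EqualLength L)
    (hdis : PairwiseDisjoint L) (hn : 0 < n) (hD : 0 < d0 * d0 + d1 * d1)
    (hdir : (d0 = (L ⟨0, hn⟩).2 0 - (L ⟨0, hn⟩).1 0 ∧ d1 = (L ⟨0, hn⟩).2 1 - (L ⟨0, hn⟩).1 1 ∧
        h = d0 * d0 + d1 * d1) ∨
      ((L ⟨0, hn⟩).2 0 = (L ⟨0, hn⟩).1 0 ∧ (L ⟨0, hn⟩).2 1 = (L ⟨0, hn⟩).1 1 ∧ h = 0)) :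
    Coords L d0 d1 h (fun i => d1 * (L i).1 0 - d0 * (L i).1 1)
      (fun i => min (d0 * (L i).1 0 + d1 * (L i).1 1) (d0 * (L i).2 0 + d1 * (L i).2 1)) := by
  have hne : (!₂[d0, d1] : Plane) ≠ 0 := by
    intro h0
    have e0 : d0 = 0 := by simpa using congrArg (fun z : Plane => z 0) h0
    have e1 : d1 = 0 := by simpa using congrArg (fun z : Plane => z 1) h0
    simp [e0, e1] at hD
  rcases hdir with ⟨e0, e1, rfl⟩ | ⟨e0, e1, rfl⟩
  · have hd : (L ⟨0, hn⟩).2 - (L ⟨0, hn⟩).1 = !₂[d0, d1] := by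
      ext i; fin_cases i
      · simp [e0]
      · simp [e1]
    obtain ⟨c, hc⟩ := hpar ⟨0, hn⟩
    rw [hd] at hc
    have hc0 : c ≠ 0 := by rintro rfl; exact hne (by rw [hc, zero_smul])
    have hpar' : ParallelTo !₂[d0, d1] L := fun i => by
      obtain ⟨b, hb⟩ := hpar i
      exact ⟨b * c⁻¹, by rw [hb, hc, smul_smul, inv_mul_cancel_right₀ hc0]⟩
    refine coords_of_parallel hL hdis hne hpar' hD.le ?_
    rintro ⟨i, hi⟩ rfl
    change |d0 * _ + d1 * _| = _
    rw [← e0, ← e1, abs_of_pos hD]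
  · have heq : (L ⟨0, hn⟩).1 = (L ⟨0, hn⟩).2 := by
      ext i; fin_cases i
      · exact e0.symm
      · exact e1.symm
    have hpar' : ParallelTo !₂[d0, d1] L := fun i => by
      have := hL i ⟨0, hn⟩
      rw [heq, dist_self, dist_eq_zero] at this
      exact ⟨0, by rw [this, sub_self, zero_smul]⟩
    refine coords_of_parallel hL hdis hne hpar' le_rfl ?_
    rintro ⟨i, hi⟩ rfl
    rw [e0, e1]
    simp

/-- An enumeration of different points has the same set of values as another one of the same
length only if it is a permutation of it. -/
theorem exists_perm_of_pts_eq {X₀ Y₀ : Fin n → ℝ} {X Y X' Y' : ℕ → ℝ}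
    (hinj : ∀ i j, X₀ i = X₀ j → Y₀ i = Y₀ j → i = j)
    (h' : ∀ i : Fin n, X' i = X₀ i ∧ Y' i = Y₀ i) (hpts : pts X Y 0 n = pts X' Y' 0 n) :
    ∃ π : Equiv.Perm (Fin n), ∀ u : Fin n, X u = X₀ (π u) ∧ Y u = Y₀ (π u) := by
  have h1 : ∀ u : Fin n, ∃ i : Fin n, X u = X₀ i ∧ Y u = Y₀ i := by
    intro u
    have : (X u, Y u) ∈ pts X Y 0 n := ⟨u, Nat.zero_le _, u.2, rfl⟩
    rw [hpts] at this
    obtain ⟨i, -, hi, he⟩ := this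
    obtain ⟨hx, hy⟩ := Prod.mk.inj he
    exact ⟨⟨i, hi⟩, hx.trans (h' ⟨i, hi⟩).1, hy.trans (h' ⟨i, hi⟩).2⟩
  choose f hf using h1
  have hsurj : Function.Surjective f := by
    intro i
    have : (X' i, Y' i) ∈ pts X' Y' 0 n := ⟨i, Nat.zero_le _, i.2, rfl⟩
    rw [← hpts] at this
    obtain ⟨u, -, hu, he⟩ := this
    obtain ⟨hx, hy⟩ := Prod.mk.inj he
    refine ⟨⟨u, hu⟩, hinj _ _ ?_ ?_⟩
    · rw [← (hf _).1, ← (h' i).1]; exact hx.symm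
    · rw [← (hf _).2, ← (h' i).2]; exact hy.symm
  -- Distinctness of the points was used for surjectivity; on a finite type this gives bijectivity.
  exact ⟨Equiv.ofBijective f ⟨Finite.injective_iff_surjective.mpr hsurj, hsurj⟩, hf⟩

theorem Candidate.isTrueTriangle {X₀ Y₀ : Fin n → ℝ} {X Y : ℕ → ℝ} {V0 V : ℝ} {p q r : ℝ × ℝ}
    (hC : Coords L d0 d1 h X₀ Y₀) {π : Equiv.Perm (Fin n)}
    (hπ : ∀ u : Fin n, X u = X₀ (π u) ∧ Y u = Y₀ (π u)) (hK : Candidate X Y n h V0 V p q r)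
    {P Q R : Plane} (hP : coord d0 d1 P = p) (hQ : coord d0 d1 Q = q) (hR : coord d0 d1 R = r) :
    IsTrueTriangle L P Q R ∧ triangleArea P Q R = V / (2 * (d0 * d0 + d1 * d1)) := by
  obtain ⟨-, -, i, j, k, a, b, c, ⟨hi, hj, hk⟩, ⟨hij, hjk, hik⟩, ⟨ha, hb, hc⟩, ⟨rfl, rfl, rfl⟩,
    rfl⟩ := hK
  have key : ∀ (u : Fin n) {e : ℝ} {Z : Plane}, (e = 0 ∨ e = h) →
      coord d0 d1 Z = (X u, Y u + e) → Z ∈ (L (π u)).carrier := by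
    intro u e Z he hZ
    obtain ⟨z, -, hz, hz'⟩ := hC.exists_endpoint (π u) he
    rw [(hπ u).1, (hπ u).2, ← hz'] at hZ
    rwa [coord_injective hC.D_pos hZ]
  have hne : ∀ {u v : ℕ} (hu : u < n) (hv : v < n), u ≠ v → π ⟨u, hu⟩ ≠ π ⟨v, hv⟩ :=
    fun hu hv huv he => huv (Fin.mk.inj (π.injective he))
  refine ⟨⟨_, _, _, hne hi hj hij, hne hj hk hjk, hne hi hk hik, key ⟨i, hi⟩ ha hP,
    key ⟨j, hj⟩ hb hQ, key ⟨k, hk⟩ hc hR⟩, ?_⟩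
  rw [triangleArea_eq_cr hC.D_pos, hP, hQ, hR]

theorem Coords.triangleArea_le {X₀ Y₀ : Fin n → ℝ} {X Y : ℕ → ℝ} {V : ℝ}
    (hC : Coords L d0 d1 h X₀ Y₀) {π : Equiv.Perm (Fin n)}
    (hπ : ∀ u : Fin n, X u = X₀ (π u) ∧ Y u = Y₀ (π u))
    (hV : ∀ (i j k : Fin n) {a b c : ℝ}, 0 ≤ a ∧ a ≤ h → 0 ≤ b ∧ b ≤ h → 0 ≤ c ∧ c ≤ h →
      |cr (X i, Y i + a) (X j, Y j + b) (X k, Y k + c)| ≤ V) {p q r : Plane}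
    (hp : p ∈ endpoints L) (hq : q ∈ endpoints L) (hr : r ∈ endpoints L) :
    triangleArea p q r ≤ V / (2 * (d0 * d0 + d1 * d1)) := by
  have key : ∀ {z : Plane}, z ∈ endpoints L → ∃ (u : Fin n) (a : ℝ), (0 ≤ a ∧ a ≤ h) ∧
      coord d0 d1 z = (X u, Y u + a) := by
    intro z hz
    obtain ⟨i, a, ha, -, he⟩ := hC.exists_of_mem hz
    refine ⟨π.symm i, a, ha, ?_⟩
    rw [(hπ _).1, (hπ _).2, π.apply_symm_apply, he]
  obtain ⟨i, a, ha, hp'⟩ := key hp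
  obtain ⟨j, b, hb, hq'⟩ := key hq
  obtain ⟨k, c, hc, hr'⟩ := key hr
  have hD := hC.D_pos
  rw [triangleArea_eq_cr hD, hp', hq', hr']
  exact div_le_div_of_nonneg_right (hV i j k ha hb hc) (by positivity)

/-- A bound for the running time of the program on `n` segments. -/
def timeBound (n : ℕ) : ℕ := (Nat.log 2 n + 2) * (10000 * n + 4000)

theorem timeBound_isBigO :
    (fun n : ℕ => (timeBound n : ℝ)) =O[Filter.atTop] (fun n : ℕ => (n : ℝ) * Real.log n) := by
  refine Asymptotics.IsBigO.of_bound 60000 ?_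
  filter_upwards [Filter.eventually_ge_atTop 3] with n hn
  have hn3 : (3 : ℝ) ≤ n := by exact_mod_cast hn
  have hlog2 : (0.69 : ℝ) ≤ Real.log 2 := by linarith [Real.log_two_gt_d9]
  have hlog1 : 1 ≤ Real.log n := by
    rw [Real.le_log_iff_exp_le (by linarith)]
    linarith [Real.exp_one_lt_d9]
  have hpow : Real.log ((2 ^ Nat.log 2 n : ℕ) : ℝ) ≤ Real.log n :=
    Real.log_le_log (by positivity) (by exact_mod_cast Nat.pow_log_le_self 2 (by omega))
  push_cast at hpow
  rw [Real.log_pow] at hpow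
  have hl0 : (0 : ℝ) ≤ Nat.log 2 n := Nat.cast_nonneg _
  -- `Real.log 2` exceeds one half. For `n ≥ 3` also `1 ≤ Real.log n`, so the factors are at most `4
  -- * Real.log n` and `15000 * n`, whence the constant 60000.
  have hl : (Nat.log 2 n : ℝ) ≤ 2 * Real.log n := by nlinarith
  rw [Real.norm_of_nonneg (Nat.cast_nonneg _), Real.norm_of_nonneg (by positivity), timeBound]
  push_cast
  have h1 : (Nat.log 2 n : ℝ) + 2 ≤ 4 * Real.log n := by linarith
  have h2 : 10000 * (n : ℝ) + 4000 ≤ 15000 * n := by linarith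
  calc ((Nat.log 2 n : ℝ) + 2) * (10000 * n + 4000) ≤ (4 * Real.log n) * (15000 * n) :=
        mul_le_mul h1 h2 (by positivity) (by linarith)
    _ = 60000 * (n * Real.log n) := by ring

set_option maxRecDepth 10000 in
theorem maxMaxArea_spec {d : Plane} (hn3 : 3 ≤ n) (hpar : ParallelTo d L) (hL : EqualLength L)
    (hdis : PairwiseDisjoint L) :
    WP Code.maxMaxArea (fun s _ => IsOutput L s) (initState L) (timeBound n) := by
  have hn0 : 0 < n := by omega
  -- The budget splits into sorting, the two searches and a remainder that covers the linear and
  -- constant stages.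
  have htime : timeBound n = (Nat.log 2 n + 1) * (150 * n + 100) +
      (Nat.log 2 n + 2) * (8000 * n + 2900) +
      (1850 * (n * Nat.log 2 n) + 3850 * n + 1000 * Nat.log 2 n + 2100) := by
    rw [timeBound]; ring
  generalize timeBound n = T at htime
  have hS : (Nat.log 2 n + 1) * (150 * n + 100) + (Nat.log 2 n + 2) * (8000 * n + 2900) +
      100 * n + 2000 ≤ T := by
    rw [htime, Nat.add_assoc _ (100 * n)]
    refine Nat.add_le_add_left ?_ _
    have : 0 ≤ n * Nat.log 2 n := Nat.zero_le _
    omega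
  clear htime
  have hi : ∀ i : Fin n, (initState L).rarr 0 i = (L i).1 0 ∧ (initState L).rarr 1 i = (L i).1 1 ∧
      (initState L).rarr 2 i = (L i).2 0 ∧ (initState L).rarr 3 i = (L i).2 1 := fun i => by
    simp [initState]
  have n0 : (initState L).nreg 0 = n := by simp [initState]
  generalize hA : (Nat.log 2 n + 1) * (150 * n + 100) = A at hS
  generalize hB : (Nat.log 2 n + 2) * (8000 * n + 2900) = B at hS
  refine WP.seq ((direction_spec (by omega)).frame.mono ?_)
  rintro s1 t1 ⟨⟨ht1, hD, hD1, hdir⟩, hF1⟩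
  have n1 : s1.nreg 0 = n := (hF1.n 0 rfl).trans n0
  have a10 : s1.rarr 0 = _ := hF1.ra 0 rfl
  have a11 : s1.rarr 1 = _ := hF1.ra 1 rfl
  have a12 : s1.rarr 2 = _ := hF1.ra 2 rfl
  have a13 : s1.rarr 3 = _ := hF1.ra 3 rfl
  rw [hD1, (hi ⟨0, hn0⟩).1, (hi ⟨0, hn0⟩).2.1, (hi ⟨0, hn0⟩).2.2.1,
    (hi ⟨0, hn0⟩).2.2.2] at hdir
  have hC := coords_of_direction hpar hL hdis hn0 hD hdir
  refine WP.seq ((coordinates_spec n1 (by omega)).frame.mono ?_)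
  rintro s2 t2 ⟨⟨ht2, hc2⟩, hF2⟩
  have n2 : s2.nreg 0 = n := (hF2.n 0 rfl).trans n1
  refine WP.seq ((sort_spec n2 (by omega)).frame.mono ?_)
  rintro s3 t3 ⟨⟨ht3, hp3, hs3⟩, hF3⟩
  have n3 : s3.nreg 0 = n := (hF3.n 0 rfl).trans n2
  have h3 : s3.rreg 13 = s1.rreg 13 := (hF3.r 13 rfl).trans (hF2.r 13 rfl)
  refine WP.seq ((initBest_spec n3 hn3 h3 hC.h_nonneg hs3 (by omega)).frame.mono ?_)
  rintro s4 t4 ⟨⟨ht4, hK4⟩, hF4⟩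
  have n4 : s4.nreg 0 = n := (hF4.n 0 rfl).trans n3
  have h4 : s4.rreg 13 = s1.rreg 13 := (hF4.r 13 rfl).trans h3
  have a44 : s4.rarr 4 = s3.rarr 4 := hF4.ra 4 rfl
  have a45 : s4.rarr 5 = s3.rarr 5 := hF4.ra 5 rfl
  rw [← a44, ← a45] at hK4
  refine WP.seq ((searchBoth_spec n4 hn3 h4 hC.h_nonneg (by rwa [a44]) hK4
    (by omega)).frame.mono ?_)
  rintro s5 t5 ⟨⟨ht5, hK5, hV5⟩, hF5⟩
  have e10 : s5.rreg 10 = s1.rreg 10 :=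
    (hF5.r 10 rfl).trans ((hF4.r 10 rfl).trans ((hF3.r 10 rfl).trans (hF2.r 10 rfl)))
  have e11 : s5.rreg 11 = s1.rreg 11 :=
    (hF5.r 11 rfl).trans ((hF4.r 11 rfl).trans ((hF3.r 11 rfl).trans (hF2.r 11 rfl)))
  have e12 : s5.rreg 12 = s1.rreg 12 :=
    (hF5.r 12 rfl).trans ((hF4.r 12 rfl).trans ((hF3.r 12 rfl).trans (hF2.r 12 rfl)))
  rw [a44, a45] at hK5 hV5
  refine (output_spec (by omega)).mono ?_
  rintro s6 - ⟨o0, o1, o2, o3, o4, o5, o6⟩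
  rw [e10, e11, e12, hD1] at *
  rw [e12, hD1] at o0
  obtain ⟨π, hπ⟩ := exists_perm_of_pts_eq hC.inj (X' := s2.rarr 4) (Y' := s2.rarr 5)
    (fun i => by
      obtain ⟨hx, hy⟩ := hc2 i i.2
      rw [hx, hy, a10, a11, a12, a13, (hi i).1, (hi i).2.1, (hi i).2.2.1, (hi i).2.2.2]
      exact ⟨rfl, rfl⟩) hp3
  have hmain := Candidate.isTrueTriangle hC hπ hK5 (coord_back hD _) (coord_back hD _)
    (coord_back hD _)
  simp only [← o0, ← o1, ← o2, ← o3, ← o4, ← o5, ← o6] at hmain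
  obtain ⟨htrue, harea⟩ := hmain
  refine ⟨?_, htrue, harea⟩
  rw [← harea]
  refine (isMaxMaxArea_of_isTrueTriangle htrue fun p hp q hq r hr => ?_).1
  rw [harea, o0]
  exact hC.triangleArea_le hπ hV5 hp hq hr

end correct

end ImpreciseTriangle

end

theorem mainTheorem5 :
    -- if the upper endpoints are not collinear, every largest-area triangle on the endpoints is
    -- true, and MaxMaxArea is solved by a true triangle on the vertices of the convex hull
    (∀ (n : ℕ) (L : Fin n → ImpreciseTriangle.Seg) (d : ImpreciseTriangle.Plane), d ≠ 0 →
      ImpreciseTriangle.ParallelTo d L → ImpreciseTriangle.EqualLength L →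
      ImpreciseTriangle.PairwiseDisjoint L →
      ¬ Collinear ℝ (Set.range fun i => (L i).upper d) →
      (∀ p ∈ ImpreciseTriangle.endpoints L, ∀ q ∈ ImpreciseTriangle.endpoints L,
        ∀ r ∈ ImpreciseTriangle.endpoints L,
        IsGreatest (ImpreciseTriangle.triangleAreasIn (ImpreciseTriangle.endpoints L))
          (ImpreciseTriangle.triangleArea p q r) →
        ImpreciseTriangle.IsTrueTriangle L p q r) ∧
      (∃ p ∈ (ImpreciseTriangle.hull L).extremePoints ℝ,
        ∃ q ∈ (ImpreciseTriangle.hull L).extremePoints ℝ,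
        ∃ r ∈ (ImpreciseTriangle.hull L).extremePoints ℝ,
        ImpreciseTriangle.IsTrueTriangle L p q r ∧
        ImpreciseTriangle.IsMaxMaxArea L (ImpreciseTriangle.triangleArea p q r))) ∧
    -- MaxMaxArea asks for the area of a largest triangle inscribed in the convex hull
    (∀ (n : ℕ) (L : Fin n → ImpreciseTriangle.Seg) (d : ImpreciseTriangle.Plane), 3 ≤ n → d ≠ 0 →
      ImpreciseTriangle.ParallelTo d L → ImpreciseTriangle.EqualLength L →
      ImpreciseTriangle.PairwiseDisjoint L →
      ∀ M : ℝ, ImpreciseTriangle.IsMaxMaxArea L M ↔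
        IsGreatest (ImpreciseTriangle.triangleAreasIn (ImpreciseTriangle.hull L)) M) ∧
    -- one program solves MaxMaxArea in time O(n log n)
    (∃ (c : ImpreciseTriangle.Prog) (T : ℕ → ℕ),
      (fun n : ℕ => (T n : ℝ)) =O[Filter.atTop] (fun n : ℕ => (n : ℝ) * Real.log n) ∧
      ∀ (n : ℕ) (L : Fin n → ImpreciseTriangle.Seg) (d : ImpreciseTriangle.Plane), 3 ≤ n → d ≠ 0 →
        ImpreciseTriangle.ParallelTo d L → ImpreciseTriangle.EqualLength L →
        ImpreciseTriangle.PairwiseDisjoint L →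
        ∃ (t : ℕ) (s : ImpreciseTriangle.RAMState),
          ImpreciseTriangle.Exec c (ImpreciseTriangle.initState L) t s ∧ t ≤ T n ∧
          ImpreciseTriangle.IsOutput L s) := by
  refine ⟨fun n L d hd hpar hL hdis hcol =>
      ImpreciseTriangle.isTrueTriangle_and_exists_extreme hd hpar hL hdis hcol,
    fun n L d hn hd hpar hL hdis M => ImpreciseTriangle.isMaxMaxArea_iff hn hd hpar hL hdis M,
    ImpreciseTriangle.Code.maxMaxArea, ImpreciseTriangle.timeBound,
    ImpreciseTriangle.timeBound_isBigO, fun n L d hn _ hpar hL hdis => ?_⟩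
  obtain ⟨t, s, h1, h2, h3⟩ := ImpreciseTriangle.maxMaxArea_spec hn hpar hL hdis
  exact ⟨t, s, h1, h2, h3⟩
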